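/- Let $\Sigma$ be an irreducible (reduced, crystallographic) root system of rank $r$ in a real vector space, let $\{\alpha_1,\dots,\alpha_r\}$ be a simple system of $\Sigma$ with set of positive roots $\Sigma^+$, and let $\alpha_0$ be the corresponding lowest root, so that $\{\alpha_0,\alpha_1,\dots,\alpha_r\}$ is the extended simple system. For a proper subset $J$ of $\{0,\dots,r\}$ let $\Sigma_J$ be the set of roots that are integral combinations of the $\alpha_j$, $j\in J$ (the root subsystem with simple system $\{\alpha_j: j\in J\}$), and let $\Sigma_J^+$ be the set of those roots in $\Sigma_J$ that are nonnegative integral combinations of the $\alpha_j$, $j\in J$. For a permutation $\mathcal P=(j_0,j_1,\dots,j_r)$ of $\{0,\dots,r\}$ and $i=0,1,\dots,r$ put $I_i=\{j_{i+1},\dots,j_r\}$ (so $I_r=\emptyset$), $$n_i(\mathcal P)=|\Sigma^+|-|\Sigma^+_{I_i}|,\qquad q_i(\mathcal P)=n_i(\mathcal P)-n_{i-1}(\mathcal P),\qquad n_{-1}(\mathcal P)=0.$$ Call $\mathcal P_0$ optimal if $n_i(\mathcal P_0)\le n_i(\mathcal P)$ for every permutation $\mathcal P$ of $\{0,\dots,r\}$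 and every $i=0,\dots,r$. Then: (1) An optimal permutation $\mathcal P_0$ exists. (2) The numbers $q_{i,0}=q_i(\mathcal P_0)$ are the same for all optimal $\mathcal P_0$. One has $q_{0,0}=0$, the root system $\Sigma$ has one of the types listed below, and $q_{1,0},\dots,q_{r,0}$ are, according to its type: - $A_r$ ($r\ge1$): $r,r-1,\dots,2,1$; - $B_r$ ($r\ge2$) and $C_r$ ($r\ge3$): $2r-1,2r-3,\dots,3,1$; - $D_r$ ($r\ge4$): $2r-2,2r-4,\dots,8,6,3,2,1$ (for $r=4$: $6,3,2,1$); - $E_6$: $16,8,6,3,2,1$; - $E_7$: $27,16,8,6,3,2,1$; - $E_8$: $57,27,16,8,6,3,2,1$; - $F_4$: $15,5,3,1$; - $G_2$: $5,1$. Moreover, if $\alpha_1,\dots,\alpha_r$ are numbered as in the standard (Bourbaki) Dynkin diagram, except that in type $G_2$ the simple root $\alpha_1$ is the long one, then an optimal permutation is $\mathcal P_0=(0,j_{1,0},\dots,j_{r,0})$, where $(j_{1,0},\dots,j_{r,0})$ is $(1,2,\dots,r)$ for $A_r,B_r,C_r,G_2$; $(1,2,\dots,r-3,r-1,r-2,r)$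 for $D_r$; $(1,6,2,3,4,5)$ for $E_6$; $(7,1,6,2,3,4,5)$ for $E_7$; $(8,7,1,6,2,3,4,5)$ for $E_8$; $(1,4,2,3)$ for $F_4$. (3) $q_{1,0}>q_{2,0}>\cdots>q_{r,0}=1$. -/

import Mathlib

namespace RootPeeling

/-- The Dynkin types of irreducible root systems of rank `r`, without repetitions:
`A_r (r ≥ 1)`, `B_r (r ≥ 2)`, `C_r (r ≥ 3)`, `D_r (r ≥ 4)`, `E₆`, `E₇`, `E₈`, `F₄`, `G₂`. -/
inductive DynkinType : ℕ → Type
  | A (r : ℕ) (hr : 1 ≤ r) : DynkinType r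
  | B (r : ℕ) (hr : 2 ≤ r) : DynkinType r
  | C (r : ℕ) (hr : 3 ≤ r) : DynkinType r
  | D (r : ℕ) (hr : 4 ≤ r) : DynkinType r
  | E₆ : DynkinType 6
  | E₇ : DynkinType 7
  | E₈ : DynkinType 8
  | F₄ : DynkinType 4
  | G₂ : DynkinType 2

namespace DynkinType

/-- The Cartan matrix of a type. The entry `i j : Fin r` is `⟨α_{i+1}, α_{j+1}^∨⟩`, for the
usual labelling `α_1, …, α_r` of the Dynkin diagram. -/
def cartanMatrix : {r : ℕ} → DynkinType r → Matrix (Fin r) (Fin r) ℤ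
  | _, .A r _ => CartanMatrix.A r
  | _, .B r _ => CartanMatrix.B r
  | _, .C r _ => CartanMatrix.C r
  | _, .D r _ => CartanMatrix.D r
  | _, .E₆ => CartanMatrix.E₆
  | _, .E₇ => CartanMatrix.E₇
  | _, .E₈ => CartanMatrix.E₈
  | _, .F₄ => CartanMatrix.F₄
  | _, .G₂ => CartanMatrix.G₂

/-- The list `q_{1,0}, …, q_{r,0}` of a type; the value at `i : Fin r` is `q_{i+1,0}`. -/
def optimalNumbers : {r : ℕ} → DynkinType r → Fin r → ℕ
  | _, .A r _ => fun i => r - i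
  | _, .B r _ => fun i => 2 * r - 1 - 2 * i
  | _, .C r _ => fun i => 2 * r - 1 - 2 * i
  | _, .D r _ => fun i => if (i : ℕ) + 3 < r then 2 * r - 2 - 2 * i else r - i
  | _, .E₆ => ![16, 8, 6, 3, 2, 1]
  | _, .E₇ => ![27, 16, 8, 6, 3, 2, 1]
  | _, .E₈ => ![57, 27, 16, 8, 6, 3, 2, 1]
  | _, .F₄ => ![15, 5, 3, 1]
  | _, .G₂ => ![5, 1]

/-- The list `j_{0,0} = 0, j_{1,0}, …, j_{r,0}` of labels of a type, in the order in which the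
nodes of the extended Dynkin diagram are removed. For `D_r` it is
`0, 1, …, r-3, r-1, r-2, r`. -/
def optimalOrder : {r : ℕ} → DynkinType r → Fin (r + 1) → Fin (r + 1)
  | _, .A _ _ => id
  | _, .B _ _ => id
  | _, .C _ _ => id
  | _, .D r _ => Equiv.swap ⟨r - 2, by omega⟩ ⟨r - 1, by omega⟩
  | _, .E₆ => ![0, 1, 6, 2, 3, 4, 5]
  | _, .E₇ => ![0, 7, 1, 6, 2, 3, 4, 5]
  | _, .E₈ => ![0, 8, 7, 1, 6, 2, 3, 4, 5]
  | _, .F₄ => ![0, 1, 4, 2, 3]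
  | _, .G₂ => id

end DynkinType

section

variable {ι M N : Type*} [AddCommGroup M] [Module ℝ M] [AddCommGroup N] [Module ℝ N]

/-- `α_0, α_1, …, α_r` is the extended simple system of the base `b`: `α_1, …, α_r` are the
simple roots, each listed once, and `α_0` is the lowest root, i.e. the root such that `β - α_0`
is a nonnegative integral combination of simple roots for every root `β`. -/
structure IsExtendedSimpleSystem {Φ : RootPairing ι ℝ M N} (b : Φ.Base) {r : ℕ}
    (α : Fin (r + 1) → ι) : Prop where
  bijOn_succ : Set.BijOn (fun j : Fin r => α j.succ) Set.univ (b.support : Set ι)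
  lowest : ∀ i : ι,
    Φ.root i - Φ.root (α 0) ∈ AddSubmonoid.closure (Φ.root '' (b.support : Set ι))

/-- `Σ_J`, for `J` a proper subset of `{0, …, r}`: the roots that are integral combinations of
`α_j`, `j ∈ J` (integral and not real: if `J` has `r` elements, the `α_j`, `j ∈ J`, span the
whole space over `ℝ`). -/
def parabolic (Φ : RootPairing ι ℝ M N) {r : ℕ} (α : Fin (r + 1) → ι)
    (J : Set (Fin (r + 1))) : Set ι :=
  {i | Φ.root i ∈ AddSubgroup.closure ((fun j => Φ.root (α j)) '' J)}

/-- `Σ_J^+`, for `J` a proper subset of `{0, …, r}`: the roots of `Σ_J` that are positive with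
respect to its simple system `{α_j, j ∈ J}`. -/
def parabolicPos (Φ : RootPairing ι ℝ M N) {r : ℕ} (α : Fin (r + 1) → ι)
    (J : Set (Fin (r + 1))) : Set ι :=
  {i ∈ parabolic Φ α J | Φ.root i ∈ AddSubmonoid.closure ((fun j => Φ.root (α j)) '' J)}

/-- `I_i(p) = {j_{i+1}, …, j_r}` for the permutation `p = (j_0, …, j_r)`, `j_k = p k`. -/
def remaining {r : ℕ} (p : Equiv.Perm (Fin (r + 1))) (i : Fin (r + 1)) : Set (Fin (r + 1)) :=
  p '' {k | i < k}

variable [Finite ι] {Φ : RootPairing ι ℝ M N}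

/-- `n_i(p) = |Σ^+| - |Σ^+_{I_i}|`, `i = 0, …, r`. -/
noncomputable def peeled (b : Φ.Base) {r : ℕ} (α : Fin (r + 1) → ι)
    (p : Equiv.Perm (Fin (r + 1))) (i : Fin (r + 1)) : ℤ :=
  ({i : ι | b.IsPos i}.ncard : ℤ) - ((parabolicPos Φ α (remaining p i)).ncard : ℤ)

/-- The peeling numbers `q_0(p) = n_0(p)` and `q_i(p) = n_i(p) - n_{i-1}(p)`,
`i = 1, …, r`. -/
noncomputable def peelingNumber (b : Φ.Base) {r : ℕ} (α : Fin (r + 1) → ι)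
    (p : Equiv.Perm (Fin (r + 1))) : Fin (r + 1) → ℤ :=
  Fin.cases (peeled b α p 0) (fun i => peeled b α p i.succ - peeled b α p i.castSucc)

/-- The peeling inequality `n_i(p₀) ≤ n_i(p)` holds for every permutation `p` and every `i`. -/
def IsOptimalPeeling (b : Φ.Base) {r : ℕ} (α : Fin (r + 1) → ι)
    (p₀ : Equiv.Perm (Fin (r + 1))) : Prop :=
  ∀ (p : Equiv.Perm (Fin (r + 1))) (i : Fin (r + 1)), peeled b α p₀ i ≤ peeled b α p i

/-- The simple roots relabelled by `σ`, in the order `α_{σ 1}, …, α_{σ r}`, have the Cartan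
matrix of type `T`; the label of the lowest root stays `0`. -/
def IsLabelling (Φ : RootPairing ι ℝ M N) [Φ.IsCrystallographic] {r : ℕ} (α : Fin (r + 1) → ι)
    (T : DynkinType r) (σ : Equiv.Perm (Fin (r + 1))) : Prop :=
  σ 0 = 0 ∧ ∀ i j : Fin r,
    Φ.pairingIn ℤ (α (σ i.succ)) (α (σ j.succ)) = T.cartanMatrix i j

end

end RootPeeling

namespace RootPeeling

open Matrix

/-- The combinatorial property of a Cartan matrix that is equivalent to the root system being
finite. -/
def IsFiniteType {I : Type*} [Fintype I] (A : Matrix I I ℤ) : Prop :=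
  ∀ c : I → ℤ, 0 ≤ c → c ≠ 0 → ∃ i, 0 < c i ∧ 0 < ∑ j, c j * A j i

theorem IsFiniteType.submatrix {I K : Type*} [Fintype I] [Fintype K] {A : Matrix I I ℤ}
    (hA : IsFiniteType A) {f : K → I} (hf : Function.Injective f) :
    IsFiniteType (A.submatrix f f) := by
  classical
  intro c hc hc0
  have hext : ∀ k, Function.extend f c 0 (f k) = c k := fun k => hf.extend_apply _ _ _
  obtain ⟨i, hi, hs⟩ := hA (Function.extend f c 0) (fun i => by
      by_cases h : ∃ k, f k = i
      · obtain ⟨k, rfl⟩ := h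
        rw [hext]; exact hc k
      · rw [Function.extend_apply' _ _ _ h]) (fun h => hc0 <| by
      ext k
      rw [← hext, h]; rfl)
  have h : ∃ k, f k = i := by
    by_contra h
    rw [Function.extend_apply' _ _ _ h] at hi
    exact lt_irrefl _ hi
  obtain ⟨k, rfl⟩ := h
  refine ⟨k, by rwa [hext] at hi, ?_⟩
  convert hs using 1
  rw [← Finset.sum_subset (Finset.subset_univ (Finset.univ.image f)),
    Finset.sum_image (fun a _ b _ h => hf h)]
  · simp [hext]
  · intro x _ hx
    rw [Function.extend_apply', Pi.zero_apply, zero_mul]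
    rintro ⟨k, rfl⟩
    simp at hx

/-- Connected Cartan matrices of finite type. -/
structure IsConnectedCartan {I : Type*} [Fintype I] (A : Matrix I I ℤ) : Prop where
  diag : ∀ i, A i i = 2
  nonpos : ∀ i j, i ≠ j → A i j ≤ 0
  zero_symm : ∀ i j, A i j = 0 → A j i = 0
  conn : ∀ p : I → Prop, (∃ i, p i) → (∀ i j, p i → A j i ≠ 0 → p j) → ∀ j, p j
  finite : IsFiniteType A

namespace IsConnectedCartan

variable {I : Type*} [Fintype I] {A : Matrix I I ℤ}

theorem exists_leaf (hA : IsConnectedCartan A) (hI : 2 ≤ Fintype.card I) :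
    ∃ x y, x ≠ y ∧ A y x = -1 ∧ ∀ z, z ≠ x → z ≠ y → A z x = 0 := by
  classical
  have : Nontrivial I := Fintype.one_lt_card_iff_nontrivial.mp (by omega)
  obtain ⟨x, -, hx⟩ := hA.finite 1 zero_le_one one_ne_zero
  simp only [Pi.one_apply, one_mul] at hx
  obtain ⟨y, hxy, hy⟩ : ∃ y, x ≠ y ∧ A y x ≠ 0 := by
    by_contra! h
    obtain ⟨y, hy⟩ := exists_ne x
    refine hy (hA.conn (· = x) ⟨x, rfl⟩ ?_ y)
    rintro i j rfl hj
    by_contra hne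
    exact hj (h j (Ne.symm hne))
  have hy' : A y x ≤ -1 := by
    have := hA.nonpos y x hxy.symm
    omega
  rw [← Finset.add_sum_erase _ _ (Finset.mem_univ x), hA.diag,
    ← Finset.add_sum_erase _ _ (show y ∈ Finset.univ.erase x by simp [hxy.symm])] at hx
  have hle : ∑ z ∈ (Finset.univ.erase x).erase y, A z x ≤ 0 :=
    Finset.sum_nonpos fun z hz => hA.nonpos _ _ (by simp at hz; exact hz.2)
  refine ⟨x, y, hxy, by omega, fun z hzx hzy => ?_⟩
  have hz := hA.nonpos z x hzx
  have : ∑ z ∈ (Finset.univ.erase x).erase y, A z x ≤ A z x := by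
    rw [← Finset.add_sum_erase _ _ (show z ∈ (Finset.univ.erase x).erase y by simp [hzx, hzy])]
    have : ∑ w ∈ (((Finset.univ.erase x).erase y).erase z), A w x ≤ 0 :=
      Finset.sum_nonpos fun w hw => hA.nonpos _ _ (by simp at hw; exact hw.2.2)
    omega
  omega

theorem mul_lt_four (hA : IsConnectedCartan A) {x y : I} (hxy : x ≠ y) :
    A x y * A y x < 4 := by
  classical
  by_contra! h
  have h1 := hA.nonpos x y hxy
  have h2 := hA.nonpos y x hxy.symm
  have hinj : Function.Injective ![x, y] := by
    intro a b
    fin_cases a <;> fin_cases b <;> simp [hxy, hxy.symm]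
  obtain ⟨i, hi, hs⟩ := hA.finite.submatrix hinj ![-A y x, 2]
    (by intro i; fin_cases i <;> simp; omega) (by intro h; simpa using congrFun h 1)
  fin_cases i
  · simp [Fin.sum_univ_two, hA.diag] at hs
    omega
  · simp [Fin.sum_univ_two, hA.diag] at hs
    nlinarith

/-- Removing a leaf. -/
theorem erase [DecidableEq I] (hA : IsConnectedCartan A) {x y : I} (hxy : x ≠ y)
    (h : ∀ z, z ≠ x → z ≠ y → A z x = 0) :
    IsConnectedCartan
      (A.submatrix (Subtype.val : {z // z ≠ x} → I) (Subtype.val : {z // z ≠ x} → I)) where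
  diag i := hA.diag i
  nonpos i j hij := hA.nonpos i j (fun h => hij (Subtype.ext h))
  zero_symm i j := hA.zero_symm i j
  finite := hA.finite.submatrix Subtype.val_injective
  conn p hp hc j := by
    let q : I → Prop := fun i => (∃ h : i ≠ x, p ⟨i, h⟩) ∨ (i = x ∧ p ⟨y, hxy.symm⟩)
    have hq : ∀ j, q j := by
      refine hA.conn q ?_ ?_
      · obtain ⟨i, hi⟩ := hp
        exact ⟨i, Or.inl ⟨i.2, hi⟩⟩
      · intro u v hu huv
        by_cases hvx : v = x
        · refine Or.inr ⟨hvx, ?_⟩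
          rw [hvx] at huv
          rcases hu with ⟨hne, hu⟩ | ⟨-, hu⟩
          · have huy : u = y := by
              by_contra huy
              exact huv (hA.zero_symm _ _ (h u hne huy))
            simpa only [huy] using hu
          · exact hu
        · refine Or.inl ⟨hvx, ?_⟩
          rcases hu with ⟨hne, hu⟩ | ⟨hux, hu⟩
          · exact hc ⟨u, hne⟩ ⟨v, hvx⟩ hu huv
          · have hvy : v = y := by
              by_contra hvy
              exact huv (hux ▸ h v hvx hvy)
            simpa only [hvy] using hu
    rcases hq j with ⟨_, h⟩ | ⟨h, _⟩
    · exact h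
    · exact absurd h j.2

end IsConnectedCartan

/-- The Cartan matrix obtained by joining a new node, of index `0`, to the node `k` by a bond of
multiplicity `m`, the new simple root being the longer one. -/
def attachLeaf {n : ℕ} (M : Matrix (Fin n) (Fin n) ℤ) (k : Fin n) (m : ℤ) :
    Matrix (Fin (n + 1)) (Fin (n + 1)) ℤ :=
  fun i j => Fin.cases (Fin.cases 2 (fun j => if j = k then -m else 0) j)
    (fun i => Fin.cases (if i = k then -1 else 0) (fun j => M i j) j) i

section attachLeaf

variable {n : ℕ} (M : Matrix (Fin n) (Fin n) ℤ) (k : Fin n) (m : ℤ)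

@[simp] theorem attachLeaf_zero_zero : attachLeaf M k m 0 0 = 2 := rfl

@[simp] theorem attachLeaf_zero_succ (j : Fin n) :
    attachLeaf M k m 0 j.succ = if j = k then -m else 0 := rfl

@[simp] theorem attachLeaf_succ_zero (i : Fin n) :
    attachLeaf M k m i.succ 0 = if i = k then -1 else 0 := rfl

@[simp] theorem attachLeaf_succ_succ (i j : Fin n) : attachLeaf M k m i.succ j.succ = M i j := rfl

end attachLeaf

variable {n : ℕ} {M : Matrix (Fin n) (Fin n) ℤ} {k : Fin n} {m : ℤ}

theorem not_isFiniteType_attachLeaf (h : IsFiniteType (attachLeaf M k m)) (m₀ c₀ : ℤ)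
    (c : Fin n → ℤ) (hm : m₀ ≤ m) (hc₀ : 0 < c₀) (hc : ∀ i, 0 ≤ c i) (hk : 2 * c₀ ≤ c k)
    (hs : ∀ i, 0 < c i → ∑ j, c j * M j i ≤ if i = k then m₀ * c₀ else 0) : False := by
  obtain ⟨i, hi, hi'⟩ := h (Fin.cons c₀ c)
    (by intro i; induction i using Fin.cases <;> simp [hc, hc₀.le])
    (by intro h; have := congrFun h 0; simp at this; omega)
  induction i using Fin.cases with
  | zero =>
    simp [Fin.sum_univ_succ] at hi'
    omega
  | succ i =>
    simp only [Fin.cons_succ] at hi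
    have := hs i hi
    simp only [Fin.sum_univ_succ, Fin.cons_zero, attachLeaf_zero_succ, Fin.cons_succ,
      attachLeaf_succ_succ] at hi'
    split_ifs at this hi'
    · nlinarith
    · omega

/-- An injection of diagrams carrying the node `k'` to `k` extends to the diagrams with a new
node. -/
theorem IsFiniteType.of_attachLeaf (h : IsFiniteType (attachLeaf M k m)) {n' : ℕ}
    {M' : Matrix (Fin n') (Fin n') ℤ} (f : Fin n' → Fin n) (k' : Fin n')
    (hf : Function.Injective f) (hk : f k' = k) (hM : ∀ i j, M (f i) (f j) = M' i j) :
    IsFiniteType (attachLeaf M' k' m) := by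
  have hinj : Function.Injective (Fin.cons 0 (Fin.succ ∘ f) : Fin (n' + 1) → Fin (n + 1)) := by
    rw [Fin.cons_injective_iff]
    exact ⟨by simp, (Fin.succ_injective _).comp hf⟩
  convert h.submatrix hinj using 1
  ext i j
  have hk' : ∀ i, f i = k ↔ i = k' := fun i => by rw [← hk, hf.eq_iff]
  induction i using Fin.cases <;> induction j using Fin.cases <;> simp [hk', hM]

/-- The diagrams of finite type with a new node that has multiplicity `m` at `k`: neighbours of
`k` in `M` leave little room. -/
theorem star_bound (h : IsFiniteType (attachLeaf M k m)) (hd : ∀ i, M i i = 2)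
    (hn : ∀ i j, i ≠ j → M i j ≤ 0) (S : Finset (Fin n))
    (hS : ∀ j ∈ S, j ≠ k ∧ M k j ≤ -1) : m < 4 + ∑ j ∈ S, M j k := by
  by_contra! hcon
  have hkS : k ∉ S := fun h => (hS k h).1 rfl
  let c : Fin n → ℤ := fun j => if j = k then 2 else if j ∈ S then 1 else 0
  have hc : ∀ i, 0 ≤ c i := fun i => by simp only [c]; split_ifs <;> simp
  refine not_isFiniteType_attachLeaf h m 1 c le_rfl one_pos hc (by simp [c]) fun i hi => ?_
  have key : ∀ i, ∑ j, c j * M j i = 2 * M k i + ∑ j ∈ S, M j i := by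
    intro i
    rw [← Finset.add_sum_erase _ _ (Finset.mem_univ k)]
    congr 1
    · simp [c]
    · rw [← Finset.sum_subset (s₁ := S)]
      · refine Finset.sum_congr rfl fun j hj => ?_
        simp [c, hj, (hS j hj).1]
      · intro j hj
        simp [(hS j hj).1]
      · intro j hj hjS
        simp at hj
        simp [c, hj, hjS]
  rw [key]
  by_cases hik : i = k
  · subst hik
    simp [hd]
    omega
  · have hiS : i ∈ S := by
      by_contra hiS
      simp [c, hik, hiS] at hi
    rw [← Finset.add_sum_erase _ _ hiS, hd]
    have : ∑ j ∈ S.erase i, M j i ≤ 0 := Finset.sum_nonpos fun j hj => hn _ _ (by simp at hj; exact hj.1)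
    have := (hS i hiS).2
    simp [hik]
    omega

end RootPeeling

namespace RootPeeling

open Matrix

variable {n : ℕ} {M : Matrix (Fin n) (Fin n) ℤ} {k : Fin n} {m : ℤ}

namespace DynkinType

theorem cartanMatrix_nonpos (T : DynkinType n) (i j : Fin n) (h : i ≠ j) :
    T.cartanMatrix i j ≤ 0 := by
  cases T
  case A => exact CartanMatrix.A_apply_le_zero_of_ne n i j h
  case B => exact CartanMatrix.B_off_diag_nonpos n i j h
  case C => exact CartanMatrix.C_off_diag_nonpos n i j h
  case D => exact CartanMatrix.D_off_diag_nonpos n i j h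
  case E₆ => exact CartanMatrix.E₆_off_diag_nonpos i j h
  case E₇ => exact CartanMatrix.E₇_off_diag_nonpos i j h
  case E₈ => exact CartanMatrix.E₈_off_diag_nonpos i j h
  case F₄ => exact CartanMatrix.F₄_off_diag_nonpos i j h
  case G₂ => exact CartanMatrix.G₂_off_diag_nonpos i j h

end DynkinType

/-- A diagram with a new node is again a Dynkin diagram. -/
def IsDynkinExtension (M : Matrix (Fin n) (Fin n) ℤ) (k : Fin n) (m : ℤ) : Prop :=
  ∃ (T : DynkinType (n + 1)) (f : Fin (n + 1) → Fin (n + 1)),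
    (attachLeaf M k m).submatrix f f = T.cartanMatrix

theorem isDynkinExtension_E₆ (hm : m = 1 ∨ m = 2 ∨ m = 3) (k : Fin 6)
    (h : IsFiniteType (attachLeaf CartanMatrix.E₆ k m)) :
    IsDynkinExtension CartanMatrix.E₆ k m := by
  have h1 : 1 ≤ m := by omega
  have h2 (hne : m ≠ 1) : 2 ≤ m := by omega
  fin_cases k
  · by_cases hm1 : m = 1
    · subst hm1
      exact ⟨.E₇, ![6, 2, 5, 4, 3, 1, 0], by decide +kernel⟩
    · exact (not_isFiniteType_attachLeaf h 2 1 ![2, 1, 2, 2, 1, 0] (h2 hm1) one_pos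
        (by decide +kernel) (by decide +kernel) (by decide +kernel)).elim
  · exact (not_isFiniteType_attachLeaf h 1 1 ![1, 2, 2, 3, 2, 1] h1 one_pos
      (by decide +kernel) (by decide +kernel) (by decide +kernel)).elim
  · exact (not_isFiniteType_attachLeaf h 1 1 ![1, 1, 2, 2, 1, 0] h1 one_pos
      (by decide +kernel) (by decide +kernel) (by decide +kernel)).elim
  · exact (not_isFiniteType_attachLeaf h 1 1 ![0, 1, 1, 2, 1, 0] h1 one_pos
      (by decide +kernel) (by decide +kernel) (by decide +kernel)).elim
  · exact (not_isFiniteType_attachLeaf h 1 1 ![0, 1, 1, 2, 2, 1] h1 one_pos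
      (by decide +kernel) (by decide +kernel) (by decide +kernel)).elim
  · by_cases hm1 : m = 1
    · subst hm1
      exact ⟨.E₇, ![1, 2, 3, 4, 5, 6, 0], by decide +kernel⟩
    · exact (not_isFiniteType_attachLeaf h 2 1 ![0, 1, 1, 2, 2, 2] (h2 hm1) one_pos
        (by decide +kernel) (by decide +kernel) (by decide +kernel)).elim

theorem isDynkinExtension_E₇ (hm : m = 1 ∨ m = 2 ∨ m = 3) (k : Fin 7)
    (h : IsFiniteType (attachLeaf CartanMatrix.E₇ k m)) :
    IsDynkinExtension CartanMatrix.E₇ k m := by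
  have h1 : 1 ≤ m := by omega
  have h2 (hne : m ≠ 1) : 2 ≤ m := by omega
  fin_cases k
  · exact (not_isFiniteType_attachLeaf h 1 1 ![2, 2, 3, 4, 3, 2, 1] h1 one_pos
      (by decide +kernel) (by decide +kernel) (by decide +kernel)).elim
  · exact (not_isFiniteType_attachLeaf h 1 1 ![1, 2, 2, 3, 2, 1, 0] h1 one_pos
      (by decide +kernel) (by decide +kernel) (by decide +kernel)).elim
  · exact (not_isFiniteType_attachLeaf h 1 1 ![1, 1, 2, 2, 1, 0, 0] h1 one_pos
      (by decide +kernel) (by decide +kernel) (by decide +kernel)).elim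
  · exact (not_isFiniteType_attachLeaf h 1 1 ![0, 1, 1, 2, 1, 0, 0] h1 one_pos
      (by decide +kernel) (by decide +kernel) (by decide +kernel)).elim
  · exact (not_isFiniteType_attachLeaf h 1 1 ![0, 1, 1, 2, 2, 1, 0] h1 one_pos
      (by decide +kernel) (by decide +kernel) (by decide +kernel)).elim
  · exact (not_isFiniteType_attachLeaf h 1 1 ![0, 1, 1, 2, 2, 2, 1] h1 one_pos
      (by decide +kernel) (by decide +kernel) (by decide +kernel)).elim
  · by_cases hm1 : m = 1
    · subst hm1
      exact ⟨.E₈, ![1, 2, 3, 4, 5, 6, 7, 0], by decide +kernel⟩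
    · exact (not_isFiniteType_attachLeaf h 2 1 ![0, 1, 1, 2, 2, 2, 2] (h2 hm1) one_pos
        (by decide +kernel) (by decide +kernel) (by decide +kernel)).elim

theorem isDynkinExtension_E₈ (hm : m = 1 ∨ m = 2 ∨ m = 3) (k : Fin 8)
    (h : IsFiniteType (attachLeaf CartanMatrix.E₈ k m)) :
    IsDynkinExtension CartanMatrix.E₈ k m := by
  have h1 : 1 ≤ m := by omega
  fin_cases k
  · exact (not_isFiniteType_attachLeaf h 1 1 ![2, 2, 3, 4, 3, 2, 1, 0] h1 one_pos
      (by decide +kernel) (by decide +kernel) (by decide +kernel)).elim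
  · exact (not_isFiniteType_attachLeaf h 1 1 ![1, 2, 2, 3, 2, 1, 0, 0] h1 one_pos
      (by decide +kernel) (by decide +kernel) (by decide +kernel)).elim
  · exact (not_isFiniteType_attachLeaf h 1 1 ![1, 1, 2, 2, 1, 0, 0, 0] h1 one_pos
      (by decide +kernel) (by decide +kernel) (by decide +kernel)).elim
  · exact (not_isFiniteType_attachLeaf h 1 1 ![0, 1, 1, 2, 1, 0, 0, 0] h1 one_pos
      (by decide +kernel) (by decide +kernel) (by decide +kernel)).elim
  · exact (not_isFiniteType_attachLeaf h 1 1 ![0, 1, 1, 2, 2, 1, 0, 0] h1 one_pos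
      (by decide +kernel) (by decide +kernel) (by decide +kernel)).elim
  · exact (not_isFiniteType_attachLeaf h 1 1 ![0, 1, 1, 2, 2, 2, 1, 0] h1 one_pos
      (by decide +kernel) (by decide +kernel) (by decide +kernel)).elim
  · exact (not_isFiniteType_attachLeaf h 1 1 ![0, 1, 1, 2, 2, 2, 2, 1] h1 one_pos
      (by decide +kernel) (by decide +kernel) (by decide +kernel)).elim
  · exact (not_isFiniteType_attachLeaf h 1 1 ![2, 3, 4, 6, 5, 4, 3, 2] h1 one_pos
      (by decide +kernel) (by decide +kernel) (by decide +kernel)).elim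

theorem isDynkinExtension_F₄ (hm : m = 1 ∨ m = 2 ∨ m = 3) (k : Fin 4)
    (h : IsFiniteType (attachLeaf CartanMatrix.F₄ k m)) :
    IsDynkinExtension CartanMatrix.F₄ k m := by
  have h1 : 1 ≤ m := by omega
  fin_cases k
  · exact (not_isFiniteType_attachLeaf h 1 1 ![2, 3, 4, 2] h1 one_pos
      (by decide +kernel) (by decide +kernel) (by decide +kernel)).elim
  · exact (not_isFiniteType_attachLeaf h 1 1 ![1, 2, 2, 0] h1 one_pos
      (by decide +kernel) (by decide +kernel) (by decide +kernel)).elim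
  · exact (not_isFiniteType_attachLeaf h 1 1 ![0, 1, 2, 1] h1 one_pos
      (by decide +kernel) (by decide +kernel) (by decide +kernel)).elim
  · exact (not_isFiniteType_attachLeaf h 1 1 ![1, 2, 3, 2] h1 one_pos
      (by decide +kernel) (by decide +kernel) (by decide +kernel)).elim

theorem isDynkinExtension_G₂ (hm : m = 1 ∨ m = 2 ∨ m = 3) (k : Fin 2)
    (h : IsFiniteType (attachLeaf CartanMatrix.G₂ k m)) :
    IsDynkinExtension CartanMatrix.G₂ k m := by
  have h1 : 1 ≤ m := by omega
  fin_cases k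
  · exact (not_isFiniteType_attachLeaf h 1 1 ![2, 3] h1 one_pos
      (by decide +kernel) (by decide +kernel) (by decide +kernel)).elim
  · exact (not_isFiniteType_attachLeaf h 1 1 ![1, 2] h1 one_pos
      (by decide +kernel) (by decide +kernel) (by decide +kernel)).elim

end RootPeeling

namespace RootPeeling

open Matrix

variable {n : ℕ} {k : Fin n} {m : ℤ}

section sums

variable {M : Matrix (Fin n) (Fin n) ℤ} {c : Fin n → ℤ}

theorem sum_mul_le_sum_subset (hc : ∀ i, 0 ≤ c i) (hn : ∀ i j, i ≠ j → M i j ≤ 0)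
    {i : Fin n} {S : Finset (Fin n)} (hi : i ∈ S) :
    ∑ l, c l * M l i ≤ ∑ l ∈ S, c l * M l i := by
  rw [← Finset.sum_sdiff (Finset.subset_univ S)]
  have : ∑ l ∈ Finset.univ \ S, c l * M l i ≤ 0 := by
    refine Finset.sum_nonpos fun l hl => mul_nonpos_of_nonneg_of_nonpos (hc l) (hn l i ?_)
    rintro rfl
    simp [hi] at hl
  omega

theorem sum_mul_le_two (hc : ∀ i, 0 ≤ c i) (hn : ∀ i j, i ≠ j → M i j ≤ 0)
    {i j : Fin n} (hij : i ≠ j) : ∑ l, c l * M l i ≤ c i * M i i + c j * M j i :=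
  (sum_mul_le_sum_subset hc hn (S := {i, j}) (by simp)).trans_eq (Finset.sum_pair hij)

theorem sum_mul_le_three (hc : ∀ i, 0 ≤ c i) (hn : ∀ i j, i ≠ j → M i j ≤ 0)
    {i j l : Fin n} (hij : i ≠ j) (hil : i ≠ l) (hjl : j ≠ l) :
    ∑ l, c l * M l i ≤ c i * M i i + (c j * M j i + c l * M l i) :=
  (sum_mul_le_sum_subset hc hn (S := {i, j, l}) (by simp)).trans_eq <| by
    rw [Finset.sum_insert (by simp [hij, hil]), Finset.sum_pair hjl]

theorem sum_mul_le_four (hc : ∀ i, 0 ≤ c i) (hn : ∀ i j, i ≠ j → M i j ≤ 0)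
    {i j l p : Fin n} (hij : i ≠ j) (hil : i ≠ l) (hip : i ≠ p) (hjl : j ≠ l) (hjp : j ≠ p)
    (hlp : l ≠ p) :
    ∑ l, c l * M l i ≤ c i * M i i + (c j * M j i + (c l * M l i + c p * M p i)) :=
  (sum_mul_le_sum_subset hc hn (S := {i, j, l, p}) (by simp)).trans_eq <| by
    rw [Finset.sum_insert (by simp [hij, hil, hip]), Finset.sum_insert (by simp [hjl, hjp]),
      Finset.sum_pair hlp]

end sums

section entries

variable {i j : ℕ} (hi : i < n) (hj : j < n)

theorem A_mk : CartanMatrix.A n ⟨i, hi⟩ ⟨j, hj⟩ =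
    if i = j then 2 else if i + 1 = j ∨ j + 1 = i then -1 else 0 := by
  simp [CartanMatrix.A]

theorem B_mk : CartanMatrix.B n ⟨i, hi⟩ ⟨j, hj⟩ =
    if i = j then 2 else if i + 1 = j then if j = n - 1 then -2 else -1
    else if j + 1 = i then -1 else 0 := by
  simp [CartanMatrix.B]

theorem C_mk : CartanMatrix.C n ⟨i, hi⟩ ⟨j, hj⟩ =
    if i = j then 2 else if i + 1 = j then -1
    else if j + 1 = i then if i = n - 1 then -2 else -1 else 0 := by
  simp [CartanMatrix.C]

theorem D_mk : CartanMatrix.D n ⟨i, hi⟩ ⟨j, hj⟩ =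
    if i = j then 2
    else if n ≤ 2 then 0
    else if i + 1 = j ∧ j + 2 < n then -1
    else if j + 1 = i ∧ i + 2 < n then -1
    else if i + 3 = n ∧ (j + 2 = n ∨ j + 1 = n) then -1
    else if j + 3 = n ∧ (i + 2 = n ∨ i + 1 = n) then -1
    else 0 := by
  simp [CartanMatrix.D]

end entries

/-- Affine marks: a fork or a double bond at the left end, a double bond to a short root at the right
end. -/
theorem not_isFiniteType_attachLeaf_B (hn : 2 ≤ n)
    (hk : (m = 1 ∧ 1 ≤ (k : ℕ) ∧ (k : ℕ) + 1 < n) ∨ (2 ≤ m ∧ (k : ℕ) = 0))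
    (h : IsFiniteType (attachLeaf (CartanMatrix.B n) k m)) : False := by
  obtain ⟨k, hkn⟩ := k
  simp only at hk
  let c : Fin n → ℤ := fun i => if i + 1 < k then 0 else if i + 1 = k then 1 else 2
  have hc : ∀ i, 0 ≤ c i := fun i => by simp only [c]; grind
  refine not_isFiniteType_attachLeaf h (if k = 0 then 2 else 1) 1 c (by grind) one_pos hc
    (by simp only [c]; grind) ?_
  have hM := CartanMatrix.B_off_diag_nonpos n
  rintro ⟨i, hi⟩ hci
  by_cases hi0 : i = 0
  · subst hi0
    refine (sum_mul_le_two hc hM (j := ⟨1, by omega⟩) (by simp only [ne_eq, Fin.mk.injEq]; omega)).trans ?_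
    simp only [B_mk, c, Fin.mk.injEq] at hci ⊢
    grind
  by_cases hin : i = n - 1
  · refine (sum_mul_le_two hc hM (j := ⟨i - 1, by omega⟩)
      (by simp only [ne_eq, Fin.mk.injEq]; omega)).trans ?_
    simp only [B_mk, c, Fin.mk.injEq] at hci ⊢
    grind
  · refine (sum_mul_le_three hc hM (j := ⟨i - 1, by omega⟩) (l := ⟨i + 1, by omega⟩)
      (by simp only [ne_eq, Fin.mk.injEq]; omega) (by simp only [ne_eq, Fin.mk.injEq]; omega)
      (by simp only [ne_eq, Fin.mk.injEq]; omega)).trans ?_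
    simp only [B_mk, c, Fin.mk.injEq] at hci ⊢
    grind

/-- Affine marks: a fork or a double bond at the left end, a double bond to a long root at the right
end. -/
theorem not_isFiniteType_attachLeaf_C (hn : 3 ≤ n)
    (hk : (m = 1 ∧ 1 ≤ (k : ℕ) ∧ (k : ℕ) + 1 < n) ∨ (2 ≤ m ∧ (k : ℕ) = 0))
    (h : IsFiniteType (attachLeaf (CartanMatrix.C n) k m)) : False := by
  obtain ⟨k, hkn⟩ := k
  simp only at hk
  let c : Fin n → ℤ := fun i => if i + 1 < k then 0 else if i + 1 = k then 1 else if i + 1 = n then 1 else 2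
  have hc : ∀ i, 0 ≤ c i := fun i => by simp only [c]; grind
  refine not_isFiniteType_attachLeaf h (if k = 0 then 2 else 1) 1 c (by grind) one_pos hc
    (by simp only [c]; grind) ?_
  have hM := CartanMatrix.C_off_diag_nonpos n
  rintro ⟨i, hi⟩ hci
  by_cases hi0 : i = 0
  · subst hi0
    refine (sum_mul_le_two hc hM (j := ⟨1, by omega⟩) (by simp only [ne_eq, Fin.mk.injEq]; omega)).trans ?_
    simp only [C_mk, c, Fin.mk.injEq] at hci ⊢
    grind
  by_cases hin : i = n - 1
  · refine (sum_mul_le_two hc hM (j := ⟨i - 1, by omega⟩)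
      (by simp only [ne_eq, Fin.mk.injEq]; omega)).trans ?_
    simp only [C_mk, c, Fin.mk.injEq] at hci ⊢
    grind
  · refine (sum_mul_le_three hc hM (j := ⟨i - 1, by omega⟩) (l := ⟨i + 1, by omega⟩)
      (by simp only [ne_eq, Fin.mk.injEq]; omega) (by simp only [ne_eq, Fin.mk.injEq]; omega)
      (by simp only [ne_eq, Fin.mk.injEq]; omega)).trans ?_
    simp only [C_mk, c, Fin.mk.injEq] at hci ⊢
    grind

/-- Affine marks: a fork or a double bond at the left end, a fork at the right end. -/
theorem not_isFiniteType_attachLeaf_D (hn : 4 ≤ n)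
    (hk : (m = 1 ∧ 1 ≤ (k : ℕ) ∧ (k : ℕ) + 2 < n) ∨ (2 ≤ m ∧ (k : ℕ) = 0))
    (h : IsFiniteType (attachLeaf (CartanMatrix.D n) k m)) : False := by
  obtain ⟨k, hkn⟩ := k
  simp only at hk
  let c : Fin n → ℤ := fun i => if i + 1 < k then 0 else if i + 1 = k then 1 else if i + 2 < n then 2 else 1
  have hc : ∀ i, 0 ≤ c i := fun i => by simp only [c]; grind
  refine not_isFiniteType_attachLeaf h (if k = 0 then 2 else 1) 1 c (by grind) one_pos hc
    (by simp only [c]; grind) ?_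
  have hM := CartanMatrix.D_off_diag_nonpos n
  rintro ⟨i, hi⟩ hci
  by_cases hi0 : i = 0
  · subst hi0
    refine (sum_mul_le_two hc hM (j := ⟨1, by omega⟩) (by simp only [ne_eq, Fin.mk.injEq]; omega)).trans ?_
    simp only [D_mk, c, Fin.mk.injEq] at hci ⊢
    grind
  by_cases hin : i = n - 1
  · refine (sum_mul_le_two hc hM (j := ⟨n - 3, by omega⟩)
      (by simp only [ne_eq, Fin.mk.injEq]; omega)).trans ?_
    simp only [D_mk, c, Fin.mk.injEq] at hci ⊢
    grind
  by_cases hin : i = n - 2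
  · refine (sum_mul_le_two hc hM (j := ⟨n - 3, by omega⟩)
      (by simp only [ne_eq, Fin.mk.injEq]; omega)).trans ?_
    simp only [D_mk, c, Fin.mk.injEq] at hci ⊢
    grind
  by_cases hin : i = n - 3
  · refine (sum_mul_le_four hc hM (j := ⟨n - 4, by omega⟩) (l := ⟨n - 2, by omega⟩)
      (p := ⟨n - 1, by omega⟩) (by simp only [ne_eq, Fin.mk.injEq]; omega)
      (by simp only [ne_eq, Fin.mk.injEq]; omega) (by simp only [ne_eq, Fin.mk.injEq]; omega)
      (by simp only [ne_eq, Fin.mk.injEq]; omega) (by simp only [ne_eq, Fin.mk.injEq]; omega)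
      (by simp only [ne_eq, Fin.mk.injEq]; omega)).trans ?_
    simp only [D_mk, c, Fin.mk.injEq] at hci ⊢
    grind
  refine (sum_mul_le_three hc hM (j := ⟨i - 1, by omega⟩) (l := ⟨i + 1, by omega⟩)
    (by simp only [ne_eq, Fin.mk.injEq]; omega) (by simp only [ne_eq, Fin.mk.injEq]; omega)
    (by simp only [ne_eq, Fin.mk.injEq]; omega)).trans ?_
  simp only [D_mk, c, Fin.mk.injEq] at hci ⊢
  grind

end RootPeeling

namespace RootPeeling

open Matrix

variable {n : ℕ} {k : Fin n} {m : ℤ}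

theorem attachLeaf_mk (M : Matrix (Fin n) (Fin n) ℤ) (k : Fin n) (m : ℤ) {i j : ℕ}
    (hi : i < n + 1) (hj : j < n + 1) :
    attachLeaf M k m ⟨i, hi⟩ ⟨j, hj⟩ =
      if h : i = 0 then if j = 0 then 2 else if j = k + 1 then -m else 0
      else if h' : j = 0 then if i = k + 1 then -1 else 0
      else M ⟨i - 1, by omega⟩ ⟨j - 1, by omega⟩ := by
  cases i <;> cases j
  · rfl
  · simp only [Nat.add_eq_zero_iff, one_ne_zero, and_false, if_false, dite_true, add_left_inj]
    exact if_congr (by rw [Fin.ext_iff]) rfl rfl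
  · simp only [Nat.add_eq_zero_iff, one_ne_zero, and_false, dite_true, dite_false, add_left_inj]
    exact if_congr (by rw [Fin.ext_iff]) rfl rfl
  · rfl

theorem IsDynkinExtension.of_symm {M : Matrix (Fin n) (Fin n) ℤ} {k' : Fin n}
    (h : IsDynkinExtension M k' m) (f : Equiv.Perm (Fin n)) (hk : f k' = k)
    (hM : ∀ i j, M (f i) (f j) = M i j) : IsDynkinExtension M k m := by
  obtain ⟨T, g, hg⟩ := h
  refine ⟨T, Fin.cons 0 (Fin.succ ∘ f) ∘ g, ?_⟩
  rw [← hg, ← submatrix_submatrix]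
  congr 1
  have hk' : ∀ i, f i = k ↔ i = k' := fun i => by rw [← hk, f.injective.eq_iff]
  ext i j
  induction i using Fin.cases <;> induction j using Fin.cases <;> simp [hk', hM]

theorem isDynkinExtension_A_left (hn : 0 < n) :
    IsDynkinExtension (CartanMatrix.A n) ⟨0, hn⟩ 1 := by
  refine ⟨.A (n + 1) (by omega), id, ?_⟩
  ext ⟨i, hi⟩ ⟨j, hj⟩
  simp only [submatrix_apply, id, attachLeaf_mk, DynkinType.cartanMatrix, A_mk]
  grind

theorem isDynkinExtension_A_left_two (hn : 0 < n) :
    IsDynkinExtension (CartanMatrix.A n) ⟨0, hn⟩ 2 := by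
  by_cases hn1 : n = 1
  · subst hn1
    exact ⟨.B 2 le_rfl, id,
      show (attachLeaf (CartanMatrix.A 1) 0 2).submatrix id id = CartanMatrix.B 2 by decide +kernel⟩
  refine ⟨.C (n + 1) (by omega), Fin.rev, ?_⟩
  ext ⟨i, hi⟩ ⟨j, hj⟩
  simp only [submatrix_apply, Fin.rev, attachLeaf_mk, DynkinType.cartanMatrix, A_mk, C_mk]
  grind

theorem isDynkinExtension_A_second (hn : 3 ≤ n) :
    IsDynkinExtension (CartanMatrix.A n) ⟨1, by omega⟩ 1 := by
  refine ⟨.D (n + 1) (by omega), Fin.rev, ?_⟩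
  ext ⟨i, hi⟩ ⟨j, hj⟩
  simp only [submatrix_apply, Fin.rev, attachLeaf_mk, DynkinType.cartanMatrix, A_mk, D_mk]
  grind (splits := 30)

theorem isDynkinExtension_B_left (hn : 2 ≤ n) :
    IsDynkinExtension (CartanMatrix.B n) ⟨0, by omega⟩ 1 := by
  refine ⟨.B (n + 1) (by omega), id, ?_⟩
  ext ⟨i, hi⟩ ⟨j, hj⟩
  simp only [submatrix_apply, id, attachLeaf_mk, DynkinType.cartanMatrix, B_mk]
  grind

theorem isDynkinExtension_C_left (hn : 3 ≤ n) :
    IsDynkinExtension (CartanMatrix.C n) ⟨0, by omega⟩ 1 := by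
  refine ⟨.C (n + 1) (by omega), id, ?_⟩
  ext ⟨i, hi⟩ ⟨j, hj⟩
  simp only [submatrix_apply, id, attachLeaf_mk, DynkinType.cartanMatrix, C_mk]
  grind

theorem isDynkinExtension_D_left (hn : 4 ≤ n) :
    IsDynkinExtension (CartanMatrix.D n) ⟨0, by omega⟩ 1 := by
  refine ⟨.D (n + 1) (by omega), id, ?_⟩
  ext ⟨i, hi⟩ ⟨j, hj⟩
  simp only [submatrix_apply, id, attachLeaf_mk, DynkinType.cartanMatrix, D_mk]
  grind (splits := 30)

theorem not_isFiniteType_A₇ : ¬ IsFiniteType (attachLeaf (CartanMatrix.A 7) 3 1) := fun h =>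
  not_isFiniteType_attachLeaf h 1 2 ![1, 2, 3, 4, 3, 2, 1] le_rfl two_pos
    (by decide +kernel) (by decide +kernel) (by decide +kernel)

theorem not_isFiniteType_A₈ : ¬ IsFiniteType (attachLeaf (CartanMatrix.A 8) 2 1) := fun h =>
  not_isFiniteType_attachLeaf h 1 3 ![2, 4, 6, 5, 4, 3, 2, 1] le_rfl three_pos
    (by decide +kernel) (by decide +kernel) (by decide +kernel)

theorem not_isFiniteType_B₄ : ¬ IsFiniteType (attachLeaf (CartanMatrix.B 4) 3 1) := fun h =>
  not_isFiniteType_attachLeaf h 1 2 ![1, 2, 3, 4] le_rfl two_pos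
    (by decide +kernel) (by decide +kernel) (by decide +kernel)

theorem not_isFiniteType_C₄ : ¬ IsFiniteType (attachLeaf (CartanMatrix.C 4) 3 1) := fun h =>
  not_isFiniteType_attachLeaf h 1 1 ![1, 2, 3, 2] le_rfl one_pos
    (by decide +kernel) (by decide +kernel) (by decide +kernel)

theorem not_isFiniteType_C₂ : ¬ IsFiniteType (attachLeaf (CartanMatrix.C 2) 1 2) := fun h =>
  not_isFiniteType_attachLeaf h 2 1 ![2, 2] le_rfl one_pos
    (by decide +kernel) (by decide +kernel) (by decide +kernel)

theorem not_isFiniteType_D₈ : ¬ IsFiniteType (attachLeaf (CartanMatrix.D 8) 7 1) := fun h =>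
  not_isFiniteType_attachLeaf h 1 2 ![1, 2, 3, 4, 5, 6, 3, 4] le_rfl two_pos
    (by decide +kernel) (by decide +kernel) (by decide +kernel)

theorem not_isFiniteType_D₄ : ¬ IsFiniteType (attachLeaf (CartanMatrix.D 4) 3 2) := fun h =>
  not_isFiniteType_attachLeaf h 2 1 ![1, 2, 1, 2] le_rfl one_pos
    (by decide +kernel) (by decide +kernel) (by decide +kernel)

/-- A bond of multiplicity three cannot be attached to a diagram with at least two nodes. -/
theorem lt_three_of_neighbour {M : Matrix (Fin n) (Fin n) ℤ}
    (h : IsFiniteType (attachLeaf M k m)) (hd : ∀ i, M i i = 2)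
    (hn : ∀ i j, i ≠ j → M i j ≤ 0) (j : Fin n) (hj : j ≠ k) (hkj : M k j ≤ -1)
    (hjk : M j k ≤ -1) : m < 3 := by
  have := star_bound h hd hn {j} (by simp [hj, hkj])
  rw [Finset.sum_singleton] at this
  omega

theorem lt_two_of_double_neighbour {M : Matrix (Fin n) (Fin n) ℤ}
    (h : IsFiniteType (attachLeaf M k m)) (hd : ∀ i, M i i = 2)
    (hn : ∀ i j, i ≠ j → M i j ≤ 0) (j : Fin n) (hj : j ≠ k) (hkj : M k j ≤ -1)
    (hjk : M j k ≤ -2) : m < 2 := by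
  have := star_bound h hd hn {j} (by simp [hj, hkj])
  rw [Finset.sum_singleton] at this
  omega

theorem lt_two_of_two_neighbours {M : Matrix (Fin n) (Fin n) ℤ}
    (h : IsFiniteType (attachLeaf M k m)) (hd : ∀ i, M i i = 2)
    (hn : ∀ i j, i ≠ j → M i j ≤ 0) (i j : Fin n) (hij : i ≠ j) (hi : i ≠ k) (hj : j ≠ k)
    (hki : M k i ≤ -1) (hik : M i k ≤ -1) (hkj : M k j ≤ -1) (hjk : M j k ≤ -1) : m < 2 := by
  have := star_bound h hd hn {i, j} (by simp [hi, hj, hki, hkj])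
  rw [Finset.sum_pair hij] at this
  omega

end RootPeeling

namespace RootPeeling

open Matrix

variable {n : ℕ} {k : Fin n} {m : ℤ}

theorem A_rev (i j : Fin n) : CartanMatrix.A n i.rev j.rev = CartanMatrix.A n i j := by
  obtain ⟨i, hi⟩ := i
  obtain ⟨j, hj⟩ := j
  simp only [Fin.rev, A_mk]
  grind

theorem IsDynkinExtension.of_rev (h : IsDynkinExtension (CartanMatrix.A n) k.rev m) :
    IsDynkinExtension (CartanMatrix.A n) k m :=
  h.of_symm Fin.revPerm (by simp) (by simpa using A_rev)

theorem isDynkinExtension_A_of_le (hm : m = 1 ∨ m = 2 ∨ m = 3) (hk : (k : ℕ) ≤ n - 1 - k)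
    (h : IsFiniteType (attachLeaf (CartanMatrix.A n) k m)) :
    IsDynkinExtension (CartanMatrix.A n) k m := by
  obtain ⟨k, hkn⟩ := k
  simp only at hk
  have hd : ∀ i, CartanMatrix.A n i i = 2 := congrFun (CartanMatrix.A_diag n)
  have hneg := CartanMatrix.A_apply_le_zero_of_ne n
  rcases hm with rfl | rfl | rfl
  · rcases (by omega : k = 0 ∨ k = 1 ∨ k = 2 ∨ 3 ≤ k) with rfl | rfl | rfl | hk3
    · exact isDynkinExtension_A_left hkn
    · exact isDynkinExtension_A_second (by omega)
    · rcases (by omega : n = 5 ∨ n = 6 ∨ n = 7 ∨ 8 ≤ n) with rfl | rfl | rfl | hn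
      · exact ⟨.E₆, ![1, 0, 2, 3, 4, 5], show (attachLeaf (CartanMatrix.A 5) 2 1).submatrix
          ![1, 0, 2, 3, 4, 5] ![1, 0, 2, 3, 4, 5] = CartanMatrix.E₆ by decide +kernel⟩
      · exact ⟨.E₇, ![1, 0, 2, 3, 4, 5, 6], show (attachLeaf (CartanMatrix.A 6) 2 1).submatrix
          ![1, 0, 2, 3, 4, 5, 6] ![1, 0, 2, 3, 4, 5, 6] = CartanMatrix.E₇ by decide +kernel⟩
      · exact ⟨.E₈, ![1, 0, 2, 3, 4, 5, 6, 7], show (attachLeaf (CartanMatrix.A 7) 2 1).submatrix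
          ![1, 0, 2, 3, 4, 5, 6, 7] ![1, 0, 2, 3, 4, 5, 6, 7] = CartanMatrix.E₈ by decide +kernel⟩
      · refine (not_isFiniteType_A₈ (h.of_attachLeaf (fun i => ⟨i, by omega⟩) 2 ?_ rfl ?_)).elim
        · intro i j hij
          simpa [Fin.ext_iff] using hij
        · rintro ⟨i, hi⟩ ⟨j, hj⟩
          simp only [A_mk]
    · refine (not_isFiniteType_A₇
        (h.of_attachLeaf (fun i => ⟨k - 3 + i, by omega⟩) 3 ?_ ?_ ?_)).elim
      · intro i j hij
        simpa [Fin.ext_iff] using hij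
      · simp only [Fin.mk.injEq]
        change k - 3 + 3 = k
        omega
      · rintro ⟨i, hi⟩ ⟨j, hj⟩
        simp only [A_mk]
        grind
  · by_cases hk0 : k = 0
    · subst hk0
      exact isDynkinExtension_A_left_two hkn
    · have := lt_two_of_two_neighbours h hd hneg ⟨k - 1, by omega⟩ ⟨k + 1, by omega⟩
        (by simp only [ne_eq, Fin.mk.injEq]; omega) (by simp only [ne_eq, Fin.mk.injEq]; omega)
        (by simp only [ne_eq, Fin.mk.injEq]; omega)
        (by rw [A_mk]; grind) (by rw [A_mk]; grind) (by rw [A_mk]; grind) (by rw [A_mk]; grind)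
      omega
  · by_cases hn : n = 1
    · subst hn
      obtain rfl : k = 0 := by omega
      exact ⟨.G₂, id, show (attachLeaf (CartanMatrix.A 1) 0 3).submatrix id id = CartanMatrix.G₂
        by decide +kernel⟩
    · have := lt_three_of_neighbour h hd hneg ⟨k + 1, by omega⟩
        (by simp only [ne_eq, Fin.mk.injEq]; omega)
        (by rw [A_mk]; grind) (by rw [A_mk]; grind)
      omega

theorem isDynkinExtension_A (hm : m = 1 ∨ m = 2 ∨ m = 3)
    (h : IsFiniteType (attachLeaf (CartanMatrix.A n) k m)) :
    IsDynkinExtension (CartanMatrix.A n) k m := by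
  by_cases hk : (k : ℕ) ≤ n - 1 - k
  · exact isDynkinExtension_A_of_le hm hk h
  · refine (isDynkinExtension_A_of_le hm ?_ (h.of_attachLeaf Fin.rev k.rev Fin.rev_injective
      (Fin.rev_rev k) A_rev)).of_rev
    rw [Fin.val_rev]
    omega

theorem isDynkinExtension_B (hn : 2 ≤ n) (hm : m = 1 ∨ m = 2 ∨ m = 3)
    (h : IsFiniteType (attachLeaf (CartanMatrix.B n) k m)) :
    IsDynkinExtension (CartanMatrix.B n) k m := by
  obtain ⟨k, hkn⟩ := k
  have hd := CartanMatrix.B_diag n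
  have hneg := CartanMatrix.B_off_diag_nonpos n
  have hm3 : m < 3 := by
    by_cases hk0 : k = 0
    · exact lt_three_of_neighbour h hd hneg ⟨k + 1, by omega⟩
        (by simp only [ne_eq, Fin.mk.injEq]; omega) (by rw [B_mk]; grind) (by rw [B_mk]; grind)
    · exact lt_three_of_neighbour h hd hneg ⟨k - 1, by omega⟩
        (by simp only [ne_eq, Fin.mk.injEq]; omega) (by rw [B_mk]; grind) (by rw [B_mk]; grind)
  rcases (by omega : k = 0 ∨ (1 ≤ k ∧ k + 1 < n) ∨ (1 ≤ k ∧ k = n - 1)) with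
    rfl | ⟨hk1, hk⟩ | ⟨hk1, hk⟩
  · by_cases hm1 : m = 1
    · subst hm1
      exact isDynkinExtension_B_left hn
    · exact (not_isFiniteType_attachLeaf_B hn (.inr ⟨by omega, rfl⟩) h).elim
  · by_cases hm1 : m = 1
    · exact (not_isFiniteType_attachLeaf_B hn (.inl ⟨hm1, hk1, hk⟩) h).elim
    · have := lt_two_of_two_neighbours h hd hneg ⟨k - 1, by omega⟩ ⟨k + 1, by omega⟩
        (by simp only [ne_eq, Fin.mk.injEq]; omega) (by simp only [ne_eq, Fin.mk.injEq]; omega)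
        (by simp only [ne_eq, Fin.mk.injEq]; omega)
        (by rw [B_mk]; grind) (by rw [B_mk]; grind) (by rw [B_mk]; grind) (by rw [B_mk]; grind)
      omega
  · have := lt_two_of_double_neighbour h hd hneg ⟨k - 1, by omega⟩
      (by simp only [ne_eq, Fin.mk.injEq]; omega) (by rw [B_mk]; grind) (by rw [B_mk]; grind)
    obtain rfl : m = 1 := by omega
    rcases (by omega : n = 2 ∨ n = 3 ∨ 4 ≤ n) with rfl | rfl | hn4
    · obtain rfl : k = 1 := hk
      exact ⟨.C 3 le_rfl, ![0, 2, 1], show (attachLeaf (CartanMatrix.B 2) 1 1).submatrix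
        ![0, 2, 1] ![0, 2, 1] = CartanMatrix.C 3 by decide +kernel⟩
    · obtain rfl : k = 2 := hk
      exact ⟨.F₄, ![1, 2, 3, 0], show (attachLeaf (CartanMatrix.B 3) 2 1).submatrix
        ![1, 2, 3, 0] ![1, 2, 3, 0] = CartanMatrix.F₄ by decide +kernel⟩
    · refine (not_isFiniteType_B₄
        (h.of_attachLeaf (fun i => ⟨n - 4 + i, by omega⟩) 3 ?_ ?_ ?_)).elim
      · intro i j hij
        simpa [Fin.ext_iff] using hij
      · simp only [Fin.mk.injEq]
        change n - 4 + 3 = k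
        omega
      · rintro ⟨i, hi⟩ ⟨j, hj⟩
        simp only [B_mk]
        grind

theorem isDynkinExtension_C (hn : 3 ≤ n) (hm : m = 1 ∨ m = 2 ∨ m = 3)
    (h : IsFiniteType (attachLeaf (CartanMatrix.C n) k m)) :
    IsDynkinExtension (CartanMatrix.C n) k m := by
  obtain ⟨k, hkn⟩ := k
  have hd := CartanMatrix.C_diag n
  have hneg := CartanMatrix.C_off_diag_nonpos n
  have hm3 : m < 3 := by
    by_cases hk0 : k = 0
    · exact lt_three_of_neighbour h hd hneg ⟨k + 1, by omega⟩
        (by simp only [ne_eq, Fin.mk.injEq]; omega) (by rw [C_mk]; grind) (by rw [C_mk]; grind)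
    · exact lt_three_of_neighbour h hd hneg ⟨k - 1, by omega⟩
        (by simp only [ne_eq, Fin.mk.injEq]; omega) (by rw [C_mk]; grind) (by rw [C_mk]; grind)
  rcases (by omega : k = 0 ∨ (1 ≤ k ∧ k + 1 < n) ∨ (1 ≤ k ∧ k = n - 1)) with
    rfl | ⟨hk1, hk⟩ | ⟨hk1, hk⟩
  · by_cases hm1 : m = 1
    · subst hm1
      exact isDynkinExtension_C_left hn
    · exact (not_isFiniteType_attachLeaf_C hn (.inr ⟨by omega, rfl⟩) h).elim
  · by_cases hm1 : m = 1
    · exact (not_isFiniteType_attachLeaf_C hn (.inl ⟨hm1, hk1, hk⟩) h).elim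
    · have := lt_two_of_two_neighbours h hd hneg ⟨k - 1, by omega⟩ ⟨k + 1, by omega⟩
        (by simp only [ne_eq, Fin.mk.injEq]; omega) (by simp only [ne_eq, Fin.mk.injEq]; omega)
        (by simp only [ne_eq, Fin.mk.injEq]; omega)
        (by rw [C_mk]; grind) (by rw [C_mk]; grind) (by rw [C_mk]; grind) (by rw [C_mk]; grind)
      omega
  · by_cases hm1 : m = 1
    · subst hm1
      by_cases hn3 : n = 3
      · subst hn3
        obtain rfl : k = 2 := hk
        exact ⟨.F₄, ![0, 3, 2, 1], show (attachLeaf (CartanMatrix.C 3) 2 1).submatrix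
          ![0, 3, 2, 1] ![0, 3, 2, 1] = CartanMatrix.F₄ by decide +kernel⟩
      · refine (not_isFiniteType_C₄
          (h.of_attachLeaf (fun i => ⟨n - 4 + i, by omega⟩) 3 ?_ ?_ ?_)).elim
        · intro i j hij
          simpa [Fin.ext_iff] using hij
        · simp only [Fin.mk.injEq]
          change n - 4 + 3 = k
          omega
        · rintro ⟨i, hi⟩ ⟨j, hj⟩
          simp only [C_mk]
          grind
    · obtain rfl : m = 2 := by omega
      refine (not_isFiniteType_C₂
        (h.of_attachLeaf (fun i => ⟨n - 2 + i, by omega⟩) 1 ?_ ?_ ?_)).elim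
      · intro i j hij
        simpa [Fin.ext_iff] using hij
      · simp only [Fin.mk.injEq]
        change n - 2 + 1 = k
        omega
      · rintro ⟨i, hi⟩ ⟨j, hj⟩
        simp only [C_mk]
        grind

theorem isDynkinExtension_D_last (hn : 4 ≤ n) (hm : m = 1 ∨ m = 2) (hk : (k : ℕ) = n - 1)
    (h : IsFiniteType (attachLeaf (CartanMatrix.D n) k m)) :
    IsDynkinExtension (CartanMatrix.D n) k m := by
  obtain ⟨k, hkn⟩ := k
  simp only at hk
  rcases hm with rfl | rfl
  · rcases (by omega : n = 4 ∨ n = 5 ∨ n = 6 ∨ n = 7 ∨ 8 ≤ n) with rfl | rfl | rfl | rfl | hn8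
    · obtain rfl : k = 3 := hk
      exact ⟨.D 5 (Nat.le_succ 4), ![0, 4, 2, 1, 3], show (attachLeaf (CartanMatrix.D 4) 3 1).submatrix
        ![0, 4, 2, 1, 3] ![0, 4, 2, 1, 3] = CartanMatrix.D 5 by decide +kernel⟩
    · obtain rfl : k = 4 := hk
      exact ⟨.E₆, ![0, 4, 5, 3, 2, 1], show (attachLeaf (CartanMatrix.D 5) 4 1).submatrix
        ![0, 4, 5, 3, 2, 1] ![0, 4, 5, 3, 2, 1] = CartanMatrix.E₆ by decide +kernel⟩
    · obtain rfl : k = 5 := hk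
      exact ⟨.E₇, ![0, 5, 6, 4, 3, 2, 1], show (attachLeaf (CartanMatrix.D 6) 5 1).submatrix
        ![0, 5, 6, 4, 3, 2, 1] ![0, 5, 6, 4, 3, 2, 1] = CartanMatrix.E₇ by decide +kernel⟩
    · obtain rfl : k = 6 := hk
      exact ⟨.E₈, ![0, 6, 7, 5, 4, 3, 2, 1], show (attachLeaf (CartanMatrix.D 7) 6 1).submatrix
        ![0, 6, 7, 5, 4, 3, 2, 1] ![0, 6, 7, 5, 4, 3, 2, 1] = CartanMatrix.E₈ by decide +kernel⟩
    · refine (not_isFiniteType_D₈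
        (h.of_attachLeaf (fun i => ⟨n - 8 + i, by omega⟩) 7 ?_ ?_ ?_)).elim
      · intro i j hij
        simpa [Fin.ext_iff] using hij
      · simp only [Fin.mk.injEq]
        change n - 8 + 7 = k
        omega
      · rintro ⟨i, hi⟩ ⟨j, hj⟩
        simp only [D_mk]
        grind (splits := 30)
  · refine (not_isFiniteType_D₄
      (h.of_attachLeaf (fun i => ⟨n - 4 + i, by omega⟩) 3 ?_ ?_ ?_)).elim
    · intro i j hij
      simpa [Fin.ext_iff] using hij
    · simp only [Fin.mk.injEq]
      change n - 4 + 3 = k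
      omega
    · rintro ⟨i, hi⟩ ⟨j, hj⟩
      simp only [D_mk]
      grind (splits := 30)

theorem D_swap (hn : 4 ≤ n) (i j : Fin n) :
    CartanMatrix.D n (Equiv.swap ⟨n - 2, by omega⟩ ⟨n - 1, by omega⟩ i)
      (Equiv.swap ⟨n - 2, by omega⟩ ⟨n - 1, by omega⟩ j) = CartanMatrix.D n i j := by
  have key : ∀ i : Fin n, Equiv.swap (⟨n - 2, by omega⟩ : Fin n) ⟨n - 1, by omega⟩ i =
      ⟨if (i : ℕ) = n - 2 then n - 1 else if (i : ℕ) = n - 1 then n - 2 else i, by grind⟩ := by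
    intro i
    rw [Equiv.swap_apply_def]
    simp only [Fin.ext_iff]
    split_ifs <;> rfl
  obtain ⟨i, hi⟩ := i
  obtain ⟨j, hj⟩ := j
  simp only [key, D_mk]
  grind (splits := 40)

theorem isDynkinExtension_D (hn : 4 ≤ n) (hm : m = 1 ∨ m = 2 ∨ m = 3)
    (h : IsFiniteType (attachLeaf (CartanMatrix.D n) k m)) :
    IsDynkinExtension (CartanMatrix.D n) k m := by
  obtain ⟨k, hkn⟩ := k
  have hd := CartanMatrix.D_diag n
  have hneg := CartanMatrix.D_off_diag_nonpos n
  rcases (by omega : k = 0 ∨ (1 ≤ k ∧ k + 3 < n) ∨ k + 3 = n ∨ k = n - 2 ∨ k = n - 1) with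
    rfl | ⟨hk1, hk⟩ | hk | hk | hk
  · have := lt_three_of_neighbour h hd hneg ⟨1, by omega⟩
      (by simp only [ne_eq, Fin.mk.injEq]; omega) (by rw [D_mk]; grind) (by rw [D_mk]; grind)
    by_cases hm1 : m = 1
    · subst hm1
      exact isDynkinExtension_D_left hn
    · exact (not_isFiniteType_attachLeaf_D hn (.inr ⟨by omega, rfl⟩) h).elim
  · by_cases hm1 : m = 1
    · exact (not_isFiniteType_attachLeaf_D hn (.inl ⟨hm1, hk1, by simp only; omega⟩) h).elim
    · have := lt_two_of_two_neighbours h hd hneg ⟨k - 1, by omega⟩ ⟨k + 1, by omega⟩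
        (by simp only [ne_eq, Fin.mk.injEq]; omega) (by simp only [ne_eq, Fin.mk.injEq]; omega)
        (by simp only [ne_eq, Fin.mk.injEq]; omega)
        (by rw [D_mk]; grind) (by rw [D_mk]; grind) (by rw [D_mk]; grind) (by rw [D_mk]; grind)
      omega
  · by_cases hm1 : m = 1
    · exact (not_isFiniteType_attachLeaf_D hn (.inl ⟨hm1, by simp only; omega,
        by simp only; omega⟩) h).elim
    · have := lt_two_of_two_neighbours h hd hneg ⟨k + 1, by omega⟩ ⟨k + 2, by omega⟩
        (by simp only [ne_eq, Fin.mk.injEq]; omega) (by simp only [ne_eq, Fin.mk.injEq]; omega)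
        (by simp only [ne_eq, Fin.mk.injEq]; omega)
        (by rw [D_mk]; grind) (by rw [D_mk]; grind) (by rw [D_mk]; grind) (by rw [D_mk]; grind)
      omega
  · have := lt_three_of_neighbour h hd hneg ⟨n - 3, by omega⟩
      (by simp only [ne_eq, Fin.mk.injEq]; omega) (by rw [D_mk]; grind) (by rw [D_mk]; grind)
    have hs := Equiv.swap_apply_right (⟨n - 2, by omega⟩ : Fin n) ⟨n - 1, by omega⟩
    have hk' : (⟨k, hkn⟩ : Fin n) = ⟨n - 2, by omega⟩ := Fin.ext hk
    rw [hk'] at h ⊢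
    exact (isDynkinExtension_D_last hn (by omega) rfl
      (h.of_attachLeaf _ _ (Equiv.injective _) hs (D_swap hn))).of_symm _ hs (D_swap hn)
  · have := lt_three_of_neighbour h hd hneg ⟨n - 3, by omega⟩
      (by simp only [ne_eq, Fin.mk.injEq]; omega) (by rw [D_mk]; grind) (by rw [D_mk]; grind)
    exact isDynkinExtension_D_last hn (by omega) hk h

theorem isDynkinExtension (T : DynkinType n) (hm : m = 1 ∨ m = 2 ∨ m = 3)
    (h : IsFiniteType (attachLeaf T.cartanMatrix k m)) :
    IsDynkinExtension T.cartanMatrix k m := by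
  cases T
  case A => exact isDynkinExtension_A hm h
  case B hr => exact isDynkinExtension_B hr hm h
  case C hr => exact isDynkinExtension_C hr hm h
  case D hr => exact isDynkinExtension_D hr hm h
  case E₆ => exact isDynkinExtension_E₆ hm k h
  case E₇ => exact isDynkinExtension_E₇ hm k h
  case E₈ => exact isDynkinExtension_E₈ hm k h
  case F₄ => exact isDynkinExtension_F₄ hm k h
  case G₂ => exact isDynkinExtension_G₂ hm k h

/-- The Cartan–Killing classification of connected Cartan matrices of finite type. -/
theorem IsConnectedCartan.exists_dynkinType (n : ℕ) (hn : 1 ≤ n) :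
    ∀ {I : Type} [Fintype I] {A : Matrix I I ℤ}, Fintype.card I = n → IsConnectedCartan A →
      ∃ (T : DynkinType n) (f : Fin n → I), A.submatrix f f = T.cartanMatrix := by
  induction n, hn using Nat.le_induction with
  | base =>
    intro I _ A hI hA
    obtain ⟨x, -⟩ := Fintype.card_eq_one_iff.mp hI
    refine ⟨.A 1 le_rfl, fun _ => x, ?_⟩
    ext i j
    rw [Subsingleton.elim i 0, Subsingleton.elim j 0]
    simpa [DynkinType.cartanMatrix, CartanMatrix.A] using hA.diag x
  | succ n hn ih =>
    intro I _ A hI hA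
    classical
    obtain ⟨x, y, hxy, hyx, hx⟩ := hA.exists_leaf (by omega)
    obtain ⟨T, f, hf⟩ := ih (by simp [Fintype.card_subtype_compl, hI]) (hA.erase hxy hx)
    have hinj : Function.Injective f := by
      intro i j hij
      by_contra hne
      have h1 := T.cartanMatrix_nonpos i j hne
      rw [← hf, submatrix_apply, hij, submatrix_apply, hA.diag] at h1
      omega
    have hbij : Function.Bijective f :=
      (Fintype.bijective_iff_injective_and_card f).mpr
        ⟨hinj, by simp [Fintype.card_subtype_compl, hI]⟩
    obtain ⟨k, hk⟩ := hbij.2 ⟨y, hxy.symm⟩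
    let g : Fin (n + 1) → I := Fin.cons x (fun i => (f i : I))
    have hy : ∀ i, (f i : I) = y ↔ i = k := fun i => by
      rw [← hinj.eq_iff, hk, Subtype.ext_iff]
    have hg : A.submatrix g g = attachLeaf T.cartanMatrix k (-A x y) := by
      ext i j
      induction i using Fin.cases with
      | zero =>
        induction j using Fin.cases with
        | zero => simp [g, hA.diag]
        | succ j =>
          simp only [submatrix_apply, g, Fin.cons_zero, Fin.cons_succ, attachLeaf_zero_succ,
            ← hy]
          split_ifs with h
          · rw [h, neg_neg]
          · exact hA.zero_symm _ _ (hx _ (f j).2 h)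
      | succ i =>
        induction j using Fin.cases with
        | zero =>
          simp only [submatrix_apply, g, Fin.cons_zero, Fin.cons_succ, attachLeaf_succ_zero,
            ← hy]
          split_ifs with h
          · rw [h, hyx]
          · exact hx _ (f i).2 h
        | succ j =>
          simp [g, ← hf]
    have hginj : Function.Injective g := by
      rw [Fin.cons_injective_iff]
      refine ⟨?_, Subtype.val_injective.comp hinj⟩
      rintro ⟨i, hi⟩
      exact (f i).2 hi
    have hm : -A x y = 1 ∨ -A x y = 2 ∨ -A x y = 3 := by
      have h1 := hA.mul_lt_four hxy
      have h2 := hA.nonpos x y hxy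
      have h3 : A x y ≠ 0 := fun h => by
        have := hA.zero_symm _ _ h
        omega
      rw [hyx] at h1
      omega
    have hfin := hA.finite.submatrix hginj
    rw [hg] at hfin
    obtain ⟨T', f', hf'⟩ := isDynkinExtension T hm hfin
    exact ⟨T', g ∘ f', by rw [← hf', ← hg, submatrix_submatrix]⟩

end RootPeeling

namespace RootPeeling

open Matrix

variable {ι M N : Type*} [AddCommGroup M] [Module ℝ M]
    [AddCommGroup N] [Module ℝ N] {Φ : RootPairing ι ℝ M N} {b : Φ.Base}

namespace IsExtendedSimpleSystem

variable {r : ℕ} {α : Fin (r + 1) → ι} (hα : IsExtendedSimpleSystem b α)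

/-- The simple roots, indexed by `1, …, r`. -/
noncomputable def supportEquiv : Fin r ≃ b.support :=
  (Equiv.Set.univ (Fin r)).symm.trans (hα.bijOn_succ.equiv _)

theorem coe_supportEquiv (i : Fin r) : (hα.supportEquiv i : ι) = α i.succ := rfl

include hα in
theorem image_support : Φ.root '' (b.support : Set ι) = Set.range fun i : Fin r => Φ.root (α i.succ) := by
  rw [← hα.bijOn_succ.image_eq, Set.image_image, Set.image_univ]

variable [Finite ι]

include hα in
theorem isConnectedCartan [Φ.IsRootSystem] [Φ.IsCrystallographic] [Φ.IsReduced]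
    [Φ.IsIrreducible] :
    IsConnectedCartan (fun i j : Fin r => Φ.pairingIn ℤ (α i.succ) (α j.succ)) where
  diag i := b.cartanMatrix_apply_same (hα.supportEquiv i)
  nonpos i j hij := b.cartanMatrix_le_zero_of_ne (hα.supportEquiv i) (hα.supportEquiv j)
    (hα.supportEquiv.injective.ne hij)
  zero_symm i j h :=
    (b.cartanMatrix_apply_eq_zero_iff_symm (i := hα.supportEquiv i)
      (j := hα.supportEquiv j)).mp h
  conn p := by
    rintro ⟨i, hi⟩ hp j
    have := b.induction_on_cartanMatrix (fun x => p (hα.supportEquiv.symm x))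
      (i := hα.supportEquiv i) (j := hα.supportEquiv j) (by simpa using hi) (fun x y hx hxy => by
        refine hp _ _ hx ?_
        simp only [← hα.coe_supportEquiv, Equiv.apply_symm_apply]
        exact hxy)
    simpa using this
  finite c hc hc0 := by
    classical
    obtain ⟨d, hd, hpos⟩ := b.exists_cartanMatrix_mul_diagaonal_posDef
    by_contra! hcon
    have hne : c ∘ hα.supportEquiv.symm ≠ 0 := fun h => hc0 <| by
      ext i
      simpa using congrFun h (hα.supportEquiv i)
    have h := hpos.dotProduct_mulVec_pos hne
    refine absurd h (not_lt.mpr ?_)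
    have : star (c ∘ hα.supportEquiv.symm) ⬝ᵥ
        (b.cartanMatrix * diagonal d) *ᵥ (c ∘ hα.supportEquiv.symm) =
        ∑ i : Fin r, d (hα.supportEquiv i) * (c i * ∑ j, c j *
          Φ.pairingIn ℤ (α j.succ) (α i.succ)) := by
      simp only [dotProduct, mulVec, mul_diagonal]
      rw [← hα.supportEquiv.sum_comp]
      simp only [← hα.supportEquiv.sum_comp, Finset.mul_sum]
      rw [Finset.sum_comm]
      refine Finset.sum_congr rfl fun i _ => Finset.sum_congr rfl fun j _ => ?_
      simp [RootPairing.Base.cartanMatrixIn_def, hα.coe_supportEquiv]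
      ring
    rw [this]
    refine Finset.sum_nonpos fun i _ => mul_nonpos_of_nonneg_of_nonpos (hd _).le ?_
    rcases (hc i).eq_or_lt with h0 | h0
    · rw [← h0]; simp
    · exact mul_nonpos_of_nonneg_of_nonpos h0.le (hcon i h0)

include hα in
theorem exists_isLabelling [Φ.IsRootSystem] [Φ.IsCrystallographic] [Φ.IsReduced]
    [Φ.IsIrreducible] :
    ∃ (T : DynkinType r) (σ : Equiv.Perm (Fin (r + 1))), IsLabelling Φ α T σ := by
  have hr : 1 ≤ r := by
    have : Nontrivial M := RootPairing.IsIrreducible.nontrivial Φ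
    have : Nonempty ι := ⟨α 0⟩
    obtain ⟨i, hi⟩ := b.support_nonempty
    exact Fin.pos (hα.supportEquiv.symm ⟨i, hi⟩)
  obtain ⟨T, f, hf⟩ := IsConnectedCartan.exists_dynkinType r hr (Fintype.card_fin r)
    hα.isConnectedCartan
  have hf' (i j : Fin r) : Φ.pairingIn ℤ (α (f i).succ) (α (f j).succ) = T.cartanMatrix i j :=
    congrFun₂ hf i j
  have hinj : Function.Injective f := by
    intro i j hij
    by_contra hne
    have h1 := T.cartanMatrix_nonpos i j hne
    rw [← hf', hij] at h1
    exact absurd (h1.trans_eq' (hα.isConnectedCartan.diag (f j))) (by norm_num)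
  refine ⟨T, Equiv.Perm.decomposeFin.symm
    (0, Equiv.ofBijective f (Finite.injective_iff_bijective.mp hinj)), ?_, fun i j => ?_⟩
  · simp
  · rw [← hf']
    simp

end IsExtendedSimpleSystem

end RootPeeling

namespace RootPeeling

open Matrix

namespace IsExtendedSimpleSystem

variable {ι M N : Type*} [AddCommGroup M] [Module ℝ M]
    [AddCommGroup N] [Module ℝ N] {Φ : RootPairing ι ℝ M N} {b : Φ.Base}
    {r : ℕ} {α : Fin (r + 1) → ι} (hα : IsExtendedSimpleSystem b α)

section basis

variable [Φ.IsRootSystem]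

/-- The basis of simple roots. -/
noncomputable def basis : Module.Basis (Fin r) ℝ M := b.toWeightBasis.reindex hα.supportEquiv.symm

@[simp] theorem basis_apply (i : Fin r) : hα.basis i = Φ.root (α i.succ) := by
  simp [basis, hα.coe_supportEquiv]

theorem repr_nonneg {x : M} (hx : x ∈ AddSubmonoid.closure (Φ.root '' (b.support : Set ι)))
    (j : Fin r) : 0 ≤ hα.basis.repr x j := by
  rw [hα.image_support] at hx
  induction hx using AddSubmonoid.closure_induction with
  | mem x hx =>
    obtain ⟨i, rfl⟩ := hx
    simp only [← hα.basis_apply, Module.Basis.repr_self, Finsupp.single_apply]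
    split_ifs <;> simp
  | zero => simp
  | add x y _ _ hx hy => simpa using add_nonneg hx hy

/-- The mark of a simple root: its coefficient in the highest root `-α_0`. -/
noncomputable def mark (j : Fin r) : ℝ := -hα.basis.repr (Φ.root (α 0)) j

theorem neg_repr_le_mark (i : ι) (j : Fin r) : -hα.basis.repr (Φ.root i) j ≤ hα.mark j := by
  have := hα.repr_nonneg (hα.lowest i) j
  rw [map_sub, Finsupp.sub_apply] at this
  rw [mark]
  linarith

theorem repr_le_mark (i : ι) (j : Fin r) : hα.basis.repr (Φ.root i) j ≤ hα.mark j := by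
  simpa using hα.neg_repr_le_mark (Φ.reflectionPerm i i) j

theorem one_le_mark (j : Fin r) : 1 ≤ hα.mark j := by
  have := hα.repr_le_mark (α j.succ) j
  rwa [← hα.basis_apply, Module.Basis.repr_self, Finsupp.single_eq_same] at this

include hα in
/-- The roots `α_j`, `j ∈ J`, lie in an open half-space if `J` is proper. -/
theorem exists_dual_pos {J : Set (Fin (r + 1))} (hJ : J ≠ Set.univ) :
    ∃ φ : M →ₗ[ℝ] ℝ, ∀ j ∈ J, 0 < φ (Φ.root (α j)) := by
  obtain ⟨k, hk⟩ := (Set.ne_univ_iff_exists_notMem J).mp hJ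
  have hsimple (c : ℝ) (k j : Fin r) :
      ((∑ i, hα.basis.coord i) - c • hα.basis.coord k : M →ₗ[ℝ] ℝ) (Φ.root (α j.succ)) =
        1 - c * if j = k then 1 else 0 := by
    rw [← hα.basis_apply]
    simp [-basis_apply, Finsupp.single_apply]
  induction k using Fin.cases with
  | zero =>
    refine ⟨∑ i, hα.basis.coord i, fun j hj => ?_⟩
    induction j using Fin.cases with
    | zero => exact absurd hj hk
    | succ j =>
      have := hsimple 0 j j
      simp only [zero_smul, sub_zero, zero_mul] at this
      rw [this]
      exact one_pos
  | succ k =>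
    refine ⟨(∑ i, hα.basis.coord i) - (∑ i, hα.mark i + 1) • hα.basis.coord k, fun j hj => ?_⟩
    induction j using Fin.cases with
    | zero =>
      have h1 : ∀ i, hα.basis.coord i (Φ.root (α 0)) = -hα.mark i := fun i => by simp [mark]
      have h2 := hα.one_le_mark k
      have h3 : 0 ≤ ∑ i, hα.mark i :=
        Finset.sum_nonneg fun i _ => zero_le_one.trans (hα.one_le_mark i)
      simp only [LinearMap.sub_apply, LinearMap.sum_apply, LinearMap.smul_apply, h1,
        Finset.sum_neg_distrib, smul_eq_mul]
      nlinarith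
    | succ j =>
      rw [hsimple, if_neg (by rintro rfl; exact hk hj)]
      simp

include hα in
theorem root_ne_neg_of_mem_parabolicPos {J : Set (Fin (r + 1))} (hJ : J ≠ Set.univ) {i i' : ι}
    (hi : i ∈ parabolicPos Φ α J) (hi' : i' ∈ parabolicPos Φ α J) :
    Φ.root i ≠ -Φ.root i' := by
  obtain ⟨φ, hφ⟩ := hα.exists_dual_pos hJ
  have key (x : M) (hx : x ∈ AddSubmonoid.closure ((fun j => Φ.root (α j)) '' J)) :
      x = 0 ∨ 0 < φ x := by
    induction hx using AddSubmonoid.closure_induction with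
    | mem x hx =>
      obtain ⟨j, hj, rfl⟩ := hx
      exact .inr (hφ j hj)
    | zero => exact .inl rfl
    | add x y _ _ hx hy =>
      rcases hx with rfl | hx
      · simpa using hy
      · rcases hy with rfl | hy
        · simpa using Or.inr hx
        · exact .inr (by rw [map_add]; exact add_pos hx hy)
  intro h
  have h1 := (key _ hi.2).resolve_left (Φ.ne_zero i)
  have h2 := (key _ hi'.2).resolve_left (Φ.ne_zero i')
  rw [h, map_neg] at h1
  linarith

include hα in
theorem eq_zero_of_coroot' {x : M} (hx : ∀ j : Fin r, Φ.coroot' (α j.succ) x = 0) : x = 0 := by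
  have h : Φ.toLinearMap x = 0 := by
    refine b.toCoweightBasis.ext fun i => ?_
    rw [b.toCoweightBasis_apply]
    obtain ⟨j, rfl⟩ := hα.supportEquiv.surjective i
    exact hx j
  exact (LinearMap.IsPerfPair.bijective_left Φ.toLinearMap).1 (by rw [h, map_zero])

include hα in
/-- A linear map through which the simple coroots factor is injective. -/
theorem injective_of_coroot' {V : Type*} [AddCommGroup V] [Module ℝ V] {L : M →ₗ[ℝ] V}
    {φ : Fin r → V →ₗ[ℝ] ℝ} (hφ : ∀ j x, Φ.coroot' (α j.succ) x = φ j (L x)) :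
    Function.Injective L := by
  rw [injective_iff_map_eq_zero]
  intro x hx
  exact hα.eq_zero_of_coroot' fun j => by rw [hφ, hx, map_zero]

include hα in
/-- The coroots factor through a linear map if they do so on simple roots. -/
theorem coroot'_eq_of_basis [Φ.IsCrystallographic] {V : Type*} [AddCommGroup V] [Module ℝ V]
    {L : M →ₗ[ℝ] V} {φ : Fin r → V →ₗ[ℝ] ℝ}
    (hφ : ∀ i j : Fin r, φ j (L (Φ.root (α i.succ))) = Φ.pairingIn ℤ (α i.succ) (α j.succ))
    (j : Fin r) (x : M) : Φ.coroot' (α j.succ) x = φ j (L x) := by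
  suffices Φ.coroot' (α j.succ) = φ j ∘ₗ L by rw [this]; rfl
  refine hα.basis.ext fun i => ?_
  rw [hα.basis_apply, LinearMap.comp_apply, hφ, Φ.root_coroot'_eq_pairing,
    ← Φ.algebraMap_pairingIn ℤ]
  rfl

end basis

section induction

variable [Finite ι] [Φ.IsCrystallographic] [Φ.IsReduced]

include hα in
theorem root_mem_of_reflection {S : Set M} (hs : ∀ j : Fin r, Φ.root (α j.succ) ∈ S)
    (hneg : ∀ x ∈ S, -x ∈ S)
    (href : ∀ x ∈ S, ∀ j : Fin r, x - Φ.coroot' (α j.succ) x • Φ.root (α j.succ) ∈ S) (i : ι) :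
    Φ.root i ∈ S := by
  have hsupp : ∀ i ∈ b.support, ∃ j : Fin r, i = α j.succ := fun i hi => by
    obtain ⟨j, hj⟩ := hα.supportEquiv.surjective ⟨i, hi⟩
    exact ⟨j, by rw [← hα.coe_supportEquiv, hj]⟩
  refine b.induction_reflect i (p := fun i => Φ.root i ∈ S) ?_ ?_ ?_
  · intro i hi
    simpa using hneg _ hi
  · intro i hi
    obtain ⟨j, rfl⟩ := hsupp i hi
    exact hs j
  · intro i k hi hk
    obtain ⟨j, rfl⟩ := hsupp k hk
    have := href _ hi j
    rwa [← Φ.reflection_apply, ← Φ.root_reflectionPerm] at this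

omit [Finite ι] [Φ.IsCrystallographic] in
theorem eq_or_eq_neg_of_root_eq_smul {i i' : ι} {c : ℝ} (h : Φ.root i = c • Φ.root i') :
    i = i' ∨ Φ.root i = -Φ.root i' := by
  by_contra! hne
  have := RootPairing.IsReduced.linearIndependent Φ hne.1 hne.2
  rw [LinearIndependent.pair_iff] at this
  have := this 1 (-c) (by rw [h]; module)
  exact one_ne_zero this.1

variable [Φ.IsRootSystem]

omit [Finite ι] [Φ.IsCrystallographic] in
include hα in
/-- `|Σ_J^+|` is at most the number of lines spanned by model vectors `v y`, `y ∈ S`, that lie in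
the span of the `α_j`, `j ∈ J`. -/
theorem ncard_parabolicPos_le {V Y : Type*} [AddCommGroup V] [Module ℝ V] {L : M →ₗ[ℝ] V}
    (hL : Function.Injective L) (v : Y → V) (S : Finset Y)
    (hroot : ∀ i, ∃ y ∈ S, ∃ c : ℝ, c ≠ 0 ∧ L (Φ.root i) = c • v y)
    {J : Set (Fin (r + 1))} (hJ : J ≠ Set.univ) [DecidablePred fun y => v y ∈
      (Submodule.span ℝ ((fun j => Φ.root (α j)) '' J)).map L] :
    (parabolicPos Φ α J).ncard ≤ (S.filter fun y => v y ∈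
      (Submodule.span ℝ ((fun j => Φ.root (α j)) '' J)).map L).card := by
  choose y hyS c hc hy using hroot
  rw [← Set.ncard_coe_finset]
  refine Set.ncard_le_ncard_of_injOn y (fun i hi => ?_) (fun i hi i' hi' h => ?_)
    (Finset.finite_toSet _)
  · simp only [Finset.coe_filter, Set.mem_ofPred_eq]
    refine ⟨hyS i, ?_⟩
    have hmem : Φ.root i ∈ Submodule.span ℝ ((fun j => Φ.root (α j)) '' J) :=
      (AddSubmonoid.closure_le.mpr Submodule.subset_span :
        _ ≤ (Submodule.span ℝ ((fun j => Φ.root (α j)) '' J)).toAddSubmonoid) hi.2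
    have h1 : v (y i) = L ((c i)⁻¹ • Φ.root i) := by
      rw [map_smul, hy, smul_smul, inv_mul_cancel₀ (hc i), one_smul]
    rw [h1]
    exact Submodule.mem_map_of_mem (Submodule.smul_mem _ _ hmem)
  · have h1 : Φ.root i = (c i * (c i')⁻¹) • Φ.root i' := by
      apply hL
      rw [map_smul, hy i, hy i', h, smul_smul, mul_assoc, inv_mul_cancel₀ (hc i'), mul_one]
    exact (eq_or_eq_neg_of_root_eq_smul h1).resolve_right
      (hα.root_ne_neg_of_mem_parabolicPos hJ hi hi')

omit [Finite ι] [Φ.IsCrystallographic] [Φ.IsReduced] [Φ.IsRootSystem] in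
theorem finrank_map_span_le {V : Type*} [AddCommGroup V] [Module ℝ V] (L : M →ₗ[ℝ] V)
    (J : Set (Fin (r + 1))) :
    Module.finrank ℝ ((Submodule.span ℝ ((fun j => Φ.root (α j)) '' J)).map L) ≤ J.ncard := by
  classical
  rw [Submodule.map_span, Set.image_image]
  have := finrank_span_finset_le_card (R := ℝ) (J.toFinset.image fun j => L (Φ.root (α j)))
  rw [Finset.coe_image, Set.coe_toFinset] at this
  refine this.trans (Finset.card_image_le.trans_eq ?_)
  rw [Set.ncard_eq_toFinset_card']

end induction

end IsExtendedSimpleSystem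

end RootPeeling

namespace RootPeeling

open Matrix

/-- The unit vectors of the space of sequences. -/
noncomputable def unitVec (a : ℕ) : ℕ → ℝ := Pi.single a 1

theorem unitVec_apply (a x : ℕ) : unitVec a x = if x = a then 1 else 0 := by
  rw [unitVec, Pi.single_apply]

/-- The vectors `e_a - e_b` and `e_a + e_b`. -/
noncomputable def pairVec (y : ℕ × ℕ × Bool) : ℕ → ℝ :=
  unitVec y.1 + (if y.2.2 then (1 : ℝ) else -1) • unitVec y.2.1

theorem pairVec_apply (y : ℕ × ℕ × Bool) (x : ℕ) :
    pairVec y x = (if x = y.1 then 1 else 0) +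
      (if y.2.2 then 1 else -1) * (if x = y.2.1 then 1 else 0) := by
  simp only [pairVec, Pi.add_apply, Pi.smul_apply, smul_eq_mul, unitVec_apply]

/-- The positive roots of type `D_n`, in the form `e_a ± e_b`. -/
def orderedPairs (n : ℕ) : Finset (ℕ × ℕ × Bool) :=
  (Finset.range n ×ˢ Finset.range n ×ˢ Finset.univ).filter fun y => y.1 < y.2.1

theorem mem_orderedPairs {n : ℕ} {y : ℕ × ℕ × Bool} :
    y ∈ orderedPairs n ↔ y.1 < y.2.1 ∧ y.2.1 < n := by
  simp [orderedPairs]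
  omega

theorem card_le_finrank {W : Submodule ℝ (ℕ → ℝ)} [FiniteDimensional ℝ W] (S : Finset ℕ)
    (u : ℕ → ℕ → ℝ) (hu : ∀ j ∈ S, u j ∈ W) (hne : ∀ j ∈ S, u j j ≠ 0)
    (hz : ∀ j ∈ S, ∀ l ∈ S, j ≠ l → u j l = 0) : S.card ≤ Module.finrank ℝ W := by
  have hli : LinearIndependent ℝ (fun j : S => (⟨u j, hu j j.2⟩ : W)) := by
    rw [Fintype.linearIndependent_iff]
    intro g hg l
    have h1 := congrFun (congrArg Subtype.val hg) l
    simp only [AddSubmonoidClass.coe_finsetSum, Submodule.coe_smul, Finset.sum_apply,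
      Pi.smul_apply, smul_eq_mul, ZeroMemClass.coe_zero, Pi.zero_apply] at h1
    rw [Finset.sum_eq_single l (fun j _ hjl => by
      rw [hz j j.2 l l.2 (fun h => hjl (Subtype.ext h)), mul_zero]) (by simp)] at h1
    exact (mul_eq_zero.mp h1).resolve_right (hne l l.2)
  simpa using hli.fintype_card_le_finrank

open Classical in
theorem card_axis_le (n : ℕ) (W : Submodule ℝ (ℕ → ℝ)) [FiniteDimensional ℝ W] :
    ((Finset.range n).filter fun a => unitVec a ∈ W).card ≤ Module.finrank ℝ W := by
  refine card_le_finrank _ unitVec (fun j hj => (Finset.mem_filter.mp hj).2) (fun j hj => ?_)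
    (fun j hj l hl hjl => ?_)
  · simp [unitVec_apply]
  · simp [unitVec_apply, hjl.symm]

open Classical in
/-- The vectors `±e_i ± e_j` in a subspace that does not contain `e_i`. -/
theorem card_pairs_through_le {n : ℕ} {W : Submodule ℝ (ℕ → ℝ)} [FiniteDimensional ℝ W] {i : ℕ}
    (hi : unitVec i ∉ W) :
    ((orderedPairs n).filter fun y => pairVec y ∈ W ∧ (y.1 = i ∨ y.2.1 = i)).card ≤
      Module.finrank ℝ W := by
  set T := (orderedPairs n).filter fun y => pairVec y ∈ W ∧ (y.1 = i ∨ y.2.1 = i) with hT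
  let o : ℕ × ℕ × Bool → ℕ := fun y => if y.1 = i then y.2.1 else y.1
  have hoi : ∀ y ∈ T, o y ≠ i := by
    intro y hy
    simp only [hT, Finset.mem_filter, mem_orderedPairs] at hy
    simp only [o]
    grind
  have hinj : Set.InjOn o T := by
    rintro ⟨a, c, t⟩ hy ⟨a', c', t'⟩ hy' h
    simp only [hT, Finset.coe_filter, Set.mem_ofPred_eq, mem_orderedPairs] at hy hy'
    simp only [o] at h
    have h1 : a = a' := by grind
    have h2 : c = c' := by grind
    subst h1 h2
    by_contra hne
    have htt : t ≠ t' := fun h => hne (by rw [h])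
    have hp : pairVec (a, c, true) ∈ W ∧ pairVec (a, c, false) ∈ W := by
      cases t <;> cases t' <;> grind
    have hadd : (2⁻¹ : ℝ) • (pairVec (a, c, true) + pairVec (a, c, false)) = unitVec a := by
      ext x
      simp [pairVec]
      ring
    have hsub : (2⁻¹ : ℝ) • (pairVec (a, c, true) - pairVec (a, c, false)) = unitVec c := by
      ext x
      simp [pairVec]
      ring
    have h1 := W.smul_mem (2⁻¹ : ℝ) (W.add_mem hp.1 hp.2)
    have h2 := W.smul_mem (2⁻¹ : ℝ) (W.sub_mem hp.1 hp.2)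
    rw [hadd] at h1
    rw [hsub] at h2
    rcases hy.2.2 with h | h
    · exact hi (h ▸ h1)
    · exact hi (h ▸ h2)
  rw [← Finset.card_image_of_injOn hinj]
  have hex : ∀ j ∈ T.image o, ∃ y ∈ T, o y = j := by simp
  choose! y hyT hyo using hex
  refine card_le_finrank _ (fun j => pairVec (y j)) (fun j hj => ?_) (fun j hj => ?_)
    (fun j hj l hl hjl => ?_)
  · have := hyT j hj
    simp only [hT, Finset.mem_filter] at this
    exact this.2.1
  · have h1 := hyT j hj
    have h2 := hyo j hj
    simp only [hT, Finset.mem_filter, mem_orderedPairs] at h1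
    simp only [o] at h2
    rw [pairVec_apply]
    grind
  · have h1 := hyT j hj
    have h2 := hyo j hj
    have h3 := hoi _ (hyT l hl)
    have h4 := hyo l hl
    simp only [hT, Finset.mem_filter, mem_orderedPairs] at h1
    rw [h4] at h3
    simp only [o] at h2
    rw [pairVec_apply]
    grind

open Classical in
/-- The number of positive roots of type `D_n` or `B_n` in a subspace. -/
theorem two_mul_card_pairs_le (n : ℕ) (k : ℕ) :
    ∀ (W : Submodule ℝ (ℕ → ℝ)) [FiniteDimensional ℝ W], Module.finrank ℝ W ≤ k →
      2 * ((orderedPairs n).filter fun y => pairVec y ∈ W).card +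
        3 * ((Finset.range n).filter fun a => unitVec a ∈ W).card ≤
      ((Finset.range n).filter fun a => unitVec a ∈ W).card ^ 2 + k ^ 2 + k := by
  induction k with
  | zero =>
    intro W _ hW
    have hW0 : W = ⊥ := Submodule.finrank_eq_zero.mp (Nat.le_zero.mp hW)
    subst hW0
    have h1 : (orderedPairs n).filter (fun y => pairVec y ∈ (⊥ : Submodule ℝ (ℕ → ℝ))) = ∅ := by
      refine Finset.filter_eq_empty_iff.mpr fun y hy h => ?_
      rw [mem_orderedPairs] at hy
      have := congrFun ((Submodule.mem_bot ℝ).mp h) y.1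
      rw [pairVec_apply] at this
      simp [hy.1.ne] at this
    have h2 : (Finset.range n).filter (fun a => unitVec a ∈ (⊥ : Submodule ℝ (ℕ → ℝ))) = ∅ := by
      refine Finset.filter_eq_empty_iff.mpr fun y hy h => ?_
      have := congrFun ((Submodule.mem_bot ℝ).mp h) y
      rw [unitVec_apply] at this
      simp at this
    rw [h1, h2]
    simp
  | succ k ih =>
    intro W _ hW
    by_cases hcase : ∃ i, (∃ w ∈ W, w i ≠ 0) ∧ unitVec i ∉ W
    · obtain ⟨i, ⟨w, hw, hwi⟩, hi⟩ := hcase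
      set W' := W ⊓ LinearMap.ker (LinearMap.proj i : (ℕ → ℝ) →ₗ[ℝ] ℝ) with hW'
      have hlt : W' < W := by
        refine lt_of_le_of_ne inf_le_left fun h => ?_
        rw [← h, hW', Submodule.mem_inf, LinearMap.mem_ker] at hw
        exact hwi hw.2
      have : FiniteDimensional ℝ W' := Submodule.finiteDimensional_of_le hlt.le
      have hfr := Submodule.finrank_lt_finrank_of_lt hlt
      have hind := ih W' (by omega)
      have hs : (Finset.range n).filter (fun a => unitVec a ∈ W') =
          (Finset.range n).filter (fun a => unitVec a ∈ W) := by
        refine Finset.filter_congr fun a _ => ?_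
        rw [hW', Submodule.mem_inf, LinearMap.mem_ker, LinearMap.proj_apply, unitVec_apply]
        refine ⟨And.left, fun h => ⟨h, if_neg ?_⟩⟩
        rintro rfl
        exact hi h
      have hF : ((orderedPairs n).filter fun y => pairVec y ∈ W).card ≤
          ((orderedPairs n).filter fun y => pairVec y ∈ W').card +
          ((orderedPairs n).filter fun y => pairVec y ∈ W ∧ (y.1 = i ∨ y.2.1 = i)).card := by
        refine (Finset.card_le_card fun y hy => ?_).trans (Finset.card_union_le _ _)
        simp only [Finset.mem_union, Finset.mem_filter, hW', Submodule.mem_inf,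
          LinearMap.mem_ker, LinearMap.proj_apply, pairVec_apply] at hy ⊢
        grind
      have hT := card_pairs_through_le (n := n) hi
      rw [hs] at hind
      nlinarith
    · push Not at hcase
      set S := (Finset.range n).filter fun a => unitVec a ∈ W with hS
      have hSk : S.card ≤ k + 1 := (card_axis_le n W).trans hW
      have hF : ((orderedPairs n).filter fun y => pairVec y ∈ W).card ≤ S.offDiag.card := by
        refine Finset.card_le_card_of_injOn
          (fun y => if y.2.2 then (y.1, y.2.1) else (y.2.1, y.1)) (fun y hy => ?_) ?_
        · simp only [Finset.coe_filter, Set.mem_ofPred_eq, mem_orderedPairs] at hy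
          have h1 := hcase y.1 ⟨_, hy.2, by rw [pairVec_apply]; grind⟩
          have h2 := hcase y.2.1 ⟨_, hy.2, by rw [pairVec_apply]; grind⟩
          simp only [Finset.mem_coe, Finset.mem_offDiag, hS, Finset.mem_filter, Finset.mem_range]
          split_ifs <;> grind
        · rintro ⟨a, c, t⟩ hy ⟨a', c', t'⟩ hy' h
          simp only [Finset.coe_filter, Set.mem_ofPred_eq, mem_orderedPairs] at hy hy' h
          cases t <;> cases t' <;> grind
      rw [Finset.offDiag_card] at hF
      have : S.card ≤ S.card * S.card := Nat.le_mul_self _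
      zify [this] at hF ⊢
      nlinarith

end RootPeeling

namespace RootPeeling

open Matrix

variable {ι M N : Type*} [AddCommGroup M] [Module ℝ M]
    [AddCommGroup N] [Module ℝ N] {Φ : RootPairing ι ℝ M N} {b : Φ.Base}
    {r : ℕ} {α : Fin (r + 1) → ι}

theorem mem_parabolicPos_iff {J : Set (Fin (r + 1))} {i : ι} : i ∈ parabolicPos Φ α J ↔
    Φ.root i ∈ AddSubmonoid.closure ((fun j => Φ.root (α j)) '' J) :=
  ⟨And.right, fun h => ⟨(AddSubmonoid.closure_le.mpr AddSubgroup.subset_closure :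
    _ ≤ (AddSubgroup.closure ((fun j => Φ.root (α j)) '' J)).toAddSubmonoid) h, h⟩⟩

section attained

variable {V : Type*} [AddCommGroup V] [Module ℝ V]

variable (Φ α) in
/-- The images under `L` of the roots in `Σ_J^+`. -/
def attained (L : M →ₗ[ℝ] V) (J : Set (Fin (r + 1))) : Set V :=
  (fun i => L (Φ.root i)) '' parabolicPos Φ α J

variable {L : M →ₗ[ℝ] V} {φ : Fin r → V →ₗ[ℝ] ℝ} {J : Set (Fin (r + 1))}

theorem simple_mem_attained {j : Fin (r + 1)} (hj : j ∈ J) :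
    L (Φ.root (α j)) ∈ attained Φ α L J :=
  ⟨α j, mem_parabolicPos_iff.mpr (AddSubmonoid.subset_closure ⟨j, hj, rfl⟩), rfl⟩

theorem reflection_mem_attained [Φ.IsCrystallographic]
    (hφ : ∀ j x, Φ.coroot' (α j.succ) x = φ j (L x)) {j : Fin r}
    (hj : j.succ ∈ J) {x : V} (hx : x ∈ attained Φ α L J) (hneg : φ j x ≤ 0) :
    x - φ j x • L (Φ.root (α j.succ)) ∈ attained Φ α L J := by
  obtain ⟨i, hi, rfl⟩ := hx
  simp only at hneg ⊢
  rw [← hφ] at hneg ⊢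
  rw [← map_smul, ← map_sub, ← Φ.reflection_apply, ← Φ.root_reflectionPerm]
  refine ⟨_, mem_parabolicPos_iff.mpr ?_, rfl⟩
  rw [mem_parabolicPos_iff] at hi
  have hp : Φ.coroot' (α j.succ) (Φ.root i) = (Φ.pairingIn ℤ i (α j.succ) : ℝ) := by
    rw [Φ.root_coroot'_eq_pairing, ← Φ.algebraMap_pairingIn ℤ]
    rfl
  rw [Φ.root_reflectionPerm, Φ.reflection_apply, hp]
  rw [hp] at hneg
  obtain ⟨m, hm⟩ := Int.eq_ofNat_of_zero_le (neg_nonneg.mpr (Int.cast_nonpos.mp hneg))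
  have : (Φ.pairingIn ℤ i (α j.succ) : ℝ) = -(m : ℝ) := by
    rw [← Int.cast_natCast (R := ℝ) m, ← Int.cast_neg]
    congr 1
    omega
  rw [this, neg_smul, sub_neg_eq_add, Nat.cast_smul_eq_nsmul]
  have hmem : Φ.root (α j.succ) ∈ AddSubmonoid.closure ((fun j => Φ.root (α j)) '' J) :=
    AddSubmonoid.subset_closure ⟨_, hj, rfl⟩
  exact add_mem hi (nsmul_mem hmem _)

theorem card_le_ncard_parabolicPos [Finite ι] {Y : Type*} (S : Finset Y) (v : Y → V)
    (hv : Set.InjOn v S) (hS : ∀ y ∈ S, v y ∈ attained Φ α L J) :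
    S.card ≤ (parabolicPos Φ α J).ncard := by
  classical
  rw [← Finset.card_image_of_injOn hv, ← Set.ncard_coe_finset]
  refine (Set.ncard_le_ncard ?_ ((Set.toFinite _).image _)).trans
    (Set.ncard_image_le (Set.toFinite _) (f := fun i => L (Φ.root i)))
  intro x hx
  obtain ⟨y, hy, rfl⟩ := Finset.mem_image.mp hx
  exact hS y hy

end attained

/-- The coordinate functionals. -/
def coordFun (j : ℕ) : (ℕ → ℝ) →ₗ[ℝ] ℝ := LinearMap.proj j

@[simp] theorem coordFun_apply (j : ℕ) (x : ℕ → ℝ) : coordFun j x = x j := rfl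

/-- The vectors `±e_a ± e_b`, `a ≠ b`. -/
def IsPairVec (n : ℕ) (x : ℕ → ℝ) : Prop :=
  ∃ a b : ℕ, a < n ∧ b < n ∧ a ≠ b ∧ ∃ s t : ℝ, (s = 1 ∨ s = -1) ∧ (t = 1 ∨ t = -1) ∧
    x = s • unitVec a + t • unitVec b

/-- The nonzero multiples of unit vectors. -/
def IsAxisVec (n : ℕ) (x : ℕ → ℝ) : Prop :=
  ∃ a < n, ∃ c : ℝ, c ≠ 0 ∧ x = c • unitVec a

theorem IsPairVec.exists_mem_orderedPairs {n : ℕ} {x : ℕ → ℝ} (hx : IsPairVec n x) :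
    ∃ y ∈ orderedPairs n, ∃ c : ℝ, c ≠ 0 ∧ x = c • pairVec y := by
  obtain ⟨a, b, ha, hb, hab, s, t, hs, ht, rfl⟩ := hx
  rcases lt_or_gt_of_ne hab with h | h
  · refine ⟨(a, b, decide (s = t)), mem_orderedPairs.mpr ⟨h, hb⟩, s, by grind, ?_⟩
    rcases hs with rfl | rfl <;> rcases ht with rfl | rfl <;> norm_num [pairVec]
  · refine ⟨(b, a, decide (s = t)), mem_orderedPairs.mpr ⟨h, ha⟩, t, by grind, ?_⟩
    rcases hs with rfl | rfl <;> rcases ht with rfl | rfl <;> norm_num [pairVec] <;> module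

theorem IsPairVec.neg {n : ℕ} {x : ℕ → ℝ} (hx : IsPairVec n x) : IsPairVec n (-x) := by
  obtain ⟨a, b, ha, hb, hab, s, t, hs, ht, rfl⟩ := hx
  exact ⟨a, b, ha, hb, hab, -s, -t, by grind, by grind, by module⟩

theorem IsAxisVec.neg {n : ℕ} {x : ℕ → ℝ} (hx : IsAxisVec n x) : IsAxisVec n (-x) := by
  obtain ⟨a, ha, c, hc, rfl⟩ := hx
  exact ⟨a, ha, -c, by simpa using hc, by module⟩

/-- The reflection `x ↦ x - φ(x) v` permutes the first `n` unit vectors up to sign. -/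
def IsSignedPerm (n : ℕ) (φ : (ℕ → ℝ) →ₗ[ℝ] ℝ) (v : ℕ → ℝ) : Prop :=
  ∃ (π : Equiv.Perm ℕ) (s : ℕ → ℝ), (∀ a, s a = 1 ∨ s a = -1) ∧ ∀ a < n, π a < n ∧
    unitVec a - φ (unitVec a) • v = s a • unitVec (π a)

namespace IsSignedPerm

variable {n : ℕ} {φ : (ℕ → ℝ) →ₗ[ℝ] ℝ} {v : ℕ → ℝ}

theorem isPairVec (h : IsSignedPerm n φ v) {x : ℕ → ℝ} (hx : IsPairVec n x) :
    IsPairVec n (x - φ x • v) := by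
  obtain ⟨π, σ, hσ, hπ⟩ := h
  obtain ⟨a, b, ha, hb, hab, s, t, hs, ht, rfl⟩ := hx
  have h1 := (hπ a ha).2
  have h2 := (hπ b hb).2
  refine ⟨π a, π b, (hπ a ha).1, (hπ b hb).1, π.injective.ne hab, s * σ a, t * σ b,
    by grind, by grind, ?_⟩
  rw [mul_smul, mul_smul, ← h1, ← h2, map_add, map_smul, map_smul]
  simp only [smul_eq_mul]
  module

theorem isAxisVec (h : IsSignedPerm n φ v) {x : ℕ → ℝ} (hx : IsAxisVec n x) :
    IsAxisVec n (x - φ x • v) := by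
  obtain ⟨π, σ, hσ, hπ⟩ := h
  obtain ⟨a, ha, c, hc, rfl⟩ := hx
  have h1 := (hπ a ha).2
  have h2 : σ a ≠ 0 := by rcases hσ a with h | h <;> rw [h] <;> norm_num
  refine ⟨π a, (hπ a ha).1, c * σ a, mul_ne_zero hc h2, ?_⟩
  rw [mul_smul, ← h1, map_smul]
  simp only [smul_eq_mul]
  module

/-- Simple reflections of type `A`. -/
theorem swap (n j : ℕ) (hj : j + 1 < n) :
    IsSignedPerm n (coordFun j - coordFun (j + 1)) (unitVec j - unitVec (j + 1)) := by
  refine ⟨Equiv.swap j (j + 1), fun _ => 1, fun _ => .inl rfl, fun a ha => ⟨?_, ?_⟩⟩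
  · rw [Equiv.swap_apply_def]
    grind
  · ext x
    simp only [LinearMap.sub_apply, coordFun_apply, unitVec_apply, Pi.sub_apply,
      Pi.smul_apply, smul_eq_mul, Equiv.swap_apply_def]
    grind

/-- The last simple reflection of type `B` or `C`. -/
theorem sign (n j : ℕ) {c d : ℝ} (hcd : c * d = 2) :
    IsSignedPerm n (c • coordFun j) (d • unitVec j) := by
  refine ⟨1, fun a => if a = j then -1 else 1, fun a => by grind, fun a ha => ⟨ha, ?_⟩⟩
  ext x
  simp only [LinearMap.smul_apply, coordFun_apply, unitVec_apply, Pi.sub_apply,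
    Pi.smul_apply, smul_eq_mul, Equiv.Perm.one_apply]
  grind

/-- The last simple reflection of type `D`. -/
theorem swap_neg (n j : ℕ) (hj : j + 1 < n) :
    IsSignedPerm n (coordFun j + coordFun (j + 1)) (unitVec j + unitVec (j + 1)) := by
  refine ⟨Equiv.swap j (j + 1), fun a => if a = j ∨ a = j + 1 then -1 else 1,
    fun a => by grind, fun a ha => ⟨?_, ?_⟩⟩
  · rw [Equiv.swap_apply_def]
    grind
  · ext x
    simp only [LinearMap.add_apply, coordFun_apply, unitVec_apply, Pi.add_apply,
      Pi.sub_apply, Pi.smul_apply, smul_eq_mul, Equiv.swap_apply_def]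
    grind

end IsSignedPerm

end RootPeeling

namespace RootPeeling

open Matrix

variable {ι M N : Type*} [Finite ι] [AddCommGroup M] [Module ℝ M]
    [AddCommGroup N] [Module ℝ N] {Φ : RootPairing ι ℝ M N} {b : Φ.Base}
    {r : ℕ} {α : Fin (r + 1) → ι} {J : Set (Fin (r + 1))} {n : ℕ}
    {φ : Fin r → (ℕ → ℝ) →ₗ[ℝ] ℝ}

section upper

variable [Φ.IsRootSystem] [Φ.IsCrystallographic] [Φ.IsReduced]
  {L : M →ₗ[ℝ] (ℕ → ℝ)}

theorem IsExtendedSimpleSystem.ncard_parabolicPos_le_of_isPairVec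
    (hα : IsExtendedSimpleSystem b α)
    (hφ : ∀ j x, Φ.coroot' (α j.succ) x = φ j (L x))
    (hsp : ∀ j, IsSignedPerm n (φ j) (L (Φ.root (α j.succ))))
    (hv : ∀ j : Fin r, IsPairVec n (L (Φ.root (α j.succ)))) (hJ : J ≠ Set.univ) :
    ∃ s ≤ J.ncard, (0 < s → ∃ a < n, unitVec a ∈ LinearMap.range L) ∧
      2 * (parabolicPos Φ α J).ncard + 3 * s ≤ s ^ 2 + J.ncard ^ 2 + J.ncard := by
  classical
  set W := (Submodule.span ℝ ((fun j => Φ.root (α j)) '' J)).map L with hW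
  have hroot (i : ι) : IsPairVec n (L (Φ.root i)) := by
    refine hα.root_mem_of_reflection (S := {x | IsPairVec n (L x)}) hv ?_ ?_ i
    · intro x hx
      simpa using IsPairVec.neg hx
    · intro x hx j
      have := (hsp j).isPairVec hx
      rwa [← hφ, ← map_smul, ← map_sub] at this
  have hfin : FiniteDimensional ℝ W := by
    rw [hW, Submodule.map_span]
    exact FiniteDimensional.span_of_finite ℝ (Set.toFinite _)
  have hle : Module.finrank ℝ W ≤ J.ncard := finrank_map_span_le L J
  have h1 := hα.ncard_parabolicPos_le (hα.injective_of_coroot' hφ) pairVec (orderedPairs n)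
    (fun i => (hroot i).exists_mem_orderedPairs) hJ
  rw [← hW] at h1
  have h2 := two_mul_card_pairs_le n J.ncard W hle
  refine ⟨_, (card_axis_le n W).trans hle, fun hs => ?_, by omega⟩
  obtain ⟨a, ha⟩ := Finset.card_pos.mp hs
  rw [Finset.mem_filter, Finset.mem_range] at ha
  exact ⟨a, ha.1, LinearMap.map_le_range ha.2⟩

theorem IsExtendedSimpleSystem.ncard_parabolicPos_le_sq
    (hα : IsExtendedSimpleSystem b α)
    (hφ : ∀ j x, Φ.coroot' (α j.succ) x = φ j (L x))
    (hsp : ∀ j, IsSignedPerm n (φ j) (L (Φ.root (α j.succ))))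
    (hv : ∀ j : Fin r, IsPairVec n (L (Φ.root (α j.succ))) ∨
      IsAxisVec n (L (Φ.root (α j.succ)))) (hJ : J ≠ Set.univ) :
    (parabolicPos Φ α J).ncard ≤ J.ncard ^ 2 := by
  classical
  set W := (Submodule.span ℝ ((fun j => Φ.root (α j)) '' J)).map L with hW
  have hroot (i : ι) : IsPairVec n (L (Φ.root i)) ∨ IsAxisVec n (L (Φ.root i)) := by
    refine hα.root_mem_of_reflection (S := {x | IsPairVec n (L x) ∨ IsAxisVec n (L x)}) hv ?_ ?_ i
    · intro x hx
      simpa using Or.imp IsPairVec.neg IsAxisVec.neg hx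
    · intro x hx j
      have := Or.imp (hsp j).isPairVec (hsp j).isAxisVec hx
      rwa [← hφ, ← map_smul, ← map_sub] at this
  have hfin : FiniteDimensional ℝ W := by
    rw [hW, Submodule.map_span]
    exact FiniteDimensional.span_of_finite ℝ (Set.toFinite _)
  have hle : Module.finrank ℝ W ≤ J.ncard := finrank_map_span_le L J
  have h1 := hα.ncard_parabolicPos_le (hα.injective_of_coroot' hφ) (Sum.elim pairVec unitVec)
    ((orderedPairs n).disjSum (Finset.range n)) (fun i => by
      rcases hroot i with h | ⟨a, ha, c, hc, h⟩
      · obtain ⟨y, hy, c, hc, h⟩ := h.exists_mem_orderedPairs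
        exact ⟨.inl y, by simpa using hy, c, hc, h⟩
      · exact ⟨.inr a, by simpa using ha, c, hc, h⟩) hJ
  have h2 := two_mul_card_pairs_le n J.ncard W hle
  have h3 := (card_axis_le n W).trans hle
  have h4 : ((orderedPairs n).disjSum (Finset.range n)).filter
      (fun y => Sum.elim pairVec unitVec y ∈ W) =
      ((orderedPairs n).filter fun y => pairVec y ∈ W).disjSum
        ((Finset.range n).filter fun a => unitVec a ∈ W) := by
    ext (y | a) <;> simp
  rw [h4, Finset.card_disjSum] at h1
  obtain ⟨d, hd⟩ := Nat.exists_eq_add_of_le h3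
  rw [hd] at h2 ⊢
  have := Nat.le_mul_self d
  nlinarith

end upper

section lower

variable [Φ.IsCrystallographic] {L : M →ₗ[ℝ] (ℕ → ℝ)} {t : ℕ}

/-- The simple roots `e_j - e_{j+1}`, `j + 1 < n`, together with their coroots. -/
def HasDifferences (Φ : RootPairing ι ℝ M N) (α : Fin (r + 1) → ι) (L : M →ₗ[ℝ] (ℕ → ℝ))
    (φ : Fin r → (ℕ → ℝ) →ₗ[ℝ] ℝ) (n : ℕ) : Prop :=
  ∀ j : ℕ, j + 1 < n → ∃ hj : j < r,
    L (Φ.root (α (Fin.succ ⟨j, hj⟩))) = unitVec j - unitVec (j + 1) ∧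
    φ ⟨j, hj⟩ = coordFun j - coordFun (j + 1)

omit [Finite ι] in
theorem sub_mem_attained (hφ : ∀ j x, Φ.coroot' (α j.succ) x = φ j (L x))
    (hd : HasDifferences Φ α L φ n) (hJ : ∀ j : Fin r, t ≤ j → j.succ ∈ J) {a c : ℕ}
    (ha : t ≤ a) (hac : a < c) (hc : c < n) :
    unitVec a - unitVec c ∈ attained Φ α L J := by
  induction c, hac using Nat.le_induction with
  | base =>
    obtain ⟨hj, h1, -⟩ := hd a hc
    rw [← h1]
    exact simple_mem_attained (hJ _ ha)
  | succ c hac ih =>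
    obtain ⟨hj, h1, h2⟩ := hd c hc
    have hval : φ ⟨c, hj⟩ (unitVec a - unitVec c) = -1 := by
      simp [h2, unitVec_apply]
      grind
    have := reflection_mem_attained hφ (hJ ⟨c, hj⟩ (by simp only; omega)) (ih (by omega))
      (by rw [hval]; norm_num)
    rw [hval, h1] at this
    convert this using 1
    module

omit [Finite ι] in
theorem add_mem_attained (hφ : ∀ j x, Φ.coroot' (α j.succ) x = φ j (L x))
    (hd : HasDifferences Φ α L φ n) (hJ : ∀ j : Fin r, t ≤ j → j.succ ∈ J) {a c : ℕ}
    (ha : t ≤ a) (hac : a < c) (hc : c < n)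
    (hlast : unitVec a + unitVec (n - 1) ∈ attained Φ α L J) :
    unitVec a + unitVec c ∈ attained Φ α L J := by
  have hcn : c ≤ n - 1 := by omega
  clear hc
  induction hcn using Nat.decreasingInduction with
  | self => exact hlast
  | of_succ c hc ih =>
    obtain ⟨hj, h1, h2⟩ := hd c (by omega)
    have hval : φ ⟨c, hj⟩ (unitVec a + unitVec (c + 1)) = -1 := by
      simp [h2, unitVec_apply]
      grind
    have := reflection_mem_attained hφ (hJ ⟨c, hj⟩ (by simp only; omega)) (ih (by omega))
      (by rw [hval]; norm_num)
    rw [hval, h1] at this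
    convert this using 1
    module

omit [Finite ι] in
theorem axis_mem_attained (hφ : ∀ j x, Φ.coroot' (α j.succ) x = φ j (L x))
    (hd : HasDifferences Φ α L φ n) (hJ : ∀ j : Fin r, t ≤ j → j.succ ∈ J) {a : ℕ}
    (ha : t ≤ a) (han : a < n) {d : ℝ} (hd0 : 0 ≤ d)
    (hlast : d • unitVec (n - 1) ∈ attained Φ α L J) :
    d • unitVec a ∈ attained Φ α L J := by
  have hcn : a ≤ n - 1 := by omega
  clear han
  induction hcn using Nat.decreasingInduction with
  | self => exact hlast
  | of_succ c hc ih =>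
    obtain ⟨hj, h1, h2⟩ := hd c (by omega)
    have hval : φ ⟨c, hj⟩ (d • unitVec (c + 1)) = -d := by
      simp [h2, unitVec_apply]
    have := reflection_mem_attained hφ (hJ ⟨c, hj⟩ (by simp only; omega)) (ih (by omega))
      (by rw [hval]; linarith)
    rw [hval, h1] at this
    convert this using 1
    module

theorem pairVec_injOn : Set.InjOn pairVec {y | y.1 < y.2.1} := by
  rintro ⟨a, c, s⟩ hy ⟨a', c', s'⟩ hy' h
  simp only [Set.mem_ofPred_eq] at hy hy'
  have h1 := congrFun h a
  have h2 := congrFun h c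
  have h3 := congrFun h a'
  have h4 := congrFun h c'
  simp only [pairVec_apply] at h1 h2 h3 h4
  cases s <;> cases s' <;> grind

/-- The pair `(a, b)` encodes `e_a + e_b` if `a < b`, and `e_b - e_a` otherwise. -/
def signedPair (p : ℕ × ℕ) : ℕ × ℕ × Bool :=
  if p.1 < p.2 then (p.1, p.2, true) else (p.2, p.1, false)

theorem signedPair_injective : Function.Injective signedPair := by
  rintro ⟨a, c⟩ ⟨a', c'⟩ h
  simp only [signedPair] at h
  grind

/-- The vectors `e_a ± e_b` with `t ≤ a < b < n`. -/
def tailPairs (n t : ℕ) : Finset (ℕ × ℕ × Bool) :=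
  (Finset.Ico t n).offDiag.image signedPair

theorem card_tailPairs (n t : ℕ) :
    (tailPairs n t).card = (n - t) * (n - t) - (n - t) := by
  rw [tailPairs, Finset.card_image_of_injective _ signedPair_injective, Finset.offDiag_card,
    Nat.card_Ico]

theorem mem_tailPairs {n t : ℕ} {y : ℕ × ℕ × Bool} (hy : y ∈ tailPairs n t) :
    t ≤ y.1 ∧ y.1 < y.2.1 ∧ y.2.1 < n := by
  simp only [tailPairs, Finset.mem_image, Finset.mem_offDiag, Finset.mem_Ico] at hy
  obtain ⟨⟨a, c⟩, h, rfl⟩ := hy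
  simp only [signedPair] at h ⊢
  grind

omit [Φ.IsCrystallographic] in
theorem le_ncard_of_pairs (h1 : ∀ a c, t ≤ a → a < c → c < n →
      unitVec a - unitVec c ∈ attained Φ α L J)
    (h2 : ∀ a c, t ≤ a → a < c → c < n → unitVec a + unitVec c ∈ attained Φ α L J) :
    (n - t) * (n - t) - (n - t) ≤ (parabolicPos Φ α J).ncard := by
  rw [← card_tailPairs]
  refine card_le_ncard_parabolicPos (L := L) (tailPairs n t) pairVec
    (pairVec_injOn.mono fun y hy => (mem_tailPairs hy).2.1) fun y hy => ?_
  obtain ⟨h3, h4, h5⟩ := mem_tailPairs hy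
  obtain ⟨a, c, s⟩ := y
  cases s
  · simpa [pairVec, sub_eq_add_neg] using h1 a c h3 h4 h5
  · simpa [pairVec] using h2 a c h3 h4 h5

omit [Φ.IsCrystallographic] in
theorem le_ncard_of_pairs_of_axis {d : ℝ} (hd : d ≠ 0) (h1 : ∀ a c, t ≤ a → a < c → c < n →
      unitVec a - unitVec c ∈ attained Φ α L J)
    (h2 : ∀ a c, t ≤ a → a < c → c < n → unitVec a + unitVec c ∈ attained Φ α L J)
    (h3 : ∀ a, t ≤ a → a < n → d • unitVec a ∈ attained Φ α L J) :
    (n - t) * (n - t) ≤ (parabolicPos Φ α J).ncard := by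
  have hcard : (n - t) * (n - t) = ((tailPairs n t).disjSum (Finset.Ico t n)).card := by
    rw [Finset.card_disjSum, card_tailPairs, Nat.card_Ico, Nat.sub_add_cancel (Nat.le_mul_self _)]
  rw [hcard]
  refine card_le_ncard_parabolicPos (L := L) _ (Sum.elim pairVec fun a => d • unitVec a) ?_ ?_
  · rintro (y | a) hy (y' | a') hy' h
    · simp at hy hy'
      exact congrArg _ (pairVec_injOn (mem_tailPairs hy).2.1 (mem_tailPairs hy').2.1 h)
    · simp at hy
      obtain ⟨-, h4, -⟩ := mem_tailPairs hy
      have h5 := congrFun h y.1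
      have h6 := congrFun h y.2.1
      simp only [Sum.elim_inl, Sum.elim_inr, pairVec_apply, Pi.smul_apply, unitVec_apply,
        smul_eq_mul] at h5 h6
      grind
    · simp at hy'
      obtain ⟨-, h4, -⟩ := mem_tailPairs hy'
      have h5 := congrFun h y'.1
      have h6 := congrFun h y'.2.1
      simp only [Sum.elim_inl, Sum.elim_inr, pairVec_apply, Pi.smul_apply, unitVec_apply,
        smul_eq_mul] at h5 h6
      grind
    · have h5 := congrFun h a
      simp only [Sum.elim_inr, Pi.smul_apply, unitVec_apply] at h5
      simp [hd] at h5
      rw [h5]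
  · rintro (y | a) hy
    · simp at hy
      obtain ⟨h4, h5, h6⟩ := mem_tailPairs hy
      obtain ⟨a, c, s⟩ := y
      cases s
      · simpa [pairVec, sub_eq_add_neg] using h1 a c h4 h5 h6
      · simpa [pairVec] using h2 a c h4 h5 h6
    · simp at hy
      exact h3 a hy.1 hy.2

omit [Φ.IsCrystallographic] in
theorem le_ncard_of_differences (h1 : ∀ a c, t ≤ a → a < c → c < n →
      unitVec a - unitVec c ∈ attained Φ α L J) :
    (n - t) * (n - t - 1) ≤ 2 * (parabolicPos Φ α J).ncard := by
  have hcard : (n - t) * (n - t - 1) =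
      2 * ((Finset.Ico t n).sigma fun c => Finset.Ico t c).card := by
    rw [Finset.card_sigma, ← Finset.sum_range_id_mul_two, mul_comm, Finset.sum_Ico_eq_sum_range]
    simp
  rw [hcard]
  refine Nat.mul_le_mul_left _ (card_le_ncard_parabolicPos (L := L) _
    (fun y : (_ : ℕ) × ℕ => unitVec y.2 - unitVec y.1) ?_ ?_)
  · rintro ⟨c, a⟩ hy ⟨c', a'⟩ hy' h
    simp only [Finset.coe_sigma, Set.mem_sigma_iff, Finset.coe_Ico, Set.mem_Ico] at hy hy'
    have h1 := congrFun h a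
    have h2 := congrFun h c
    have h3 := congrFun h a'
    have h4 := congrFun h c'
    simp only [Pi.sub_apply, unitVec_apply] at h1 h2 h3 h4
    grind
  · rintro ⟨c, a⟩ hy
    simp only [Finset.mem_sigma, Finset.mem_Ico] at hy
    exact h1 a c hy.2.1 hy.2.2 hy.1.2

end lower

end RootPeeling

namespace RootPeeling

open Matrix

namespace DynkinType

variable {r : ℕ}

/-- The largest number of positive roots of a subsystem `Σ_J` with `|J| = k`. -/
def maxCount (T : DynkinType r) (k : ℕ) : ℕ :=
  ∑ i ∈ Finset.univ.filter fun i : Fin r => r ≤ (i : ℕ) + k, T.optimalNumbers i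

theorem maxCount_zero (T : DynkinType r) : T.maxCount 0 = 0 := by
  refine Finset.sum_eq_zero fun i hi => ?_
  rw [Finset.mem_filter] at hi
  omega

theorem maxCount_succ (T : DynkinType r) {k : ℕ} (hk : k < r) :
    T.maxCount (k + 1) = T.maxCount k + T.optimalNumbers ⟨r - (k + 1), by omega⟩ := by
  have : (Finset.univ.filter fun i : Fin r => r ≤ (i : ℕ) + (k + 1)) =
      insert ⟨r - (k + 1), by omega⟩ (Finset.univ.filter fun i : Fin r => r ≤ (i : ℕ) + k) := by
    ext i
    simp [Fin.ext_iff]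
    omega
  rw [maxCount, this, Finset.sum_insert (by simp; omega), add_comm]
  rfl

theorem two_mul_maxCount_A {hr : 1 ≤ r} {k : ℕ} (hk : k ≤ r) :
    2 * (A r hr).maxCount k = k * (k + 1) := by
  induction k with
  | zero => simp [maxCount_zero]
  | succ k ih =>
    rw [maxCount_succ _ hk, mul_add, ih (by omega)]
    simp only [optimalNumbers]
    obtain ⟨d, rfl⟩ := Nat.exists_eq_add_of_le hk
    rw [show k + 1 + d - (k + 1 + d - (k + 1)) = k + 1 by omega]
    ring

theorem maxCount_B {hr : 2 ≤ r} {k : ℕ} (hk : k ≤ r) : (B r hr).maxCount k = k ^ 2 := by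
  induction k with
  | zero => simp [maxCount_zero]
  | succ k ih =>
    rw [maxCount_succ _ hk, ih (by omega)]
    simp only [optimalNumbers]
    rw [show 2 * r - 1 - 2 * (r - (k + 1)) = 2 * k + 1 by omega]
    ring

theorem maxCount_C {hr : 3 ≤ r} {k : ℕ} (hk : k ≤ r) : (C r hr).maxCount k = k ^ 2 := by
  induction k with
  | zero => simp [maxCount_zero]
  | succ k ih =>
    rw [maxCount_succ _ hk, ih (by omega)]
    simp only [optimalNumbers]
    rw [show 2 * r - 1 - 2 * (r - (k + 1)) = 2 * k + 1 by omega]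
    ring

theorem maxCount_D_one {hr : 4 ≤ r} : (D r hr).maxCount 1 = 1 := by
  rw [maxCount_succ _ (by omega), maxCount_zero]
  simp only [optimalNumbers]
  grind

theorem maxCount_D_two {hr : 4 ≤ r} : (D r hr).maxCount 2 = 3 := by
  rw [maxCount_succ _ (by omega), maxCount_D_one]
  simp only [optimalNumbers]
  grind

theorem maxCount_D {hr : 4 ≤ r} {k : ℕ} (hk3 : 3 ≤ k) (hk : k ≤ r) :
    (D r hr).maxCount k = k * k - k := by
  induction k, hk3 using Nat.le_induction with
  | base =>
    rw [maxCount_succ _ (by omega), maxCount_D_two]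
    simp only [optimalNumbers]
    grind
  | succ k hk3 ih =>
    rw [maxCount_succ _ hk, ih (by omega)]
    simp only [optimalNumbers]
    rw [if_pos (by omega), show 2 * r - 2 - 2 * (r - (k + 1)) = 2 * k by omega]
    have := Nat.le_mul_self k
    have h2 : (k + 1) * (k + 1) = k * k + 2 * k + 1 := by ring
    omega

end DynkinType

variable {ι M N : Type*} [AddCommGroup M] [Module ℝ M]
    [AddCommGroup N] [Module ℝ N] {Φ : RootPairing ι ℝ M N} {b : Φ.Base}
    {r : ℕ} {α : Fin (r + 1) → ι} {J : Set (Fin (r + 1))}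

/-- The number of positive roots of `Σ_J` is at most `maxCount |J|`, with equality for the sets
that remain when the nodes are removed in the order `optimalOrder`. -/
structure HasMaxCounts (Φ : RootPairing ι ℝ M N) (α : Fin (r + 1) → ι) (T : DynkinType r) :
    Prop where
  le : ∀ J : Set (Fin (r + 1)), J ≠ Set.univ → (parabolicPos Φ α J).ncard ≤ T.maxCount J.ncard
  exists_perm : ∃ p : Equiv.Perm (Fin (r + 1)), (∀ k, p k = T.optimalOrder k) ∧
    ∀ i : Fin (r + 1), T.maxCount (r - i) ≤ (parabolicPos Φ α (remaining p i)).ncard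

theorem ncard_le_of_ne_univ (hJ : J ≠ Set.univ) : J.ncard ≤ r := by
  have := Set.ncard_lt_card hJ
  simp at this
  omega

variable [Finite ι] [Φ.IsRootSystem] [Φ.IsCrystallographic] [Φ.IsReduced]

theorem mem_remaining_one {i : Fin (r + 1)} {j : Fin r} (h : (i : ℕ) ≤ j) :
    j.succ ∈ remaining (1 : Equiv.Perm (Fin (r + 1))) i := by
  refine ⟨j.succ, ?_, rfl⟩
  simp only [Set.mem_ofPred_eq, Fin.lt_def, Fin.val_succ]
  omega

theorem hasMaxCounts_A (hα : IsExtendedSimpleSystem b α) (hr : 1 ≤ r)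
    (hT : ∀ i j : Fin r, Φ.pairingIn ℤ (α i.succ) (α j.succ) = CartanMatrix.A r i j) :
    HasMaxCounts Φ α (.A r hr) := by
  let v : Fin r → ℕ → ℝ := fun j => unitVec j - unitVec (j + 1)
  let φ : Fin r → (ℕ → ℝ) →ₗ[ℝ] ℝ := fun j => coordFun j - coordFun (j + 1)
  let L := hα.basis.constr ℝ v
  have hL (j : Fin r) : L (Φ.root (α j.succ)) = v j := by
    rw [← hα.basis_apply, Module.Basis.constr_basis]
  have hφ : ∀ j x, Φ.coroot' (α j.succ) x = φ j (L x) := by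
    refine hα.coroot'_eq_of_basis ?_
    rintro ⟨i, hi⟩ ⟨j, hj⟩
    rw [hT, hL, A_mk]
    simp only [φ, v, LinearMap.sub_apply, coordFun_apply, Pi.sub_apply, unitVec_apply]
    push_cast
    grind
  refine ⟨fun J hJ => ?_, 1, fun k => rfl, fun i => ?_⟩
  · obtain ⟨s, hs, hs0, hle⟩ := hα.ncard_parabolicPos_le_of_isPairVec (n := r + 1) hφ
      (fun j => by rw [hL]; exact IsSignedPerm.swap _ _ (by omega))
      (fun j => by
        rw [hL]
        exact ⟨j, j + 1, by omega, by omega, by omega, 1, -1, .inl rfl, .inr rfl,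
          by simp only [v]; module⟩) hJ
    have hsum : ((∑ x ∈ Finset.range (r + 1), coordFun x) ∘ₗ L : M →ₗ[ℝ] ℝ) = 0 := by
      refine hα.basis.ext fun j => ?_
      have h1 : (j : ℕ) < r + 1 := by omega
      rw [hα.basis_apply, LinearMap.comp_apply, hL]
      simp only [v, LinearMap.sum_apply, coordFun_apply, Pi.sub_apply, unitVec_apply,
        Finset.sum_sub_distrib, Finset.sum_ite_eq', Finset.mem_range, LinearMap.zero_apply]
      simp [h1]
    have hs' : s = 0 := by
      by_contra hne
      obtain ⟨a, ha, x, hx⟩ := hs0 (Nat.pos_of_ne_zero hne)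
      have h1 := LinearMap.congr_fun hsum x
      rw [LinearMap.comp_apply, hx] at h1
      simp [unitVec_apply] at h1
      omega
    subst hs'
    have := DynkinType.two_mul_maxCount_A (hr := hr) (ncard_le_of_ne_univ hJ)
    nlinarith
  · have hd : HasDifferences Φ α L φ (r + 1) := fun j hj => ⟨by omega, hL _, rfl⟩
    have h1 := le_ncard_of_differences (J := remaining (1 : Equiv.Perm (Fin (r + 1))) i)
      (t := i) (n := r + 1) fun a c ha hac hc =>
        sub_mem_attained hφ hd (fun j hj => mem_remaining_one hj) ha hac hc
    have := DynkinType.two_mul_maxCount_A (hr := hr) (Nat.sub_le r i)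
    rw [show r + 1 - (i : ℕ) = (r - i) + 1 by omega] at h1
    simp only [Nat.add_sub_cancel] at h1
    nlinarith

/-- Types `B` and `C`: the last simple root is `d e_r`. -/
theorem counts_of_double_bond (hα : IsExtendedSimpleSystem b α) (hr : 2 ≤ r) {c d : ℝ}
    (hcd : c * d = 2) (hd0 : 0 < d)
    (hT : ∀ i j : Fin r, (Φ.pairingIn ℤ (α i.succ) (α j.succ) : ℝ) =
      if i = j then 2 else if (i : ℕ) + 1 = j then if (j : ℕ) + 1 < r then -1 else -c
      else if (j : ℕ) + 1 = i then if (i : ℕ) + 1 < r then -1 else -d else 0) :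
    (∀ J : Set (Fin (r + 1)), J ≠ Set.univ → (parabolicPos Φ α J).ncard ≤ J.ncard ^ 2) ∧
    ∀ i : Fin (r + 1), (r - i) ^ 2 ≤
      (parabolicPos Φ α (remaining (1 : Equiv.Perm (Fin (r + 1))) i)).ncard := by
  let v : Fin r → ℕ → ℝ := fun j =>
    if (j : ℕ) + 1 < r then unitVec j - unitVec (j + 1) else d • unitVec j
  let φ : Fin r → (ℕ → ℝ) →ₗ[ℝ] ℝ := fun j =>
    if (j : ℕ) + 1 < r then coordFun j - coordFun (j + 1) else c • coordFun j
  let L := hα.basis.constr ℝ v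
  have hL (j : Fin r) : L (Φ.root (α j.succ)) = v j := by
    rw [← hα.basis_apply, Module.Basis.constr_basis]
  have hφ : ∀ j x, Φ.coroot' (α j.succ) x = φ j (L x) := by
    refine hα.coroot'_eq_of_basis ?_
    rintro ⟨i, hi⟩ ⟨j, hj⟩
    have hv (x : ℕ) : v ⟨i, hi⟩ x = if i + 1 < r then
        (if x = i then 1 else 0) - (if x = i + 1 then 1 else 0) else
        d * if x = i then 1 else 0 := by
      simp only [v]
      split_ifs <;> simp_all [unitVec_apply]
    have hφ' (x : ℕ → ℝ) : φ ⟨j, hj⟩ x = if j + 1 < r then x j - x (j + 1) else c * x j := by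
      simp only [φ]
      split_ifs <;> simp
    rw [hT, hL, hφ', hv, hv]
    simp only [Fin.mk.injEq]
    grind
  have hsp (j : Fin r) : IsSignedPerm r (φ j) (L (Φ.root (α j.succ))) := by
    rw [hL]
    simp only [φ, v]
    split_ifs with h
    · exact IsSignedPerm.swap _ _ h
    · exact IsSignedPerm.sign _ _ hcd
  have hpa (j : Fin r) : IsPairVec r (L (Φ.root (α j.succ))) ∨
      IsAxisVec r (L (Φ.root (α j.succ))) := by
    rw [hL]
    simp only [v]
    split_ifs with h
    · exact .inl ⟨j, j + 1, by omega, by omega, by omega, 1, -1, .inl rfl, .inr rfl, by module⟩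
    · exact .inr ⟨j, j.2, d, hd0.ne', rfl⟩
  refine ⟨fun J hJ => hα.ncard_parabolicPos_le_sq hφ hsp hpa hJ, fun i => ?_⟩
  by_cases hir : (i : ℕ) = r
  · simp [hir]
  have hd : HasDifferences Φ α L φ r := fun j hj =>
    ⟨by omega, by rw [hL]; exact if_pos hj, if_pos hj⟩
  have hJ : ∀ j : Fin r, (i : ℕ) ≤ j →
      j.succ ∈ remaining (1 : Equiv.Perm (Fin (r + 1))) i := fun j hj => mem_remaining_one hj
  have hlast : d • unitVec (r - 1) ∈
      attained Φ α L (remaining (1 : Equiv.Perm (Fin (r + 1))) i) := by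
    have := simple_mem_attained (Φ := Φ) (α := α) (L := L)
      (hJ ⟨r - 1, by omega⟩ (by simp only; omega))
    rw [hL] at this
    simp only [v] at this
    rwa [if_neg (by omega)] at this
  have hsub : ∀ a c, (i : ℕ) ≤ a → a < c → c < r → unitVec a - unitVec c ∈
      attained Φ α L (remaining (1 : Equiv.Perm (Fin (r + 1))) i) := fun a c ha hac hc =>
    sub_mem_attained hφ hd hJ ha hac hc
  rw [sq]
  refine le_ncard_of_pairs_of_axis hd0.ne' hsub (fun a e ha hae he => ?_)
    (fun a ha har => axis_mem_attained hφ hd hJ ha har hd0.le hlast)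
  refine add_mem_attained hφ hd hJ ha hae he ?_
  have hc0 : 0 < c := by
    by_contra! h
    nlinarith
  have hval : φ ⟨r - 1, by omega⟩ (unitVec a - unitVec (r - 1)) = -c := by
    simp only [φ]
    rw [if_neg (by omega)]
    simp [unitVec_apply]
    grind
  have := reflection_mem_attained hφ (hJ ⟨r - 1, by omega⟩ (by simp only; omega))
    (hsub a (r - 1) ha (by omega) (by omega)) (by rw [hval]; linarith)
  rw [hval, hL] at this
  simp only [v] at this
  rw [if_neg (by omega), smul_smul, neg_mul, hcd] at this
  convert this using 1
  module

theorem hasMaxCounts_B (hα : IsExtendedSimpleSystem b α) (hr : 2 ≤ r)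
    (hT : ∀ i j : Fin r, Φ.pairingIn ℤ (α i.succ) (α j.succ) = CartanMatrix.B r i j) :
    HasMaxCounts Φ α (.B r hr) := by
  obtain ⟨h1, h2⟩ := counts_of_double_bond hα hr (c := 2) (d := 1) (by norm_num) one_pos
    (by
      rintro ⟨i, hi⟩ ⟨j, hj⟩
      rw [hT, B_mk]
      push_cast
      simp only [Fin.mk.injEq]
      grind)
  refine ⟨fun J hJ => ?_, 1, fun k => rfl, fun i => ?_⟩
  · rw [DynkinType.maxCount_B (ncard_le_of_ne_univ hJ)]
    exact h1 J hJ
  · rw [DynkinType.maxCount_B (Nat.sub_le _ _)]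
    exact h2 i

theorem hasMaxCounts_C (hα : IsExtendedSimpleSystem b α) (hr : 3 ≤ r)
    (hT : ∀ i j : Fin r, Φ.pairingIn ℤ (α i.succ) (α j.succ) = CartanMatrix.C r i j) :
    HasMaxCounts Φ α (.C r hr) := by
  obtain ⟨h1, h2⟩ := counts_of_double_bond hα (by omega) (c := 1) (d := 2) (by norm_num) two_pos
    (by
      rintro ⟨i, hi⟩ ⟨j, hj⟩
      rw [hT, C_mk]
      push_cast
      simp only [Fin.mk.injEq]
      grind)
  refine ⟨fun J hJ => ?_, 1, fun k => rfl, fun i => ?_⟩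
  · rw [DynkinType.maxCount_C (ncard_le_of_ne_univ hJ)]
    exact h1 J hJ
  · rw [DynkinType.maxCount_C (Nat.sub_le _ _)]
    exact h2 i

end RootPeeling

namespace RootPeeling

open Matrix

variable {ι M N : Type*} [AddCommGroup M] [Module ℝ M]
    [AddCommGroup N] [Module ℝ N] {Φ : RootPairing ι ℝ M N} {b : Φ.Base}
    {r : ℕ} {α : Fin (r + 1) → ι}
    [Finite ι] [Φ.IsRootSystem] [Φ.IsCrystallographic] [Φ.IsReduced]

theorem hasMaxCounts_D (hα : IsExtendedSimpleSystem b α) (hr : 4 ≤ r)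
    (hT : ∀ i j : Fin r, Φ.pairingIn ℤ (α i.succ) (α j.succ) = CartanMatrix.D r i j) :
    HasMaxCounts Φ α (.D r hr) := by
  let v : Fin r → ℕ → ℝ := fun j =>
    if (j : ℕ) + 1 < r then unitVec j - unitVec (j + 1) else unitVec (r - 2) + unitVec (r - 2 + 1)
  let φ : Fin r → (ℕ → ℝ) →ₗ[ℝ] ℝ := fun j =>
    if (j : ℕ) + 1 < r then coordFun j - coordFun (j + 1)
    else coordFun (r - 2) + coordFun (r - 2 + 1)
  let L := hα.basis.constr ℝ v
  have hL (j : Fin r) : L (Φ.root (α j.succ)) = v j := by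
    rw [← hα.basis_apply, Module.Basis.constr_basis]
  have hφ : ∀ j x, Φ.coroot' (α j.succ) x = φ j (L x) := by
    refine hα.coroot'_eq_of_basis ?_
    rintro ⟨i, hi⟩ ⟨j, hj⟩
    have hv (x : ℕ) : v ⟨i, hi⟩ x = if i + 1 < r then
        (if x = i then 1 else 0) - (if x = i + 1 then 1 else 0) else
        (if x = r - 2 then 1 else 0) + (if x = r - 2 + 1 then 1 else 0) := by
      simp only [v]
      split_ifs <;> simp_all [unitVec_apply]
    have hφ' (x : ℕ → ℝ) : φ ⟨j, hj⟩ x =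
        if j + 1 < r then x j - x (j + 1) else x (r - 2) + x (r - 2 + 1) := by
      simp only [φ]
      split_ifs <;> simp
    rw [hT, hL, hφ', hv, hv, hv, hv, D_mk]
    push_cast
    by_cases hir : i + 1 < r <;> by_cases hjr : j + 1 < r <;> simp only [hir, hjr, if_true, if_false]
    · grind (splits := 40)
    · grind (splits := 40)
    · grind (splits := 40)
    · grind (splits := 40)
  have hsp (j : Fin r) : IsSignedPerm r (φ j) (L (Φ.root (α j.succ))) := by
    rw [hL]
    simp only [φ, v]
    split_ifs with h
    · exact IsSignedPerm.swap _ _ h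
    · exact IsSignedPerm.swap_neg _ _ (by omega)
  have hpa (j : Fin r) : IsPairVec r (L (Φ.root (α j.succ))) := by
    rw [hL]
    simp only [v]
    split_ifs with h
    · exact ⟨j, j + 1, by omega, by omega, by omega, 1, -1, .inl rfl, .inr rfl, by module⟩
    · exact ⟨r - 2, r - 2 + 1, by omega, by omega, by omega, 1, 1, .inl rfl, .inl rfl, by module⟩
  refine ⟨fun J hJ => ?_, Equiv.swap ⟨r - 2, by omega⟩ ⟨r - 1, by omega⟩, fun k => rfl,
    fun i => ?_⟩
  · obtain ⟨s, hs, -, hle⟩ := hα.ncard_parabolicPos_le_of_isPairVec hφ hsp hpa hJ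
    have hJr := ncard_le_of_ne_univ hJ
    generalize J.ncard = k at *
    rcases (by omega : k = 0 ∨ k = 1 ∨ k = 2 ∨ 3 ≤ k) with rfl | rfl | rfl | hk
    · rw [DynkinType.maxCount_zero]
      obtain rfl : s = 0 := by omega
      omega
    · rw [DynkinType.maxCount_D_one]
      interval_cases s <;> omega
    · rw [DynkinType.maxCount_D_two]
      interval_cases s <;> omega
    · rw [DynkinType.maxCount_D hk hJr]
      have h1 : s ^ 2 ≤ k ^ 2 - 3 * k + 3 * s := by
        obtain ⟨d, rfl⟩ := Nat.exists_eq_add_of_le hs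
        have h2 : 3 * (s + d) ≤ (s + d) ^ 2 := by nlinarith
        zify [h2]
        rcases Nat.eq_zero_or_pos d with rfl | hd
        · push_cast; nlinarith
        · rcases Nat.eq_zero_or_pos s with rfl | hs0
          · have : (3 : ℤ) ≤ d := by omega
            push_cast; nlinarith
          · have h3 : (0 : ℤ) ≤ (d - 1) * (s - 1) := by
              apply mul_nonneg <;> omega
            have h4 : (3 : ℤ) ≤ s + d := by exact_mod_cast hk
            nlinarith
      have h2 : k ≤ k * k := Nat.le_mul_self k
      have h3 : 3 * k ≤ k ^ 2 := by nlinarith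
      simp only [sq] at h1 h3 hle
      omega
  · have hmem (j : Fin (r + 1)) (hj : (i : ℕ) <
        (Equiv.swap (⟨r - 2, by omega⟩ : Fin (r + 1)) ⟨r - 1, by omega⟩ j : Fin (r + 1))) :
        j ∈ remaining (Equiv.swap ⟨r - 2, by omega⟩ ⟨r - 1, by omega⟩) i :=
      ⟨_, hj, Equiv.swap_apply_self _ _ _⟩
    set J := remaining (Equiv.swap (⟨r - 2, by omega⟩ : Fin (r + 1)) ⟨r - 1, by omega⟩) i with hJdef
    have hlastJ (hi : (i : ℕ) < r) : unitVec (r - 2) + unitVec (r - 2 + 1) ∈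
        attained Φ α L J := by
      have := simple_mem_attained (Φ := Φ) (α := α) (L := L) (J := J)
        (j := Fin.succ ⟨r - 1, by omega⟩) (hmem _ (by
          rw [Equiv.swap_apply_of_ne_of_ne]
          · simp only [Fin.val_succ]; omega
          · simp only [ne_eq, Fin.ext_iff, Fin.val_succ]; omega
          · simp only [ne_eq, Fin.ext_iff, Fin.val_succ]; omega))
      rw [hL] at this
      simp only [v] at this
      rwa [if_neg (by omega)] at this
    rcases (by omega : (i : ℕ) = r ∨ (i : ℕ) = r - 1 ∨ (i : ℕ) = r - 2 ∨ (i : ℕ) + 3 ≤ r) with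
      hi | hi | hi | hi
    · rw [hi, Nat.sub_self, DynkinType.maxCount_zero]
      exact Nat.zero_le _
    · rw [show r - (i : ℕ) = 1 by omega, DynkinType.maxCount_D_one]
      exact card_le_ncard_parabolicPos (L := L) {(r - 2, r - 2 + 1, true)} pairVec (by simp)
        (by simpa [pairVec] using hlastJ (by omega))
    · rw [show r - (i : ℕ) = 2 by omega, DynkinType.maxCount_D_two]
      have h1 := hlastJ (by omega)
      have h2 : unitVec (r - 3) - unitVec (r - 3 + 1) ∈ attained Φ α L J := by
        have := simple_mem_attained (Φ := Φ) (α := α) (L := L) (J := J)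
          (j := Fin.succ ⟨r - 3, by omega⟩) (hmem _ (by
            rw [show Fin.succ ⟨r - 3, by omega⟩ = (⟨r - 2, by omega⟩ : Fin (r + 1)) from
              Fin.ext (by simp only [Fin.val_succ]; omega), Equiv.swap_apply_left]
            simp only
            omega))
        rw [hL] at this
        simp only [v] at this
        rwa [if_pos (by omega)] at this
      have h3 : unitVec (r - 3) + unitVec (r - 2 + 1) ∈ attained Φ α L J := by
        have hval : φ ⟨r - 1, by omega⟩ (unitVec (r - 3) - unitVec (r - 3 + 1)) = -1 := by
          simp only [φ]
          rw [if_neg (by omega)]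
          simp only [LinearMap.add_apply, coordFun_apply, Pi.sub_apply, unitVec_apply]
          grind
        have := reflection_mem_attained (j := ⟨r - 1, by omega⟩) hφ (hmem _ (by
          rw [Equiv.swap_apply_of_ne_of_ne]
          · simp only [Fin.val_succ]; omega
          · simp only [ne_eq, Fin.ext_iff, Fin.val_succ]; omega
          · simp only [ne_eq, Fin.ext_iff, Fin.val_succ]; omega)) h2 (by rw [hval]; norm_num)
        rw [hval, hL] at this
        simp only [v] at this
        rw [if_neg (by omega), show r - 3 + 1 = r - 2 by omega] at this
        convert this using 1
        module
      have hcard : ({(r - 2, r - 2 + 1, true), (r - 3, r - 3 + 1, false),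
          (r - 3, r - 2 + 1, true)} : Finset (ℕ × ℕ × Bool)).card = 3 := by
        rw [Finset.card_insert_of_notMem (by simp; omega), Finset.card_pair (by simp)]
      rw [← hcard]
      refine card_le_ncard_parabolicPos (L := L) _ pairVec (pairVec_injOn.mono ?_) ?_
      · intro y hy
        simp at hy
        simp only [Set.mem_ofPred_eq]
        rcases hy with rfl | rfl | rfl <;> simp only <;> omega
      · intro y hy
        simp at hy
        rcases hy with rfl | rfl | rfl
        · simpa [pairVec] using h1
        · simpa [pairVec, sub_eq_add_neg] using h2
        · simpa [pairVec] using h3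
    · rw [DynkinType.maxCount_D (by omega) (Nat.sub_le _ _)]
      have hd : HasDifferences Φ α L φ r := fun j hj =>
        ⟨by omega, by rw [hL]; exact if_pos hj, if_pos hj⟩
      have hJ : ∀ j : Fin r, (i : ℕ) ≤ j → j.succ ∈ J := fun j hj => hmem _ (by
        rw [Equiv.swap_apply_def]
        split_ifs <;> simp_all [Fin.ext_iff] <;> omega)
      have hsub : ∀ a c, (i : ℕ) ≤ a → a < c → c < r → unitVec a - unitVec c ∈
          attained Φ α L J := fun a c ha hac hc => sub_mem_attained hφ hd hJ ha hac hc
      refine le_ncard_of_pairs hsub fun a e ha hae he => add_mem_attained hφ hd hJ ha hae he ?_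
      have h1 := hlastJ (by omega)
      rw [show r - 2 + 1 = r - 1 by omega] at h1
      by_cases har : a = r - 2
      · rw [har]
        exact h1
      · have hval : φ ⟨r - 1, by omega⟩ (unitVec a - unitVec (r - 2)) = -1 := by
          simp only [φ]
          rw [if_neg (by omega)]
          simp only [LinearMap.add_apply, coordFun_apply, Pi.sub_apply, unitVec_apply]
          grind
        have := reflection_mem_attained hφ (hJ ⟨r - 1, by omega⟩ (by simp only; omega))
          (hsub a (r - 2) ha (by omega) (by omega)) (by rw [hval]; norm_num)
        rw [hval, hL] at this
        simp only [v] at this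
        rw [if_neg (by omega), show r - 2 + 1 = r - 1 by omega] at this
        convert this using 1
        module

end RootPeeling

namespace RootPeeling

open Matrix

/-- The pairing with a simple coroot of a vector given by its coefficients on simple roots. -/
def cartanPairing {r : ℕ} (C : Matrix (Fin r) (Fin r) ℤ) (x : Fin r → ℤ) (j : Fin r) : ℤ :=
  ∑ i, x i * C i j

/-- `l` lists the coefficient vectors of the positive roots, and `m` is the highest one. -/
structure IsPosRootList {r : ℕ} (C : Matrix (Fin r) (Fin r) ℤ) (l : List (Fin r → ℤ))
    (m : Fin r → ℤ) : Prop where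
  single_mem : ∀ j, Pi.single j 1 ∈ l
  reflect_mem : ∀ x ∈ l, ∀ j, x = Pi.single j 1 ∨
    x - cartanPairing C x j • Pi.single j 1 ∈ l
  exists_pos : ∀ x ∈ l, ∃ j, 0 < cartanPairing C x j
  nonneg : ∀ x ∈ l, ∀ j, 0 ≤ x j
  highest_mem : m ∈ l
  le_highest : ∀ x ∈ l, ∀ j, x j ≤ m j
  nodup : l.Nodup

/-- Checks the bounds `N` for the numbers of vectors of `F` whose coefficients vanish on a set
of labels, and for the numbers of vectors that also may have there the coefficients of `m`. -/
def checkCounts {r : ℕ} (m : Fin r → ℤ) (N : ℕ → ℕ) :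
    List (Fin r) → List (Fin r → ℤ) → List (Fin r → ℤ) → ℕ → Bool
  | [], F, G, n => decide (F.length ≤ N (r - n)) &&
      (decide (n = 0) || decide (F.length + G.length ≤ N (r + 1 - n)))
  | j :: js, F, G, n => checkCounts m N js F G n &&
      checkCounts m N js (F.filter fun x => x j = 0) (G.filter fun x => x j = m j) (n + 1)

theorem checkCounts_filter {r : ℕ} {m : Fin r → ℤ} {N : ℕ → ℕ} (K : Fin r → Bool) :
    ∀ (js : List (Fin r)) (F G : List (Fin r → ℤ)) (n : ℕ), checkCounts m N js F G n = true →
      checkCounts m N [] (F.filter fun x => ∀ j ∈ js, K j = true → x j = 0)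
        (G.filter fun x => ∀ j ∈ js, K j = true → x j = m j) (n + js.countP K) = true
  | [], F, G, n, h => by simpa using h
  | j :: js, F, G, n, h => by
    rw [checkCounts, Bool.and_eq_true] at h
    by_cases hj : K j = true
    · have := checkCounts_filter K js _ _ _ h.2
      rw [List.filter_filter, List.filter_filter] at this
      rw [List.countP_cons_of_pos hj, add_comm _ 1, ← add_assoc]
      convert this using 3 <;> (ext x; simp [hj, Bool.and_comm])
    · have := checkCounts_filter K js _ _ _ h.1
      rw [List.countP_cons_of_neg hj]
      convert this using 3 <;> simp [hj]

namespace IsPosRootList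

variable {ι M N : Type*} [Finite ι] [AddCommGroup M] [Module ℝ M]
    [AddCommGroup N] [Module ℝ N] {Φ : RootPairing ι ℝ M N} [Φ.IsRootSystem]
    [Φ.IsCrystallographic] [Φ.IsReduced] {b : Φ.Base}
    {r : ℕ} {α : Fin (r + 1) → ι} (hα : IsExtendedSimpleSystem b α)
    {C : Matrix (Fin r) (Fin r) ℤ} {l : List (Fin r → ℤ)} {m : Fin r → ℤ}

/-- Simple coroots as functionals on coefficient vectors. -/
def corootFun (C : Matrix (Fin r) (Fin r) ℤ) (j : Fin r) : (Fin r → ℝ) →ₗ[ℝ] ℝ :=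
  ∑ i, (C i j : ℝ) • LinearMap.proj i

omit [Finite ι] [Φ.IsCrystallographic] [Φ.IsReduced] in
theorem equivFun_simple (j : Fin r) :
    hα.basis.equivFun (Φ.root (α j.succ)) = fun k => ((Pi.single j 1 : Fin r → ℤ) k : ℝ) := by
  ext k
  rw [← hα.basis_apply, Module.Basis.equivFun_self, Pi.single_apply]
  simp [eq_comm]

theorem corootFun_apply (x : Fin r → ℤ) (j : Fin r) :
    corootFun C j (fun k => (x k : ℝ)) = cartanPairing C x j := by
  simp [corootFun, cartanPairing, mul_comm]

omit [Finite ι] [Φ.IsReduced] in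
theorem coroot'_eq (hT : ∀ i j : Fin r, Φ.pairingIn ℤ (α i.succ) (α j.succ) = C i j)
    (j : Fin r) (x : M) :
    Φ.coroot' (α j.succ) x = corootFun C j (hα.basis.equivFun.toLinearMap x) := by
  refine hα.coroot'_eq_of_basis (fun i j => ?_) j x
  rw [LinearEquiv.coe_coe, equivFun_simple, corootFun_apply, hT]
  simp [cartanPairing, Pi.single_apply]

theorem exists_root (h : IsPosRootList C l m)
    (hT : ∀ i j : Fin r, Φ.pairingIn ℤ (α i.succ) (α j.succ) = C i j) (i : ι) :
    ∃ x ∈ l, (∀ k, hα.basis.repr (Φ.root i) k = x k) ∨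
      ∀ k, hα.basis.repr (Φ.root i) k = -x k := by
  refine hα.root_mem_of_reflection (S := {y | ∃ x ∈ l, (∀ k, hα.basis.repr y k = x k) ∨
      ∀ k, hα.basis.repr y k = -x k}) (fun j => ?_) ?_ ?_ i
  · exact ⟨_, h.single_mem j, .inl fun k => congrFun (equivFun_simple hα j) k⟩
  · rintro y ⟨x, hx, hy | hy⟩
    · exact ⟨x, hx, .inr fun k => by simp [hy]⟩
    · exact ⟨x, hx, .inl fun k => by simp [hy]⟩
  · have key (y : M) (x : Fin r → ℤ) (hy : ∀ k, hα.basis.repr y k = x k) (j k : Fin r) :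
        hα.basis.repr (y - Φ.coroot' (α j.succ) y • Φ.root (α j.succ)) k =
          ((x - cartanPairing C x j • Pi.single j 1 : Fin r → ℤ) k : ℝ) := by
      have h1 : hα.basis.equivFun y = fun k => (x k : ℝ) := funext hy
      have h2 := congrFun (equivFun_simple hα j) k
      rw [Module.Basis.equivFun_apply] at h2
      rw [coroot'_eq hα hT, LinearEquiv.coe_coe, h1, corootFun_apply, map_sub, map_smul,
        Finsupp.sub_apply, Finsupp.smul_apply, h2, hy]
      simp
    have hpos (y : M) (x : Fin r → ℤ) (hx : x ∈ l) (hy : ∀ k, hα.basis.repr y k = x k)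
        (j : Fin r) : ∃ x ∈ l,
          (∀ k, hα.basis.repr (y - Φ.coroot' (α j.succ) y • Φ.root (α j.succ)) k = x k) ∨
          ∀ k, hα.basis.repr (y - Φ.coroot' (α j.succ) y • Φ.root (α j.succ)) k = -x k := by
      rcases h.reflect_mem x hx j with rfl | hx'
      · refine ⟨_, h.single_mem j, .inr fun k => ?_⟩
        have h1 : y = Φ.root (α j.succ) := by
          apply hα.basis.equivFun.injective
          rw [equivFun_simple]
          exact funext hy
        have h2 := congrFun (equivFun_simple hα j) k
        rw [Module.Basis.equivFun_apply] at h2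
        rw [h1, Φ.root_coroot'_eq_pairing, Φ.pairing_same, ← h2]
        simp only [map_sub, map_smul, Finsupp.sub_apply, Finsupp.smul_apply, smul_eq_mul]
        ring
      · exact ⟨_, hx', .inl fun k => key y x hy j k⟩
    rintro y ⟨x, hx, hy | hy⟩ j
    · exact hpos y x hx hy j
    · obtain ⟨x', hx', h'⟩ := hpos (-y) x hx (fun k => by simp [hy]) j
      have h3 : -y - Φ.coroot' (α j.succ) (-y) • Φ.root (α j.succ) =
          -(y - Φ.coroot' (α j.succ) y • Φ.root (α j.succ)) := by
        rw [map_neg]; module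
      rw [h3] at h'
      refine ⟨x', hx', h'.symm.imp (fun h k => ?_) (fun h k => ?_)⟩
      · have := h k
        rw [map_neg, Finsupp.neg_apply] at this
        linarith
      · have := h k
        rw [map_neg, Finsupp.neg_apply] at this
        linarith

omit [Finite ι] [Φ.IsReduced] in
theorem mem_attained (h : IsPosRootList C l m)
    (hT : ∀ i j : Fin r, Φ.pairingIn ℤ (α i.succ) (α j.succ) = C i j)
    {J : Set (Fin (r + 1))} {x : Fin r → ℤ} (hx : x ∈ l) (hJ : ∀ k, x k ≠ 0 → k.succ ∈ J) :
    (fun k => (x k : ℝ)) ∈ attained Φ α hα.basis.equivFun.toLinearMap J := by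
  induction hn : (∑ k, x k).toNat using Nat.strong_induction_on generalizing x with
  | _ n ih =>
  have hsimple (j : Fin r) (hj : j.succ ∈ J) :
      (fun k => ((Pi.single j 1 : Fin r → ℤ) k : ℝ)) ∈
        attained Φ α hα.basis.equivFun.toLinearMap J := by
    rw [← equivFun_simple hα]
    exact simple_mem_attained hj
  obtain ⟨j, hj⟩ := h.exists_pos x hx
  rcases h.reflect_mem x hx j with rfl | hx'
  · exact hsimple j (hJ j (by simp))
  set p := cartanPairing C x j with hp
  set x' := x - p • Pi.single j 1 with hx'_def
  have hself : 0 ≤ x j - p := by simpa [hx'_def] using h.nonneg _ hx' j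
  have hjJ : j.succ ∈ J := hJ j (by omega)
  have hne (k : Fin r) (hk : k ≠ j) : x' k = x k := by simp [hx'_def, hk]
  have hsum : ∑ k, x' k = (∑ k, x k) - p := by
    simp [hx'_def, Finset.sum_sub_distrib, ← Finset.mul_sum]
  have hnn : 0 ≤ ∑ k, x' k := Finset.sum_nonneg fun k _ => h.nonneg _ hx' k
  have h1 := ih (∑ k, x' k).toNat (by omega) hx' (fun k hk => by
    by_cases hkj : k = j
    · rwa [hkj]
    · exact hJ k (by rwa [← hne k hkj])) rfl
  have hp2 : cartanPairing C x' j = -p := by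
    have hCjj : C j j = 2 := by
      rw [← hT, Φ.pairingIn_same]
    have : cartanPairing C x' j = p - p * C j j := by
      simp only [cartanPairing, hx'_def, Pi.sub_apply, Pi.smul_apply, sub_mul,
        Finset.sum_sub_distrib, hp, smul_eq_mul, mul_assoc, ← Finset.mul_sum]
      simp [Pi.single_apply]
    rw [this, hCjj]
    ring
  have h2 := reflection_mem_attained (coroot'_eq hα hT) hjJ h1 (by
    rw [corootFun_apply, hp2]
    push_cast
    have : (0 : ℝ) < p := by exact_mod_cast hj
    linarith)
  convert h2 using 1
  ext k
  rw [corootFun_apply, hp2, LinearEquiv.coe_coe, equivFun_simple]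
  simp [hx'_def]

theorem mark_eq (h : IsPosRootList C l m)
    (hT : ∀ i j : Fin r, Φ.pairingIn ℤ (α i.succ) (α j.succ) = C i j) (k : Fin r) :
    hα.mark k = m k := by
  apply le_antisymm
  · obtain ⟨x, hx, h1 | h1⟩ := h.exists_root hα hT (α 0)
    · have h2 := hα.one_le_mark k
      rw [IsExtendedSimpleSystem.mark, h1] at h2
      have h3 : (0 : ℝ) ≤ x k := by exact_mod_cast h.nonneg x hx k
      linarith
    · rw [IsExtendedSimpleSystem.mark, h1, neg_neg]
      exact_mod_cast h.le_highest x hx k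
  · obtain ⟨i, -, hi⟩ := h.mem_attained hα hT (J := Set.univ) h.highest_mem
      (fun _ _ => Set.mem_univ _)
    have h1 := hα.repr_le_mark i k
    have h2 := congrFun hi k
    simp only [LinearEquiv.coe_coe, Module.Basis.equivFun_apply] at h2
    rwa [h2] at h1

omit [Finite ι] [Φ.IsCrystallographic] [Φ.IsReduced] in
/-- Roots of `Σ_J^+` have coefficients outside `J` proportional to those of `α_0`. -/
theorem exists_repr_eq {J : Set (Fin (r + 1))} {y : M}
    (hy : y ∈ AddSubmonoid.closure ((fun j => Φ.root (α j)) '' J)) :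
    ∃ a : ℕ, (0 ∉ J → a = 0) ∧
      ∀ k : Fin r, k.succ ∉ J → hα.basis.repr y k = -(a * hα.mark k) := by
  induction hy using AddSubmonoid.closure_induction with
  | mem y hy =>
    obtain ⟨j, hj, rfl⟩ := hy
    induction j using Fin.cases with
    | zero => exact ⟨1, fun h => absurd hj h, fun k _ => by simp [IsExtendedSimpleSystem.mark]⟩
    | succ j =>
      refine ⟨0, fun _ => rfl, fun k hk => ?_⟩
      simp only
      rw [← hα.basis_apply, Module.Basis.repr_self, Finsupp.single_apply, if_neg]
      · simp
      · rintro rfl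
        exact hk hj
  | zero => exact ⟨0, fun _ => rfl, by simp⟩
  | add x y _ _ hx hy =>
    obtain ⟨a, ha0, ha⟩ := hx
    obtain ⟨c, hc0, hc⟩ := hy
    refine ⟨a + c, fun h => by rw [ha0 h, hc0 h], fun k hk => ?_⟩
    rw [map_add, Finsupp.add_apply, ha k hk, hc k hk]
    push_cast
    ring

include hα in
theorem ncard_parabolicPos_le (h : IsPosRootList C l m)
    (hT : ∀ i j : Fin r, Φ.pairingIn ℤ (α i.succ) (α j.succ) = C i j) {B : ℕ → ℕ}
    (hB : checkCounts m B (List.finRange r) l l 0 = true)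
    {J : Set (Fin (r + 1))} (hJ : J ≠ Set.univ) :
    (parabolicPos Φ α J).ncard ≤ B J.ncard := by
  classical
  let K : Fin r → Bool := fun k => decide (k.succ ∉ J)
  set F := l.filter fun x => ∀ k ∈ List.finRange r, K k = true → x k = 0 with hF
  set G := l.filter fun x => ∀ k ∈ List.finRange r, K k = true → x k = m k with hG
  have hcheck := checkCounts_filter K _ _ _ _ hB
  rw [← hF, ← hG, zero_add] at hcheck
  have hmF {x : Fin r → ℤ} : x ∈ F ↔ x ∈ l ∧ ∀ k : Fin r, k.succ ∉ J → x k = 0 := by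
    simp [hF, K]
  have hmG {x : Fin r → ℤ} : x ∈ G ↔ x ∈ l ∧ ∀ k : Fin r, k.succ ∉ J → x k = m k := by
    simp [hG, K]
  choose x hx hxr using h.exists_root hα hT
  have hinj : Set.InjOn x (parabolicPos Φ α J) := by
    intro i hi i' hi' hii'
    have hne := hα.root_ne_neg_of_mem_parabolicPos hJ hi hi'
    rw [← Φ.root.injective.eq_iff]
    by_contra hne'
    rcases hxr i with h1 | h1 <;> rcases hxr i' with h2 | h2 <;> rw [hii'] at h1
    · exact hne' (hα.basis.ext_elem fun k => by rw [h1, h2])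
    · exact hne (hα.basis.ext_elem fun k => by simp [h1, h2])
    · exact hne (hα.basis.ext_elem fun k => by simp [h1, h2])
    · exact hne' (hα.basis.ext_elem fun k => by rw [h1, h2])
  have hbound (L : List (Fin r → ℤ)) (hL : ∀ i ∈ parabolicPos Φ α J, x i ∈ L) :
      (parabolicPos Φ α J).ncard ≤ L.length := by
    refine le_trans ?_ L.toFinset_card_le
    rw [← Set.ncard_coe_finset]
    exact Set.ncard_le_ncard_of_injOn x (fun i hi => by simpa using hL i hi) hinj
      (Finset.finite_toSet _)
  have hxabs (i : ι) {k : Fin r} {a : ℕ} (ha : hα.basis.repr (Φ.root i) k = -(a * hα.mark k)) :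
      x i k = a * m k := by
    rw [h.mark_eq hα hT] at ha
    have hm : 0 ≤ m k := h.nonneg _ h.highest_mem k
    have hx0 := h.nonneg _ (hx i) k
    have h0 : 0 ≤ (a : ℤ) * m k := by positivity
    rcases hxr i with h1 | h1
    · rw [h1] at ha
      have : x i k = -(a * m k) := by exact_mod_cast ha
      omega
    · rw [h1] at ha
      have : -x i k = -(a * m k) := by exact_mod_cast ha
      omega
  have hcardK : (Finset.univ.filter fun k : Fin r => k.succ ∈ J).card +
      (List.finRange r).countP K = r := by
    have h1 : (List.finRange r).countP K =
        (Finset.univ.filter fun k : Fin r => k.succ ∉ J).card := by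
      rw [List.countP_eq_length_filter,
        ← List.toFinset_card_of_nodup ((List.nodup_finRange r).filter _)]
      congr 1
      ext k
      simp [K]
    rw [h1, Finset.card_filter_add_card_filter_not, Finset.card_univ, Fintype.card_fin]
  have hcardJ : J.ncard = (Finset.univ.filter fun k : Fin r => k.succ ∈ J).card +
      if 0 ∈ J then 1 else 0 := by
    have h1 : J.ncard = (Finset.univ.filter fun k : Fin (r + 1) => k ∈ J).card := by
      rw [← Set.ncard_coe_finset]
      simp
    rw [h1, Fin.card_filter_univ_succ]
    split_ifs <;> rfl
  rw [checkCounts, Bool.and_eq_true, Bool.or_eq_true, decide_eq_true_iff, decide_eq_true_iff,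
    decide_eq_true_iff] at hcheck
  by_cases h0 : 0 ∈ J
  · rw [if_pos h0] at hcardJ
    obtain ⟨k₀, hk₀⟩ : ∃ k : Fin r, k.succ ∉ J := by
      by_contra! hall
      exact hJ (Set.eq_univ_of_forall fun j => Fin.cases h0 hall j)
    have hK : (List.finRange r).countP K ≠ 0 := by
      rw [Ne, List.countP_eq_zero]
      intro hall
      exact hall k₀ (List.mem_finRange _) (by simp [K, hk₀])
    have h1 := hcheck.2.resolve_left hK
    rw [show J.ncard = r + 1 - (List.finRange r).countP K by omega]
    refine le_trans (hbound (F ++ G) fun i hi => ?_) (by simpa using h1)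
    obtain ⟨a, -, ha⟩ := exists_repr_eq hα (mem_parabolicPos_iff.mp hi)
    have ha' (k : Fin r) (hk : k.succ ∉ J) := hxabs i (ha k hk)
    have ha1 : a ≤ 1 := by
      have h2 := h.le_highest _ (hx i) k₀
      have h3 : (1 : ℝ) ≤ m k₀ := by
        rw [← h.mark_eq hα hT]
        exact hα.one_le_mark k₀
      have h4 : (1 : ℤ) ≤ m k₀ := by exact_mod_cast h3
      rw [ha' k₀ hk₀] at h2
      have : (a : ℤ) ≤ 1 := by
        by_contra! hlt
        nlinarith
      omega
    rw [List.mem_append]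
    rcases (by omega : a = 0 ∨ a = 1) with rfl | rfl
    · exact .inl (hmF.mpr ⟨hx i, fun k hk => by rw [ha' k hk]; simp⟩)
    · exact .inr (hmG.mpr ⟨hx i, fun k hk => by rw [ha' k hk]; simp⟩)
  · rw [if_neg h0] at hcardJ
    rw [show J.ncard = r - (List.finRange r).countP K by omega]
    refine le_trans (hbound F fun i hi => ?_) hcheck.1
    obtain ⟨a, ha0, ha⟩ := exists_repr_eq hα (mem_parabolicPos_iff.mp hi)
    obtain rfl := ha0 h0
    exact hmF.mpr ⟨hx i, fun k hk => by rw [hxabs i (ha k hk)]; simp⟩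

include hα in
theorem hasMaxCounts {T : DynkinType r} (h : IsPosRootList T.cartanMatrix l m)
    (hT : ∀ i j : Fin r, Φ.pairingIn ℤ (α i.succ) (α j.succ) = T.cartanMatrix i j)
    (hB : checkCounts m T.maxCount (List.finRange r) l l 0 = true)
    (hbij : Function.Bijective T.optimalOrder)
    (hcount : ∀ i : Fin (r + 1), T.maxCount (r - i) ≤ (l.filter fun x => ∀ k : Fin r, x k = 0 ∨
      ∃ k', i < k' ∧ T.optimalOrder k' = k.succ).length) :
    HasMaxCounts Φ α T where
  le J hJ := h.ncard_parabolicPos_le hα hT hB hJ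
  exists_perm := by
    classical
    refine ⟨Equiv.ofBijective _ hbij, fun k => rfl, fun i => ?_⟩
    refine (hcount i).trans ?_
    rw [← List.toFinset_card_of_nodup (h.nodup.filter _)]
    refine card_le_ncard_parabolicPos _ (fun x k => (x k : ℝ)) (fun x _ y _ hxy => ?_)
      (fun x hx => ?_) (L := hα.basis.equivFun.toLinearMap)
    · ext k
      simpa using congrFun hxy k
    · simp only [List.mem_toFinset, List.mem_filter, decide_eq_true_eq] at hx
      refine h.mem_attained hα hT hx.1 fun k hk => ?_
      obtain ⟨k', hk', hkk⟩ := (hx.2 k).resolve_left hk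
      exact ⟨k', hk', hkk⟩

end IsPosRootList

end RootPeeling

namespace RootPeeling

open Matrix

/-- The coefficient vector that is coded by a decimal number, the lowest digit being the first
coefficient. -/
def digitVec (r c : ℕ) : Fin r → ℤ := fun i => ((c / 10 ^ (i : ℕ) % 10 : ℕ) : ℤ)

/-- The positive roots of `E₈`. -/
def codesE : List ℕ :=
  [10000000, 1000000, 100000, 10000, 1000, 100, 10, 1, 11000000, 1100000, 110000, 11000, 1100,
   1010, 101, 11100000, 1110000, 111000, 11100, 11010, 1110, 1101, 11110000, 1111000, 111100,
   111010, 11110, 11101, 1111, 11111000, 1111100, 1111010, 111110, 12110, 111101, 11111,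
   11111100, 11111010, 1111110, 112110, 1111101, 111111, 12111, 11111110, 1112110, 122110,
   11111101, 1111111, 112111, 12211, 11112110, 1122110, 11111111, 1112111, 122111, 112211,
   11122110, 1222110, 11112111, 1122111, 1112211, 122211, 11222110, 11122111, 1222111, 11112211,
   1122211, 123211, 12222110, 11222111, 11122211, 1222211, 1123211, 123221, 12222111, 11222211,
   11123211, 1223211, 1123221, 12222211, 11223211, 1233211, 11123221, 1223221, 12223211,
   11233211, 11223221, 1233221, 12233211, 12223221, 11233221, 1234221, 12333211, 12233221,
   11234221, 1234321, 12333221, 12234221, 11234321, 1234322, 12334221, 12234321, 11234322,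
   12344221, 12334321, 12234322, 12344321, 12334322, 12345321, 12344322, 12345331, 12345322,
   12345422, 12345332, 12345432, 12346432, 12356432, 12456432, 13456432, 23456432]

/-- The positive roots of `E_r`. -/
def posRootsE (r : ℕ) : List (Fin r → ℤ) :=
  (codesE.filter fun c => c < 10 ^ r).map (digitVec r)

/-- The positive roots of `F₄`. -/
def posRootsF : List (Fin 4 → ℤ) :=
  List.map (digitVec 4)
  [1000, 100, 10, 1, 1100, 110, 11, 1110, 210, 111, 1210, 1111, 211, 2210, 1211, 221, 2211, 1221,
   2221, 1321, 2321, 2421, 2431, 2432]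

/-- The positive roots of `G₂`. -/
def posRootsG : List (Fin 2 → ℤ) :=
  List.map (digitVec 2)
  [10, 1, 11, 21, 31, 32]

theorem isPosRootList_G : IsPosRootList CartanMatrix.G₂ posRootsG ![2, 3] where
  single_mem := by decide +kernel
  reflect_mem := by decide +kernel
  exists_pos := by decide +kernel
  nonneg := by decide +kernel
  highest_mem := by decide +kernel
  le_highest := by decide +kernel
  nodup := by decide +kernel

theorem isPosRootList_F : IsPosRootList CartanMatrix.F₄ posRootsF ![2, 3, 4, 2] where
  single_mem := by decide +kernel
  reflect_mem := by decide +kernel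
  exists_pos := by decide +kernel
  nonneg := by decide +kernel
  highest_mem := by decide +kernel
  le_highest := by decide +kernel
  nodup := by decide +kernel

theorem isPosRootList_E6 : IsPosRootList CartanMatrix.E₆ (posRootsE 6) ![1, 2, 2, 3, 2, 1] where
  single_mem := by decide +kernel
  reflect_mem := by decide +kernel
  exists_pos := by decide +kernel
  nonneg := by decide +kernel
  highest_mem := by decide +kernel
  le_highest := by decide +kernel
  nodup := by decide +kernel

theorem isPosRootList_E7 : IsPosRootList CartanMatrix.E₇ (posRootsE 7) ![2, 2, 3, 4, 3, 2, 1] where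
  single_mem := by decide +kernel
  reflect_mem := by decide +kernel
  exists_pos := by decide +kernel
  nonneg := by decide +kernel
  highest_mem := by decide +kernel
  le_highest := by decide +kernel
  nodup := by decide +kernel

theorem isPosRootList_E8 : IsPosRootList CartanMatrix.E₈ (posRootsE 8) ![2, 3, 4, 6, 5, 4, 3, 2] where
  single_mem := by decide +kernel
  reflect_mem := by decide +kernel
  exists_pos := by decide +kernel
  nonneg := by decide +kernel
  highest_mem := by decide +kernel
  le_highest := by decide +kernel
  nodup := by decide +kernel

variable {ι M N : Type*} [Finite ι] [AddCommGroup M] [Module ℝ M]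
    [AddCommGroup N] [Module ℝ N] {Φ : RootPairing ι ℝ M N} [Φ.IsRootSystem]
    [Φ.IsCrystallographic] [Φ.IsReduced] {b : Φ.Base}

theorem hasMaxCounts_G {α : Fin 3 → ι} (hα : IsExtendedSimpleSystem b α)
    (hT : ∀ i j : Fin 2, Φ.pairingIn ℤ (α i.succ) (α j.succ) = CartanMatrix.G₂ i j) :
    HasMaxCounts Φ α .G₂ :=
  isPosRootList_G.hasMaxCounts hα (T := .G₂) hT
    (by decide +kernel) (by decide +kernel) (by decide +kernel)

theorem hasMaxCounts_F {α : Fin 5 → ι} (hα : IsExtendedSimpleSystem b α)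
    (hT : ∀ i j : Fin 4, Φ.pairingIn ℤ (α i.succ) (α j.succ) = CartanMatrix.F₄ i j) :
    HasMaxCounts Φ α .F₄ :=
  isPosRootList_F.hasMaxCounts hα (T := .F₄) hT
    (by decide +kernel) (by decide +kernel) (by decide +kernel)

theorem hasMaxCounts_E6 {α : Fin 7 → ι} (hα : IsExtendedSimpleSystem b α)
    (hT : ∀ i j : Fin 6, Φ.pairingIn ℤ (α i.succ) (α j.succ) = CartanMatrix.E₆ i j) :
    HasMaxCounts Φ α .E₆ :=
  isPosRootList_E6.hasMaxCounts hα (T := .E₆) hT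
    (by decide +kernel) (by decide +kernel) (by decide +kernel)

theorem hasMaxCounts_E7 {α : Fin 8 → ι} (hα : IsExtendedSimpleSystem b α)
    (hT : ∀ i j : Fin 7, Φ.pairingIn ℤ (α i.succ) (α j.succ) = CartanMatrix.E₇ i j) :
    HasMaxCounts Φ α .E₇ :=
  isPosRootList_E7.hasMaxCounts hα (T := .E₇) hT
    (by decide +kernel) (by decide +kernel) (by decide +kernel)

theorem hasMaxCounts_E8 {α : Fin 9 → ι} (hα : IsExtendedSimpleSystem b α)
    (hT : ∀ i j : Fin 8, Φ.pairingIn ℤ (α i.succ) (α j.succ) = CartanMatrix.E₈ i j) :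
    HasMaxCounts Φ α .E₈ :=
  isPosRootList_E8.hasMaxCounts hα (T := .E₈) hT
    (by decide +kernel) (by decide +kernel) (by decide +kernel)

end RootPeeling

namespace RootPeeling

open Matrix

namespace DynkinType

variable {r : ℕ}

theorem rank_pos (T : DynkinType r) : 0 < r := by
  cases T <;> omega

theorem optimalOrder_zero (T : DynkinType r) : T.optimalOrder 0 = 0 := by
  cases T
  case D hr =>
    refine Equiv.swap_apply_of_ne_of_ne ?_ ?_ <;>
    · rw [Ne, Fin.ext_iff, Fin.val_zero]
      simp only
      omega
  all_goals rfl

theorem strictAnti_optimalNumbers (T : DynkinType r) : StrictAnti T.optimalNumbers := by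
  cases T
  case D hr =>
    intro i j hij
    simp only [optimalNumbers]
    have := Fin.lt_def.mp hij
    split_ifs <;> omega
  case A | B | C =>
    intro i j hij
    simp only [optimalNumbers]
    have := Fin.lt_def.mp hij
    omega
  all_goals
    unfold StrictAnti
    decide

theorem optimalNumbers_last (T : DynkinType r) {i : Fin r} (hi : (i : ℕ) + 1 = r) :
    T.optimalNumbers i = 1 := by
  cases T
  case A | B | C | D =>
    simp only [optimalNumbers]
    grind
  all_goals
    revert hi
    revert i
    decide

end DynkinType

variable {ι M N : Type*} [AddCommGroup M] [Module ℝ M]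
    [AddCommGroup N] [Module ℝ N] {Φ : RootPairing ι ℝ M N} {b : Φ.Base}
    {r : ℕ} {α : Fin (r + 1) → ι}

theorem parabolicPos_comp (σ : Equiv.Perm (Fin (r + 1))) (J : Set (Fin (r + 1))) :
    parabolicPos Φ (α ∘ σ) J = parabolicPos Φ α (σ '' J) := by
  ext i
  rw [mem_parabolicPos_iff, mem_parabolicPos_iff, Set.image_image]
  rfl

theorem remaining_mul (σ p : Equiv.Perm (Fin (r + 1))) (i : Fin (r + 1)) :
    remaining (σ * p) i = σ '' remaining p i := by
  rw [remaining, remaining, Set.image_image]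
  rfl

theorem remaining_ne_univ (p : Equiv.Perm (Fin (r + 1))) (i : Fin (r + 1)) :
    remaining p i ≠ Set.univ := by
  intro h
  obtain ⟨k, hk, hkp⟩ := h.symm ▸ Set.mem_univ (p 0)
  rw [p.injective hkp] at hk
  exact absurd hk (Fin.not_lt_zero i)

theorem ncard_remaining (p : Equiv.Perm (Fin (r + 1))) (i : Fin (r + 1)) :
    (remaining p i).ncard = r - i := by
  rw [remaining, Set.ncard_image_of_injective _ p.injective,
    show {k | i < k} = ((Finset.Ioi i : Finset (Fin (r + 1))) : Set (Fin (r + 1))) by ext; simp,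
    Set.ncard_coe_finset, Fin.card_Ioi]
  omega

theorem remaining_zero {p : Equiv.Perm (Fin (r + 1))} (hp : p 0 = 0) :
    remaining p 0 = Set.range Fin.succ := by
  ext j
  constructor
  · rintro ⟨k, hk, rfl⟩
    refine Fin.exists_succ_eq.mpr fun h => ?_
    rw [← hp] at h
    exact absurd (p.injective h) (ne_of_gt hk)
  · rintro ⟨j, rfl⟩
    refine ⟨p.symm j.succ, Fin.pos_iff_ne_zero.mpr fun h => ?_, p.apply_symm_apply _⟩
    rw [Equiv.symm_apply_eq, hp] at h
    exact absurd h (Fin.succ_ne_zero j)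

theorem isPos_iff_mem_closure (b : Φ.Base) {i : ι} :
    b.IsPos i ↔ Φ.root i ∈ AddSubmonoid.closure (Φ.root '' (b.support : Set ι)) := by
  classical
  have hsum {x : M} (hx : x ∈ AddSubmonoid.closure (Φ.root '' (b.support : Set ι))) :
      ∃ f : ι → ℤ, 0 ≤ f ∧ x = ∑ j ∈ b.support, f j • Φ.root j := by
    induction hx using AddSubmonoid.closure_induction with
    | mem x hx =>
      obtain ⟨j, hj, rfl⟩ := hx
      refine ⟨Pi.single j 1, by simp, ?_⟩
      rw [Finset.sum_eq_single_of_mem j hj (by simp_all)]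
      simp
    | zero => exact ⟨0, le_rfl, by simp⟩
    | add x y _ _ hx hy =>
      obtain ⟨f, hf, rfl⟩ := hx
      obtain ⟨g, hg, rfl⟩ := hy
      exact ⟨f + g, add_nonneg hf hg, by simp [add_smul, Finset.sum_add_distrib]⟩
  have hpos {i : ι} (h : Φ.root i ∈ AddSubmonoid.closure (Φ.root '' (b.support : Set ι))) :
      b.IsPos i := by
    obtain ⟨f, hf, hx⟩ := hsum h
    rw [b.isPos_iff', RootPairing.Base.height_eq_sum hx]
    exact Finset.sum_nonneg fun j _ => hf j
  refine ⟨fun h => (b.root_mem_or_neg_mem i).resolve_right fun h' => ?_, hpos⟩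
  rw [show -Φ.root i = Φ.root (Φ.reflectionPerm i i) by simp] at h'
  exact (RootPairing.Base.IsPos.neg_iff_not b i).mp (hpos h') h

namespace IsExtendedSimpleSystem

variable (hα : IsExtendedSimpleSystem b α)

include hα in
theorem comp {σ : Equiv.Perm (Fin (r + 1))} (hσ : σ 0 = 0) :
    IsExtendedSimpleSystem b (α ∘ σ) := by
  have hmaps (τ : Equiv.Perm (Fin (r + 1))) (hτ : τ 0 = 0) (j : Fin r) :
      ∃ k : Fin r, τ j.succ = k.succ := by
    obtain ⟨k, hk⟩ := Fin.exists_succ_eq.mpr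
      (show τ j.succ ≠ 0 from fun h => Fin.succ_ne_zero j (τ.injective (h.trans hτ.symm)))
    exact ⟨k, hk.symm⟩
  refine ⟨⟨fun j _ => ?_, fun j _ k _ hjk => ?_, fun i hi => ?_⟩, fun i => ?_⟩
  · obtain ⟨k, hk⟩ := hmaps σ hσ j
    simp only [Function.comp_apply, hk]
    exact hα.bijOn_succ.mapsTo (Set.mem_univ k)
  · obtain ⟨j', hj⟩ := hmaps σ hσ j
    obtain ⟨k', hk⟩ := hmaps σ hσ k
    simp only [Function.comp_apply, hj, hk] at hjk
    have := hα.bijOn_succ.injOn (Set.mem_univ _) (Set.mem_univ _) hjk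
    rw [this, ← hk] at hj
    exact Fin.succ_injective _ (σ.injective hj)
  · obtain ⟨j, -, rfl⟩ := hα.bijOn_succ.surjOn hi
    obtain ⟨k, hk⟩ := hmaps σ.symm (by rw [Equiv.symm_apply_eq, hσ]) j
    refine ⟨k, Set.mem_univ _, ?_⟩
    simp only [Function.comp_apply, ← hk, Equiv.apply_symm_apply]
  · simpa [hσ] using hα.lowest i

include hα in
theorem hasMaxCounts [Finite ι] [Φ.IsRootSystem] [Φ.IsCrystallographic] [Φ.IsReduced]
    (T : DynkinType r)
    (hT : ∀ i j : Fin r, Φ.pairingIn ℤ (α i.succ) (α j.succ) = T.cartanMatrix i j) :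
    HasMaxCounts Φ α T := by
  cases T with
  | A _ hr => exact hasMaxCounts_A hα hr hT
  | B _ hr => exact hasMaxCounts_B hα hr hT
  | C _ hr => exact hasMaxCounts_C hα hr hT
  | D _ hr => exact hasMaxCounts_D hα hr hT
  | E₆ => exact hasMaxCounts_E6 hα hT
  | E₇ => exact hasMaxCounts_E7 hα hT
  | E₈ => exact hasMaxCounts_E8 hα hT
  | F₄ => exact hasMaxCounts_F hα hT
  | G₂ => exact hasMaxCounts_G hα hT

include hα in
theorem setOf_isPos_eq : {i | b.IsPos i} = parabolicPos Φ α (Set.range Fin.succ) := by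
  ext i
  rw [mem_parabolicPos_iff, ← Set.range_comp, Set.mem_ofPred_eq]
  exact (isPos_iff_mem_closure b).trans (by rw [hα.image_support]; rfl)

end IsExtendedSimpleSystem

/-- With the counts of the type `T`, a permutation is optimal iff it attains all bounds. -/
theorem HasMaxCounts.isOptimalPeeling_iff {T : DynkinType r} {σ : Equiv.Perm (Fin (r + 1))}
    (h : HasMaxCounts Φ (α ∘ σ) T) (p₀ : Equiv.Perm (Fin (r + 1))) :
    IsOptimalPeeling b α p₀ ↔
      ∀ i : Fin (r + 1), (parabolicPos Φ α (remaining p₀ i)).ncard = T.maxCount (r - i) := by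
  have hle (p : Equiv.Perm (Fin (r + 1))) (i : Fin (r + 1)) :
      (parabolicPos Φ α (remaining p i)).ncard ≤ T.maxCount (r - i) := by
    have h1 := h.le (remaining (σ⁻¹ * p) i) (remaining_ne_univ _ _)
    rwa [ncard_remaining, parabolicPos_comp, ← remaining_mul, mul_inv_cancel_left] at h1
  obtain ⟨p, -, hp⟩ := h.exists_perm
  constructor
  · intro h0 i
    refine le_antisymm (hle p₀ i) ((hp i).trans ?_)
    have h1 := h0 (σ * p) i
    rw [peeled, peeled, remaining_mul, ← parabolicPos_comp] at h1
    omega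
  · intro h0 q i
    have h1 := hle q i
    rw [peeled, peeled, h0]
    omega

theorem HasMaxCounts.exists_isOptimalPeeling {T : DynkinType r} {σ : Equiv.Perm (Fin (r + 1))}
    (h : HasMaxCounts Φ (α ∘ σ) T) : ∃ p₀ : Equiv.Perm (Fin (r + 1)),
      (∀ k, p₀ k = σ (T.optimalOrder k)) ∧ IsOptimalPeeling b α p₀ := by
  obtain ⟨p, hpT, hp⟩ := h.exists_perm
  refine ⟨σ * p, fun k => by rw [Equiv.Perm.mul_apply, hpT], ?_⟩
  rw [h.isOptimalPeeling_iff]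
  intro i
  rw [remaining_mul, ← parabolicPos_comp]
  refine le_antisymm ?_ (hp i)
  have := h.le _ (remaining_ne_univ p i)
  rwa [ncard_remaining] at this

theorem HasMaxCounts.peelingNumber_succ {T : DynkinType r} {σ p₀ : Equiv.Perm (Fin (r + 1))}
    (h : HasMaxCounts Φ (α ∘ σ) T) (h₀ : IsOptimalPeeling b α p₀) (i : Fin r) :
    peelingNumber b α p₀ i.succ = T.optimalNumbers i := by
  rw [h.isOptimalPeeling_iff] at h₀
  rw [peelingNumber, Fin.cases_succ, peeled, peeled, h₀, h₀, Fin.val_succ, Fin.val_castSucc]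
  have h1 := T.maxCount_succ (k := r - (i + 1)) (by omega)
  simp only [show r - ((i : ℕ) + 1) + 1 = r - i by omega] at h1
  rw [h1, show (⟨r - (r - (i : ℕ)), by omega⟩ : Fin r) = i from
    Fin.ext (show r - (r - (i : ℕ)) = i by omega)]
  push_cast
  ring

theorem HasMaxCounts.peelingNumber_zero [Φ.IsRootSystem] {T : DynkinType r}
    {σ p₀ : Equiv.Perm (Fin (r + 1))}
    (hα : IsExtendedSimpleSystem b α) (hσ : σ 0 = 0) (h : HasMaxCounts Φ (α ∘ σ) T)
    (h₀ : IsOptimalPeeling b α p₀) : peelingNumber b α p₀ 0 = 0 := by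
  obtain ⟨p, hpT, hp⟩ := h.exists_isOptimalPeeling (b := b)
  rw [h.isOptimalPeeling_iff] at h₀ hp
  have hp0 : p 0 = 0 := by rw [hpT, T.optimalOrder_zero, hσ]
  rw [peelingNumber, Fin.cases_zero, peeled, h₀, ← hp, remaining_zero hp0, hα.setOf_isPos_eq,
    sub_self]

end RootPeeling

theorem lemma3p1 {ι M N : Type*} [Finite ι] [AddCommGroup M] [Module ℝ M]
    [AddCommGroup N] [Module ℝ N] (Φ : RootPairing ι ℝ M N) [Φ.IsRootSystem]
    [Φ.IsCrystallographic] [Φ.IsReduced] [Φ.IsIrreducible] (b : Φ.Base)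
    {r : ℕ} (α : Fin (r + 1) → ι) (hα : RootPeeling.IsExtendedSimpleSystem b α) :
    (∃ p₀ : Equiv.Perm (Fin (r + 1)), RootPeeling.IsOptimalPeeling b α p₀) ∧
    (∃ (T : RootPeeling.DynkinType r) (σ : Equiv.Perm (Fin (r + 1))),
      RootPeeling.IsLabelling Φ α T σ) ∧
    (∀ (T : RootPeeling.DynkinType r) (σ : Equiv.Perm (Fin (r + 1))),
      RootPeeling.IsLabelling Φ α T σ →
      (∀ p₀ : Equiv.Perm (Fin (r + 1)), RootPeeling.IsOptimalPeeling b α p₀ →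
        ∀ i : Fin r,
          RootPeeling.peelingNumber b α p₀ i.succ = (T.optimalNumbers i : ℤ)) ∧
      (∃ p₀ : Equiv.Perm (Fin (r + 1)),
        (∀ k, p₀ k = σ (T.optimalOrder k)) ∧ RootPeeling.IsOptimalPeeling b α p₀)) ∧
    (∀ p₀ : Equiv.Perm (Fin (r + 1)), RootPeeling.IsOptimalPeeling b α p₀ →
      RootPeeling.peelingNumber b α p₀ 0 = 0 ∧
      StrictAnti (fun i : Fin r => RootPeeling.peelingNumber b α p₀ i.succ) ∧
      RootPeeling.peelingNumber b α p₀ (Fin.last r) = 1) := by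
  have hcounts (T : RootPeeling.DynkinType r) (σ : Equiv.Perm (Fin (r + 1)))
      (h : RootPeeling.IsLabelling Φ α T σ) : RootPeeling.HasMaxCounts Φ (α ∘ σ) T :=
    (hα.comp h.1).hasMaxCounts T h.2
  obtain ⟨T, σ, hTσ⟩ := hα.exists_isLabelling
  have h := hcounts T σ hTσ
  refine ⟨?_, ⟨T, σ, hTσ⟩, fun T' σ' h' => ⟨fun p₀ h₀ i => ?_, ?_⟩, fun p₀ h₀ => ⟨?_, ?_, ?_⟩⟩
  · obtain ⟨p₀, -, h₀⟩ := h.exists_isOptimalPeeling (b := b)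
    exact ⟨p₀, h₀⟩
  · exact (hcounts T' σ' h').peelingNumber_succ h₀ i
  · exact (hcounts T' σ' h').exists_isOptimalPeeling
  · exact h.peelingNumber_zero hα hTσ.1 h₀
  · intro i j hij
    simp only [h.peelingNumber_succ h₀]
    exact_mod_cast T.strictAnti_optimalNumbers hij
  · have hr := T.rank_pos
    have hlast : Fin.last r = Fin.succ ⟨r - 1, by omega⟩ := by
      ext
      simp only [Fin.val_last, Fin.val_succ]
      omega
    rw [hlast, h.peelingNumber_succ h₀, T.optimalNumbers_last (by simp only; omega),
      Nat.cast_one]
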